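/- Let $n\ge 1$, fix constants $a>0$, $c_0>1$, $c_1>0$, and let $\mathbf R^{1+n}_+=\{(t,x):t>0,\ x\in\mathbf R^n\}$ with Lebesgue measure $dt\,dx$. For $(t,x)\in\mathbf R^{1+n}_+$ let $W(t,x)=\{(s,y): |y-x|<c_1t,\ c_0^{-1}<s/t<c_0\}$, and for $1\le q\le\infty$ and real-valued measurable $f$ on $\mathbf R^{1+n}_+$ let $(W_qf)(t,x)=|W(t,x)|^{-1/q}\|f\|_{L_q(W(t,x))}$. For $F:\mathbf R^{1+n}_+\to[0,\infty]$ let $$N_*F(y)=\sup_{t>0,\ |x-y|\le at}F(t,x),\qquad CF(y)=\sup_{Q\ni y}\frac1{|Q|}\iint_{(0,\ell(Q))\times Q}F\,dt\,dx,\qquad y\in\mathbf R^n,$$ the last supremum being over all axis-parallel cubes $Q\subset\mathbf R^n$ containing $y$, with sidelength $\ell(Q)$. Let $N_{p,q}$ be the space of (a.e. equivalence classes of) $f$ with $\|f\|_{N_{p,q}}=\|N_*(W_qf)\|_{L_p(\mathbf R^n)}<\infty$, and $C_{p,q}$ the space of $g$ with $\|g\|_{C_{p,q}}=\|C(W_qg)\|_{L_p(\mathbf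 R^n)}<\infty$. Theorem. Let $1\le p<\infty$, $1\le q\le\infty$, $1/p+1/p'=1$ and $1/q+1/q'=1$. Then $N_{p,q}$ and $C_{p',q'}$ are Banach spaces, $fg$ is integrable for all $f\in N_{p,q}$, $g\in C_{p',q'}$, and the pairing $\langle f,g\rangle=\iint_{\mathbf R^{1+n}_+}fg\,dt\,dx$ induces linear maps $g\mapsto\langle\cdot,g\rangle$, $C_{p',q'}\to(N_{p,q})^*$, and $f\mapsto\langle f,\cdot\rangle$, $N_{p,q}\to(C_{p',q'})^*$, which are isomorphisms (linear homeomorphisms, in general not isometric) onto their ranges. Identifying each space with its range: 1. $C_{p',q'}\subsetneqq(N_{p,q})^*$ for all $1\le p<\infty$ and $1\le q\le\infty$; 2. $N_{1,q}\subsetneqq(C_{\infty,q'})^*$ for all $1\le q\le\infty$; 3. $N_{p,q}=(C_{p',q'})^*$ if $1<q\le\infty$ and $1<p<\infty$. In particular, $\mathcal X=N_{2,2}$ is the dual space of $C_{2,2}$, and $\mathcal X$ is not reflexive. -/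

import Mathlib

open MeasureTheory Set Filter Topology
open scoped ENNReal NNReal

namespace CarlesonDuality

/-! ### Extended norms and the normed space of elements of finite extended norm -/

/-- A norm on a real vector space `V` which is allowed to take the value `∞`. -/
structure ExtNorm (V : Type*) [AddCommGroup V] [Module ℝ V] where
  toFun : V → ℝ≥0∞
  add_le' : ∀ f g, toFun (f + g) ≤ toFun f + toFun g
  smul' : ∀ (r : ℝ) f, toFun (r • f) = ENNReal.ofReal |r| * toFun f
  eq_zero' : ∀ f, toFun f = 0 → f = 0

namespace ExtNorm

variable {V : Type*} [AddCommGroup V] [Module ℝ V] (φ : ExtNorm V)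

theorem map_zero : φ.toFun 0 = 0 := by
  have h := φ.smul' 0 0
  simpa using h

/-- The space of all elements of finite extended norm. -/
def finite : Submodule ℝ V where
  carrier := {f | φ.toFun f < ∞}
  zero_mem' := by simp [map_zero]
  add_mem' := fun {f g} hf hg => (φ.add_le' f g).trans_lt (ENNReal.add_lt_top.2 ⟨hf, hg⟩)
  smul_mem' := fun r f hf => by
    simp only [mem_ofPred_eq, φ.smul']
    exact ENNReal.mul_lt_top ENNReal.ofReal_lt_top hf

noncomputable instance : Norm φ.finite := ⟨fun f => (φ.toFun f.1).toReal⟩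

theorem norm_def (f : φ.finite) : ‖f‖ = (φ.toFun f.1).toReal := rfl

theorem core : NormedSpace.Core ℝ φ.finite where
  norm_nonneg f := ENNReal.toReal_nonneg
  norm_smul r f := by
    simp [norm_def, φ.smul', ENNReal.toReal_mul]
  norm_triangle f g := by
    simp only [norm_def]
    rw [← ENNReal.toReal_add (ne_of_lt f.2) (ne_of_lt g.2)]
    exact ENNReal.toReal_mono (ENNReal.add_ne_top.2 ⟨ne_of_lt f.2, ne_of_lt g.2⟩)
      (φ.add_le' f.1 g.1)
  norm_eq_zero_iff f := by
    constructor
    · intro h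
      rcases (ENNReal.toReal_eq_zero_iff _).1 h with h | h
      · exact Subtype.ext (φ.eq_zero' _ h)
      · exact absurd h (ne_of_lt f.2)
    · rintro rfl
      simp [norm_def, map_zero]

noncomputable instance : NormedAddCommGroup φ.finite := NormedAddCommGroup.ofCore φ.core

noncomputable instance : NormedSpace ℝ φ.finite := NormedSpace.ofCore φ.core

end ExtNorm

/-! ### The half space, Whitney averages, maximal functions and Carleson functionals -/

/-- The upper half space `{(t, x) | t > 0, x ∈ ℝⁿ}`. -/
def halfSpace (n : ℕ) : Set (ℝ × EuclideanSpace ℝ (Fin n)) := {z | 0 < z.1}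

/-- Lebesgue measure `dt dx` on the upper half space. -/
noncomputable def halfVol (n : ℕ) : Measure (ℝ × EuclideanSpace ℝ (Fin n)) :=
  volume.restrict (halfSpace n)

/-- Real-valued measurable functions on the upper half space, modulo equality almost everywhere. -/
abbrev HalfFun (n : ℕ) : Type := (ℝ × EuclideanSpace ℝ (Fin n)) →ₘ[halfVol n] ℝ

/-- The fixed aperture `a` of the cones and the fixed shape constants `c₀`, `c₁` of the
Whitney regions. -/
structure Shape where
  a : ℝ
  c₀ : ℝ
  c₁ : ℝ
  a_pos : 0 < a
  one_lt_c₀ : 1 < c₀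
  c₁_pos : 0 < c₁

variable {n : ℕ}

/-- The Whitney region `W(t, x) = {(s, y) | |y - x| < c₁ t, c₀⁻¹ < s / t < c₀}`, `z = (t, x)`. -/
def whitney (S : Shape) (z : ℝ × EuclideanSpace ℝ (Fin n)) :
    Set (ℝ × EuclideanSpace ℝ (Fin n)) :=
  {w | ‖w.2 - z.2‖ < S.c₁ * z.1 ∧ S.c₀⁻¹ < w.1 / z.1 ∧ w.1 / z.1 < S.c₀}

/-- The Whitney averaged function `W_q f (t, x) = |W(t, x)|^{-1/q} ‖f‖_{L_q(W(t, x))}`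
(the essential supremum of `|f|` over `W(t, x)` if `q = ∞`). -/
noncomputable def whitneyAvg (S : Shape) (q : ℝ≥0∞) (f : ℝ × EuclideanSpace ℝ (Fin n) → ℝ)
    (z : ℝ × EuclideanSpace ℝ (Fin n)) : ℝ≥0∞ :=
  volume (whitney S z) ^ (-(q⁻¹).toReal) * eLpNorm f q (volume.restrict (whitney S z))

/-- The non-tangential maximal function `N_* F (y) = sup {F (t, x) | t > 0, |x - y| ≤ a t}`. -/
noncomputable def ntMax (S : Shape) (F : ℝ × EuclideanSpace ℝ (Fin n) → ℝ≥0∞)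
    (y : EuclideanSpace ℝ (Fin n)) : ℝ≥0∞ :=
  ⨆ (z : ℝ × EuclideanSpace ℝ (Fin n)) (_ : 0 < z.1 ∧ ‖z.2 - y‖ ≤ S.a * z.1), F z

/-- The axis-parallel cube in `ℝⁿ` with lower corner `v` and sidelength `l`. -/
def cube (v : EuclideanSpace ℝ (Fin n)) (l : ℝ) : Set (EuclideanSpace ℝ (Fin n)) :=
  {x | ∀ i, v i < x i ∧ x i < v i + l}

/-- The Carleson box `(0, ℓ(Q)) × Q` over the cube `Q`. -/
def box (v : EuclideanSpace ℝ (Fin n)) (l : ℝ) : Set (ℝ × EuclideanSpace ℝ (Fin n)) :=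
  Ioo 0 l ×ˢ cube v l

/-- The Carleson functional `C F (y) = sup_{Q ∋ y} |Q|⁻¹ ∬_{(0, ℓ(Q)) × Q} F dt dx`, where the
supremum is over all axis-parallel cubes `Q` containing `y`. -/
noncomputable def carleson (F : ℝ × EuclideanSpace ℝ (Fin n) → ℝ≥0∞)
    (y : EuclideanSpace ℝ (Fin n)) : ℝ≥0∞ :=
  ⨆ (v : EuclideanSpace ℝ (Fin n)) (l : ℝ) (_ : 0 < l ∧ y ∈ cube v l),
    (volume (cube v l))⁻¹ * ∫⁻ w in box v l, F w

/-- `‖N_* (W_q f)‖_{L_p(ℝⁿ)}`, possibly infinite. -/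
noncomputable def ntENorm (S : Shape) (p q : ℝ≥0∞) (f : ℝ × EuclideanSpace ℝ (Fin n) → ℝ) :
    ℝ≥0∞ :=
  eLpNorm (ntMax S (whitneyAvg S q f)) p volume

/-- `‖C (W_q g)‖_{L_p(ℝⁿ)}`, possibly infinite. -/
noncomputable def carlesonENorm (S : Shape) (p q : ℝ≥0∞)
    (g : ℝ × EuclideanSpace ℝ (Fin n) → ℝ) : ℝ≥0∞ :=
  eLpNorm (carleson (whitneyAvg S q g)) p volume

/-! ### Auxiliary facts showing that these expressions are extended norms -/

theorem isOpen_halfSpace : IsOpen (halfSpace n) := isOpen_lt continuous_const continuous_fst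

theorem whitney_eq (S : Shape) {z : ℝ × EuclideanSpace ℝ (Fin n)} (hz : 0 < z.1) :
    whitney S z = Ioo (S.c₀⁻¹ * z.1) (S.c₀ * z.1) ×ˢ Metric.ball z.2 (S.c₁ * z.1) := by
  ext w
  simp only [whitney, mem_ofPred_eq, mem_prod, mem_Ioo, Metric.mem_ball, dist_eq_norm,
    lt_div_iff₀ hz, div_lt_iff₀ hz]
  tauto

theorem whitney_eq_empty (S : Shape) {z : ℝ × EuclideanSpace ℝ (Fin n)} (hz : z.1 ≤ 0) :
    whitney S z = ∅ := by
  ext w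
  simp only [whitney, mem_ofPred_eq, mem_empty_iff_false, iff_false, not_and]
  intro h
  have := norm_nonneg (w.2 - z.2)
  nlinarith [S.c₁_pos]

theorem whitney_subset (S : Shape) (z : ℝ × EuclideanSpace ℝ (Fin n)) :
    whitney S z ⊆ halfSpace n := by
  rcases lt_or_ge 0 z.1 with hz | hz
  · rw [whitney_eq S hz]
    rintro w ⟨h, -⟩
    have : 0 < S.c₀⁻¹ * z.1 := mul_pos (inv_pos.2 (by linarith [S.one_lt_c₀])) hz
    exact this.trans h.1
  · simp [whitney_eq_empty S hz]

theorem isOpen_whitney (S : Shape) (z : ℝ × EuclideanSpace ℝ (Fin n)) : IsOpen (whitney S z) := by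
  rcases lt_or_ge 0 z.1 with hz | hz
  · rw [whitney_eq S hz]
    exact isOpen_Ioo.prod Metric.isOpen_ball
  · simp [whitney_eq_empty S hz]

theorem mem_whitney_self (S : Shape) {z : ℝ × EuclideanSpace ℝ (Fin n)} (hz : 0 < z.1) :
    z ∈ whitney S z := by
  simp only [whitney, mem_ofPred_eq, sub_self, norm_zero, div_self hz.ne']
  exact ⟨mul_pos S.c₁_pos hz, inv_lt_one_of_one_lt₀ S.one_lt_c₀, S.one_lt_c₀⟩

theorem eventually_mem_whitney (S : Shape) {z w : ℝ × EuclideanSpace ℝ (Fin n)} (hz : 0 < z.1)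
    (hw : w ∈ whitney S z) : ∀ᶠ z' in 𝓝 z, w ∈ whitney S z' := by
  have h1 : ContinuousAt (fun z' : ℝ × EuclideanSpace ℝ (Fin n) => w.1 / z'.1) z :=
    continuousAt_const.div continuousAt_fst hz.ne'
  have h2 : ContinuousAt (fun z' : ℝ × EuclideanSpace ℝ (Fin n) => ‖w.2 - z'.2‖) z := by fun_prop
  have h3 : ContinuousAt (fun z' : ℝ × EuclideanSpace ℝ (Fin n) => S.c₁ * z'.1) z := by fun_prop
  exact (h2.eventually_lt h3 hw.1).and
    ((continuousAt_const.eventually_lt h1 hw.2.1).and (h1.eventually_lt continuousAt_const hw.2.2))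

theorem volume_whitney (S : Shape) {z : ℝ × EuclideanSpace ℝ (Fin n)} (hz : 0 < z.1) :
    volume (whitney S z) = ENNReal.ofReal (S.c₀ * z.1 - S.c₀⁻¹ * z.1) *
      (ENNReal.ofReal ((S.c₁ * z.1) ^ n) *
        volume (Metric.ball (0 : EuclideanSpace ℝ (Fin n)) 1)) := by
  rw [whitney_eq S hz, Measure.volume_eq_prod, Measure.prod_prod, Real.volume_Ioo,
    Measure.addHaar_ball_of_pos _ _ (mul_pos S.c₁_pos hz)]
  simp

theorem volume_whitney_pos (S : Shape) {z : ℝ × EuclideanSpace ℝ (Fin n)} (hz : 0 < z.1) :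
    0 < volume (whitney S z) :=
  (isOpen_whitney S z).measure_pos _ ⟨z, mem_whitney_self S hz⟩

theorem volume_whitney_lt_top (S : Shape) (z : ℝ × EuclideanSpace ℝ (Fin n)) :
    volume (whitney S z) < ∞ := by
  rcases lt_or_ge 0 z.1 with hz | hz
  · rw [volume_whitney S hz]
    exact ENNReal.mul_lt_top ENNReal.ofReal_lt_top
      (ENNReal.mul_lt_top ENNReal.ofReal_lt_top measure_ball_lt_top)
  · simp [whitney_eq_empty S hz]

theorem continuousAt_volume_whitney (S : Shape) {z : ℝ × EuclideanSpace ℝ (Fin n)}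
    (hz : 0 < z.1) : ContinuousAt (fun z => (volume (whitney (n := n) S z)).toReal) z := by
  have h : (fun z => (volume (whitney (n := n) S z)).toReal) =ᶠ[𝓝 z]
      fun z => max (S.c₀ * z.1 - S.c₀⁻¹ * z.1) 0 * (max ((S.c₁ * z.1) ^ n) 0 *
        (volume (Metric.ball (0 : EuclideanSpace ℝ (Fin n)) 1)).toReal) := by
    filter_upwards [isOpen_halfSpace.mem_nhds (show z ∈ halfSpace n from hz)] with z' hz'
    rw [volume_whitney S hz', ENNReal.toReal_mul, ENNReal.toReal_mul, ENNReal.toReal_ofReal',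
      ENNReal.toReal_ofReal']
  refine ContinuousAt.congr ?_ h.symm
  fun_prop

theorem restrict_le (S : Shape) (z : ℝ × EuclideanSpace ℝ (Fin n)) :
    volume.restrict (whitney S z) ≤ halfVol n :=
  Measure.restrict_mono (whitney_subset S z) le_rfl

theorem aesm_restrict (S : Shape) (z : ℝ × EuclideanSpace ℝ (Fin n))
    {f : ℝ × EuclideanSpace ℝ (Fin n) → ℝ} (hf : AEStronglyMeasurable f (halfVol n)) :
    AEStronglyMeasurable f (volume.restrict (whitney S z)) :=
  hf.mono_measure (restrict_le S z)

theorem whitneyAvg_congr (S : Shape) (q : ℝ≥0∞) {f g : ℝ × EuclideanSpace ℝ (Fin n) → ℝ}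
    (h : f =ᵐ[halfVol n] g) : whitneyAvg S q f = whitneyAvg S q g := by
  funext z
  simp only [whitneyAvg]
  rw [eLpNorm_congr_ae (h.filter_mono (ae_mono (restrict_le S z)))]

theorem whitneyAvg_add_le (S : Shape) {q : ℝ≥0∞} (hq : 1 ≤ q)
    {f g : ℝ × EuclideanSpace ℝ (Fin n) → ℝ} (hf : AEStronglyMeasurable f (halfVol n))
    (hg : AEStronglyMeasurable g (halfVol n)) (z : ℝ × EuclideanSpace ℝ (Fin n)) :
    whitneyAvg S q (f + g) z ≤ whitneyAvg S q f z + whitneyAvg S q g z := by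
  simp only [whitneyAvg]
  rw [← mul_add]
  gcongr
  exact eLpNorm_add_le (aesm_restrict S z hf) (aesm_restrict S z hg) hq

theorem whitneyAvg_smul (S : Shape) (q : ℝ≥0∞) (r : ℝ)
    (f : ℝ × EuclideanSpace ℝ (Fin n) → ℝ) (z : ℝ × EuclideanSpace ℝ (Fin n)) :
    whitneyAvg S q (r • f) z = ENNReal.ofReal |r| * whitneyAvg S q f z := by
  simp only [whitneyAvg]
  rw [eLpNorm_const_smul, Real.enorm_eq_ofReal_abs]
  ring

/-- The normalising factor `|W(t, x)|^{-1/q}` as a real number. -/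
noncomputable def whitneyFactor (S : Shape) (q : ℝ≥0∞) (z : ℝ × EuclideanSpace ℝ (Fin n)) : ℝ :=
  (volume (whitney S z)).toReal ^ (-(q⁻¹).toReal)

theorem enorm_whitneyFactor (S : Shape) (q : ℝ≥0∞) {z : ℝ × EuclideanSpace ℝ (Fin n)}
    (hz : 0 < z.1) : ‖whitneyFactor S q z‖ₑ = volume (whitney S z) ^ (-(q⁻¹).toReal) := by
  have h0 := ENNReal.toReal_pos (volume_whitney_pos S hz).ne' (volume_whitney_lt_top S z).ne
  rw [whitneyFactor, Real.enorm_eq_ofReal (Real.rpow_nonneg h0.le _),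
    ← ENNReal.ofReal_rpow_of_pos h0, ENNReal.ofReal_toReal (volume_whitney_lt_top S z).ne]

theorem continuousAt_whitneyFactor (S : Shape) (q : ℝ≥0∞) {z : ℝ × EuclideanSpace ℝ (Fin n)}
    (hz : 0 < z.1) : ContinuousAt (whitneyFactor S q) z :=
  (continuousAt_volume_whitney S hz).rpow_const (Or.inl
    (ENNReal.toReal_pos (volume_whitney_pos S hz).ne' (volume_whitney_lt_top S z).ne).ne')

theorem whitneyAvg_le_liminf (S : Shape) (q : ℝ≥0∞) {f : ℝ × EuclideanSpace ℝ (Fin n) → ℝ}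
    (hf : AEStronglyMeasurable f (halfVol n)) {z : ℝ × EuclideanSpace ℝ (Fin n)} (hz : 0 < z.1)
    {u : ℕ → ℝ × EuclideanSpace ℝ (Fin n)} (hu : Tendsto u atTop (𝓝 z)) :
    whitneyAvg S q f z ≤ liminf (fun m => eLpNorm (whitneyFactor S q (u m) •
      (whitney S (u m)).indicator f) q (volume.restrict (whitney S z))) atTop := by
  have h : whitneyAvg S q f z =
      eLpNorm (whitneyFactor S q z • f) q (volume.restrict (whitney S z)) := by
    rw [eLpNorm_const_smul, enorm_whitneyFactor S q hz, whitneyAvg]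
  rw [h]
  refine Lp.eLpNorm_lim_le_liminf_eLpNorm
    (fun m => ((aesm_restrict S z hf).indicator (isOpen_whitney S _).measurableSet).const_smul _)
    _ ?_
  filter_upwards [ae_restrict_mem (isOpen_whitney S z).measurableSet] with w hw
  have h1 : Tendsto (fun m => whitneyFactor S q (u m) • f w) atTop
      (𝓝 (whitneyFactor S q z • f w)) :=
    ((continuousAt_whitneyFactor S q hz).tendsto.comp hu).smul_const _
  refine h1.congr' ?_
  filter_upwards [hu.eventually (eventually_mem_whitney S hz hw)] with m hm
  rw [Pi.smul_apply, indicator_of_mem hm]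

theorem whitneyAvg_lsc (S : Shape) (q : ℝ≥0∞) {f : ℝ × EuclideanSpace ℝ (Fin n) → ℝ}
    (hf : AEStronglyMeasurable f (halfVol n)) : LowerSemicontinuous (whitneyAvg S q f) := by
  intro z y hy
  rcases lt_or_ge 0 z.1 with hz | hz
  swap
  · simp [whitneyAvg, whitney_eq_empty S hz] at hy
  by_contra hcon
  obtain ⟨u, hu, hlt⟩ := exists_seq_forall_of_frequently (not_eventually.1 hcon)
  have hlt' : ∀ m, whitneyAvg S q f (u m) ≤ y := fun m => not_lt.1 (hlt m)
  have hev : ∀ᶠ m in atTop, 0 < (u m).1 :=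
    hu.eventually (isOpen_halfSpace.mem_nhds (show z ∈ halfSpace n from hz))
  refine absurd hy (not_lt.2 ((whitneyAvg_le_liminf S q hf hz hu).trans ?_))
  refine liminf_le_of_frequently_le' (Eventually.frequently ?_)
  filter_upwards [hev] with m hm
  refine le_trans ?_ (hlt' m)
  rw [eLpNorm_const_smul, enorm_whitneyFactor S q hm, whitneyAvg]
  gcongr
  rw [← eLpNorm_indicator_eq_eLpNorm_restrict (f := f) (isOpen_whitney S (u m)).measurableSet]
  exact eLpNorm_mono_measure ((whitney S (u m)).indicator f) Measure.restrict_le_self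

theorem whitneyAvg_eq_zero (S : Shape) {q : ℝ≥0∞} (hq : 1 ≤ q)
    {f : ℝ × EuclideanSpace ℝ (Fin n) → ℝ} (hf : AEStronglyMeasurable f (halfVol n))
    (h : ∀ z : ℝ × EuclideanSpace ℝ (Fin n), 0 < z.1 → whitneyAvg S q f z = 0) :
    f =ᵐ[halfVol n] 0 := by
  have hloc : ∀ z ∈ halfSpace n, ∃ t ∈ 𝓝[halfSpace n] z, volume (t ∩ {w | f w ≠ 0}) = 0 := by
    intro z hz
    refine ⟨whitney S z, mem_nhdsWithin_of_mem_nhds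
      ((isOpen_whitney S z).mem_nhds (mem_whitney_self S hz)), ?_⟩
    have h0 := h z hz
    rw [whitneyAvg, mul_eq_zero] at h0
    have h1 : eLpNorm f q (volume.restrict (whitney S z)) = 0 := by
      refine h0.resolve_left fun h2 => ?_
      rcases ENNReal.rpow_eq_zero_iff.1 h2 with h3 | h3
      · exact (volume_whitney_pos S hz).ne' h3.1
      · exact (volume_whitney_lt_top S z).ne h3.1
    rw [eLpNorm_eq_zero_iff (aesm_restrict S z hf) (by positivity)] at h1
    have h2 := (ae_restrict_iff' (isOpen_whitney S z).measurableSet).1 h1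
    refine measure_mono_null ?_ (ae_iff.1 h2)
    rintro w ⟨hw, hne⟩
    simpa [hw] using hne
  have hnull : volume (halfSpace n ∩ {w | f w ≠ 0}) = 0 := by
    refine measure_null_of_locally_null _ fun z hz => ?_
    obtain ⟨t, ht, ht0⟩ := hloc z hz.1
    refine ⟨t ∩ {w | f w ≠ 0}, ?_, ht0⟩
    exact inter_mem (nhdsWithin_mono _ inter_subset_left ht)
      (mem_of_superset self_mem_nhdsWithin inter_subset_right)
  rw [halfVol, EventuallyEq, ae_restrict_iff' isOpen_halfSpace.measurableSet, ae_iff]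
  refine measure_mono_null ?_ hnull
  intro w hw
  simpa using hw

theorem ntMax_lsc (S : Shape) {F : ℝ × EuclideanSpace ℝ (Fin n) → ℝ≥0∞}
    (hF : LowerSemicontinuous F) : LowerSemicontinuous (ntMax S F) := by
  intro y l hl
  simp only [ntMax, lt_iSup_iff] at hl
  obtain ⟨z, hz, hlz⟩ := hl
  have hc : Tendsto (fun y' : EuclideanSpace ℝ (Fin n) => (z.1, z.2 + (y' - y))) (𝓝 y) (𝓝 z) := by
    have : Continuous (fun y' : EuclideanSpace ℝ (Fin n) => (z.1, z.2 + (y' - y))) := by fun_prop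
    simpa using this.tendsto y
  filter_upwards [hc.eventually (hF z l hlz)] with y' hy'
  refine hy'.trans_le (le_iSup₂_of_le (z.1, z.2 + (y' - y)) ⟨hz.1, ?_⟩ le_rfl)
  have he : z.2 + (y' - y) - y' = z.2 - y := by abel
  simpa [he] using hz.2

theorem isOpen_cube (v : EuclideanSpace ℝ (Fin n)) (l : ℝ) : IsOpen (cube v l) := by
  simp only [cube, ofPred_forall]
  refine isOpen_iInter_of_finite fun i => ?_
  have hi : Continuous fun x : EuclideanSpace ℝ (Fin n) => x i := by fun_prop
  exact (isOpen_lt continuous_const hi).inter (isOpen_lt hi continuous_const)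

theorem volume_cube (v : EuclideanSpace ℝ (Fin n)) (l : ℝ) :
    volume (cube v l) = ENNReal.ofReal l ^ n := by
  have h : cube v l = (MeasurableEquiv.toLp 2 (Fin n → ℝ)).symm ⁻¹'
      (Set.pi univ fun i => Ioo (v i) (v i + l)) := by
    ext x
    simp [cube]
  rw [h, (EuclideanSpace.volume_preserving_symm_measurableEquiv_toLp (Fin n)).measure_preimage
    (MeasurableSet.univ_pi fun i => measurableSet_Ioo).nullMeasurableSet, Real.volume_pi_Ioo]
  simp

theorem carleson_lsc (F : ℝ × EuclideanSpace ℝ (Fin n) → ℝ≥0∞) :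
    LowerSemicontinuous (carleson F) := by
  intro y r hr
  simp only [carleson, lt_iSup_iff] at hr
  obtain ⟨v, l, hl, hlt⟩ := hr
  filter_upwards [(isOpen_cube v l).mem_nhds hl.2] with y' hy'
  exact hlt.trans_le (le_iSup₂_of_le v l (le_iSup_of_le (f := fun _ : 0 < l ∧ y' ∈ cube v l =>
    (volume (cube v l))⁻¹ * ∫⁻ w in box v l, F w) ⟨hl.1, hy'⟩ le_rfl))

theorem le_carleson (F : ℝ × EuclideanSpace ℝ (Fin n) → ℝ≥0∞) {v y : EuclideanSpace ℝ (Fin n)}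
    {l : ℝ} (hl : 0 < l ∧ y ∈ cube v l) :
    (volume (cube v l))⁻¹ * ∫⁻ w in box v l, F w ≤ carleson F y :=
  le_iSup₂_of_le v l (le_iSup_of_le (f := fun _ : 0 < l ∧ y ∈ cube v l =>
    (volume (cube v l))⁻¹ * ∫⁻ w in box v l, F w) hl le_rfl)

theorem ntENorm_add_le (S : Shape) {p q : ℝ≥0∞} (hp : 1 ≤ p) (hq : 1 ≤ q)
    {f g : ℝ × EuclideanSpace ℝ (Fin n) → ℝ} (hf : AEStronglyMeasurable f (halfVol n))
    (hg : AEStronglyMeasurable g (halfVol n)) :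
    ntENorm S p q (f + g) ≤ ntENorm S p q f + ntENorm S p q g := by
  refine le_trans (eLpNorm_mono_enorm
    (g := ntMax S (whitneyAvg S q f) + ntMax S (whitneyAvg S q g)) fun y => ?_)
    (eLpNorm_add_le (ntMax_lsc S (whitneyAvg_lsc S q hf)).measurable.aestronglyMeasurable
      (ntMax_lsc S (whitneyAvg_lsc S q hg)).measurable.aestronglyMeasurable hp)
  simp only [enorm_eq_self, Pi.add_apply]
  refine iSup₂_le fun z hz => (whitneyAvg_add_le S hq hf hg z).trans ?_
  exact add_le_add (le_iSup₂_of_le z hz le_rfl) (le_iSup₂_of_le z hz le_rfl)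

theorem carlesonENorm_add_le (S : Shape) {p q : ℝ≥0∞} (hp : 1 ≤ p) (hq : 1 ≤ q)
    {f g : ℝ × EuclideanSpace ℝ (Fin n) → ℝ} (hf : AEStronglyMeasurable f (halfVol n))
    (hg : AEStronglyMeasurable g (halfVol n)) :
    carlesonENorm S p q (f + g) ≤ carlesonENorm S p q f + carlesonENorm S p q g := by
  refine le_trans (eLpNorm_mono_enorm
    (g := carleson (whitneyAvg S q f) + carleson (whitneyAvg S q g)) fun y => ?_)
    (eLpNorm_add_le (carleson_lsc _).measurable.aestronglyMeasurable
      (carleson_lsc _).measurable.aestronglyMeasurable hp)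
  simp only [enorm_eq_self, Pi.add_apply]
  refine iSup₂_le fun v l => iSup_le fun hl => ?_
  calc (volume (cube v l))⁻¹ * ∫⁻ w in box v l, whitneyAvg S q (f + g) w
      ≤ (volume (cube v l))⁻¹ * ∫⁻ w in box v l, (whitneyAvg S q f w + whitneyAvg S q g w) := by
        gcongr with w
        exact whitneyAvg_add_le S hq hf hg w
    _ = (volume (cube v l))⁻¹ * (∫⁻ w in box v l, whitneyAvg S q f w)
        + (volume (cube v l))⁻¹ * ∫⁻ w in box v l, whitneyAvg S q g w := by
        rw [lintegral_add_left (whitneyAvg_lsc S q hf).measurable, mul_add]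
    _ ≤ _ := add_le_add (le_carleson _ hl) (le_carleson _ hl)

theorem eLpNorm_const_mul_ennreal {α : Type*} [MeasurableSpace α] (μ : Measure α) (r : ℝ)
    (p : ℝ≥0∞) (G : α → ℝ≥0∞) :
    eLpNorm (fun y => ENNReal.ofReal |r| * G y) p μ = ENNReal.ofReal |r| * eLpNorm G p μ := by
  rcases eq_or_ne r 0 with rfl | hr
  · simp
  have hc0 : ENNReal.ofReal |r| ≠ 0 := by simpa using hr
  refine le_antisymm (eLpNorm_le_mul_eLpNorm_of_ae_le_mul' (c := Real.toNNReal |r|)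
    (ae_of_all _ fun y => le_rfl) p) (ENNReal.mul_le_of_le_div' ?_)
  rw [ENNReal.div_eq_inv_mul, ← ENNReal.ofReal_inv_of_pos (abs_pos.2 hr)]
  refine eLpNorm_le_mul_eLpNorm_of_ae_le_mul' (c := Real.toNNReal |r|⁻¹)
    (ae_of_all _ fun y => ?_) p
  change G y ≤ ENNReal.ofReal |r|⁻¹ * (ENNReal.ofReal |r| * G y)
  rw [ENNReal.ofReal_inv_of_pos (abs_pos.2 hr), ← mul_assoc,
    ENNReal.inv_mul_cancel hc0 ENNReal.ofReal_ne_top, one_mul]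

theorem ntENorm_smul (S : Shape) (p q : ℝ≥0∞) (r : ℝ)
    (f : ℝ × EuclideanSpace ℝ (Fin n) → ℝ) :
    ntENorm S p q (r • f) = ENNReal.ofReal |r| * ntENorm S p q f := by
  rw [ntENorm, ntENorm, ← eLpNorm_const_mul_ennreal]
  congr 1
  funext y
  simp only [ntMax, whitneyAvg_smul, ENNReal.mul_iSup]

theorem carlesonENorm_smul (S : Shape) (p q : ℝ≥0∞) (r : ℝ)
    (f : ℝ × EuclideanSpace ℝ (Fin n) → ℝ) :
    carlesonENorm S p q (r • f) = ENNReal.ofReal |r| * carlesonENorm S p q f := by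
  rw [carlesonENorm, carlesonENorm, ← eLpNorm_const_mul_ennreal]
  congr 1
  funext y
  simp only [carleson, whitneyAvg_smul, ENNReal.mul_iSup,
    lintegral_const_mul' _ _ ENNReal.ofReal_ne_top]
  refine iSup_congr fun v => iSup_congr fun l => iSup_congr fun _ => ?_
  rw [mul_left_comm]

theorem ae_eq_zero_of_ntENorm (S : Shape) {p q : ℝ≥0∞} (hp : 1 ≤ p) (hq : 1 ≤ q)
    {f : ℝ × EuclideanSpace ℝ (Fin n) → ℝ} (hf : AEStronglyMeasurable f (halfVol n))
    (h : ntENorm S p q f = 0) : f =ᵐ[halfVol n] 0 := by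
  rw [ntENorm, eLpNorm_eq_zero_iff
    (ntMax_lsc S (whitneyAvg_lsc S q hf)).measurable.aestronglyMeasurable (by positivity)] at h
  refine whitneyAvg_eq_zero S hq hf fun z hz => ?_
  obtain ⟨y, hy, hy0⟩ := (Measure.dense_of_ae h).inter_open_nonempty
    (Metric.ball z.2 (S.a * z.1)) Metric.isOpen_ball ⟨z.2, by simp [S.a_pos, hz]⟩
  have hle : whitneyAvg S q f z ≤ ntMax S (whitneyAvg S q f) y := by
    refine le_iSup₂_of_le z ⟨hz, ?_⟩ le_rfl
    rw [Metric.mem_ball, dist_comm, dist_eq_norm] at hy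
    exact hy.le
  have hy1 : ntMax S (whitneyAvg S q f) y = 0 := hy0
  exact le_antisymm (hle.trans hy1.le) bot_le

theorem ae_eq_zero_of_carlesonENorm (S : Shape) {p q : ℝ≥0∞} (hp : 1 ≤ p) (hq : 1 ≤ q)
    {f : ℝ × EuclideanSpace ℝ (Fin n) → ℝ} (hf : AEStronglyMeasurable f (halfVol n))
    (h : carlesonENorm S p q f = 0) : f =ᵐ[halfVol n] 0 := by
  rw [carlesonENorm, eLpNorm_eq_zero_iff
    (carleson_lsc _).measurable.aestronglyMeasurable (by positivity)] at h
  refine whitneyAvg_eq_zero S hq hf fun z hz => ?_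
  by_contra hne
  set l : ℝ := 2 * z.1 with hl
  set v : EuclideanSpace ℝ (Fin n) := WithLp.toLp 2 fun i => z.2 i - z.1 with hv
  have hzc : z.2 ∈ cube v l := fun i => by
    simp only [hv, hl]
    constructor <;> linarith
  obtain ⟨y, hy, hy0⟩ := (Measure.dense_of_ae h).inter_open_nonempty
    (cube v l) (isOpen_cube v l) ⟨z.2, hzc⟩
  have hy1 : carleson (whitneyAvg S q f) y = 0 := hy0
  have hle : (volume (cube v l))⁻¹ * ∫⁻ w in box v l, whitneyAvg S q f w = 0 :=
    le_antisymm ((le_carleson _ ⟨by positivity, hy⟩).trans hy1.le) bot_le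
  have hint : ∫⁻ w in box v l, whitneyAvg S q f w = 0 := by
    refine (mul_eq_zero.1 hle).resolve_left ?_
    rw [volume_cube]
    exact ENNReal.inv_ne_zero.2 (ENNReal.pow_ne_top ENNReal.ofReal_ne_top)
  have hbox : IsOpen (box v l) := isOpen_Ioo.prod (isOpen_cube v l)
  rw [lintegral_eq_zero_iff (whitneyAvg_lsc S q hf).measurable] at hint
  have hae := ae_iff.1 ((ae_restrict_iff' hbox.measurableSet).1 hint)
  have hopen : IsOpen (box v l ∩ {w | 0 < whitneyAvg S q f w}) :=
    hbox.inter ((whitneyAvg_lsc S q hf).isOpen_preimage 0)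
  have hpos := hopen.measure_pos volume
    ⟨z, ⟨⟨hz, by simp only [hl]; linarith⟩, hzc⟩, pos_iff_ne_zero.2 hne⟩
  refine hpos.ne' (measure_mono_null ?_ hae)
  rintro w ⟨hw, hw0⟩
  have hw1 : whitneyAvg S q f w ≠ 0 := ne_of_gt hw0
  simpa [hw] using hw1

/-! ### The spaces -/

/-- The extended norm `f ↦ ‖N_* (W_q f)‖_{L_p}` on functions modulo null sets. -/
noncomputable def ntExtNorm (n : ℕ) (S : Shape) (p q : ℝ≥0∞) [hp : Fact (1 ≤ p)]
    [hq : Fact (1 ≤ q)] : ExtNorm (HalfFun n) where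
  toFun f := ntENorm S p q f
  add_le' f g := by
    rw [ntENorm, whitneyAvg_congr S q (AEEqFun.coeFn_add f g)]
    exact ntENorm_add_le S hp.out hq.out f.aestronglyMeasurable g.aestronglyMeasurable
  smul' r f := by
    rw [ntENorm, whitneyAvg_congr S q (AEEqFun.coeFn_smul r f)]
    exact ntENorm_smul S p q r f
  eq_zero' f h := AEEqFun.ext ((ae_eq_zero_of_ntENorm S hp.out hq.out f.aestronglyMeasurable h).trans
    AEEqFun.coeFn_zero.symm)

/-- The extended norm `g ↦ ‖C (W_q g)‖_{L_p}` on functions modulo null sets. -/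
noncomputable def carlesonExtNorm (n : ℕ) (S : Shape) (p q : ℝ≥0∞) [hp : Fact (1 ≤ p)]
    [hq : Fact (1 ≤ q)] : ExtNorm (HalfFun n) where
  toFun f := carlesonENorm S p q f
  add_le' f g := by
    rw [carlesonENorm, whitneyAvg_congr S q (AEEqFun.coeFn_add f g)]
    exact carlesonENorm_add_le S hp.out hq.out f.aestronglyMeasurable g.aestronglyMeasurable
  smul' r f := by
    rw [carlesonENorm, whitneyAvg_congr S q (AEEqFun.coeFn_smul r f)]
    exact carlesonENorm_smul S p q r f
  eq_zero' f h := AEEqFun.ext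
    ((ae_eq_zero_of_carlesonENorm S hp.out hq.out f.aestronglyMeasurable h).trans
      AEEqFun.coeFn_zero.symm)

/-- The space `N_{p,q}` of all `f` with `‖f‖ = ‖N_* (W_q f)‖_{L_p(ℝⁿ)} < ∞`. -/
abbrev NSpace (n : ℕ) (S : Shape) (p q : ℝ≥0∞) [Fact (1 ≤ p)] [Fact (1 ≤ q)] : Type :=
  (ntExtNorm n S p q).finite

/-- The space `C_{p,q}` of all `g` with `‖g‖ = ‖C (W_q g)‖_{L_p(ℝⁿ)} < ∞`. -/
abbrev CSpace (n : ℕ) (S : Shape) (p q : ℝ≥0∞) [Fact (1 ≤ p)] [Fact (1 ≤ q)] : Type :=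
  (carlesonExtNorm n S p q).finite

end CarlesonDuality

/-!
The half space is cut into dyadic Whitney bricks, one over each dyadic cube of `ℝⁿ`. Replacing
Whitney averages by averages over bricks turns `f` into a function `F k` for each scale `2 ^ k`,
constant on the cubes of that scale, and `N_* (W_q f)` into the supremum `scaleSup F` of the `F k`.
It turns `C (W_q g)` into the dyadic functional `dyCarleson c`, where `c k` is the brick average
weighted by the thickness of the brick, so that `∬ |f g|` becomes `∑ₖ ∫ F k * c k`. The norms of
`N_{p,q}` and `C_{p,q}` are equivalent to their dyadic versions (`exists_ntENorm_equiv`,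
`exists_carlesonENorm_equiv`): a Whitney region meets boundedly many bricks, all of them neighbours
of the given one, and passing to a neighbour does not change the norm of a supremum over scales by
more than a constant (`eLpNorm_scaleSup_scaleShift_le`).

The dyadic functionals are in duality. Carleson's inequality `tsum_lintegral_mul_le`,
`∑ₖ ∫ F k * c k ≤ ∫ scaleSup F * dyCarleson c`, is a summation by parts against the increments of
the running maxima of `F` from large scales to small ones. Conversely each of the two suprema is
linearised by choosing a scale at which it is almost attained; the resulting norming sequences
(`exists_norming_scaleSup`, `exists_norming_dyCarleson`) are bounded because the dyadic maximal
operator is bounded on `L_{p'}`, where `p' > 1`. A norming sequence is carried to the half space by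
gluing norming functions for `L_q` on the single bricks (`exists_norming_on_bricks`). Hence the
pairing is bounded, and bounded below in either variable. Both spaces are complete because their
extended norms are countably subadditive.

The maps into the dual spaces miss the weak-star cluster points of normalised functions whose mass
escapes to the boundary of the half space (`not_surjective_of_escaping`). In `C_{p',q'}` such
functions are carried by thin layers over the unit cube. In `N_{1,q}` they are carried by single
bricks shrinking to a boundary point, and they are tested against a function comparable to `1 / t` on
the bricks above that point, which has a bounded Carleson functional because `n ≥ 1`.

If `1 < p < ∞` and `q > 1`, the exponents `p'` and `q'` are finite and `p' > 1`. Then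
`dyCarleson c` and `∑ₖ c k` have comparable norms (`exists_dyCarleson_equiv`), so dominated
convergence holds in `C_{p',q'}`. A functional on this space thus defines a countably additive
measure `E ↦ Λ (1_E ω)`, where `ω` is a fixed positive element, and its Radon–Nikodym derivative
divided by `ω` represents the functional; the representing function lies in `N_{p,q}` because it is
normed by `C_{p',q'}` (`exists_representation`).

Finally, `C_{2,2}` is a proper closed subspace of `(N_{2,2})^*` which separates the points of
`N_{2,2}`, and a reflexive space has no such subspace in its dual (`not_reflexive_of_separating`).
-/

namespace CarlesonDuality

/-! ### `L_p` norms of extended nonnegative functions -/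

section LpENNReal

variable {α : Type*} [MeasurableSpace α] {μ : Measure α}

theorem eLpNorm_mono_ennreal {p : ℝ≥0∞} {G H : α → ℝ≥0∞} (h : ∀ x, G x ≤ H x) :
    eLpNorm G p μ ≤ eLpNorm H p μ :=
  eLpNorm_mono_enorm fun x => by simpa using h x

theorem eLpNorm_pow_toReal {p : ℝ≥0∞} (hp0 : p ≠ 0) (hp : p ≠ ∞) (G : α → ℝ≥0∞) :
    eLpNorm G p μ ^ p.toReal = ∫⁻ x, G x ^ p.toReal ∂μ := by
  rw [eLpNorm_eq_lintegral_rpow_enorm_toReal hp0 hp, ← ENNReal.rpow_mul,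
    one_div_mul_cancel (ENNReal.toReal_pos hp0 hp).ne', ENNReal.rpow_one]
  simp

/-- **Monotone convergence** for `L_p` norms, including `p = ∞`. -/
theorem eLpNorm_iSup_of_monotone (p : ℝ≥0∞) {G : ℕ → α → ℝ≥0∞} (hG : ∀ m, Measurable (G m))
    (hm : Monotone G) : eLpNorm (fun x => ⨆ m, G m x) p μ = ⨆ m, eLpNorm (G m) p μ := by
  refine le_antisymm ?_ (iSup_le fun m => eLpNorm_mono_ennreal fun x =>
    le_iSup (fun m => G m x) m)
  rcases eq_or_ne p 0 with rfl | hp0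
  · simp
  rcases eq_or_ne p ∞ with rfl | hp
  · simp only [eLpNorm_exponent_top]
    refine essSup_le_of_ae_le _ ?_
    have : ∀ᵐ x ∂μ, ∀ m, G m x ≤ eLpNormEssSup (G m) μ := ae_all_iff.2 fun m => by
      simpa using enorm_ae_le_eLpNormEssSup (G m) μ
    filter_upwards [this] with x hx
    simpa using fun m => (hx m).trans (le_iSup (fun m => eLpNormEssSup (G m) μ) m)
  · have hr := ENNReal.toReal_pos hp0 hp
    have hsup : ∀ u : ℕ → ℝ≥0∞, (⨆ m, u m) ^ p.toReal = ⨆ m, u m ^ p.toReal := fun u =>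
      (ENNReal.orderIsoRpow p.toReal hr).map_iSup u
    rw [← ENNReal.rpow_le_rpow_iff hr, eLpNorm_pow_toReal hp0 hp, hsup]
    simp only [hsup, eLpNorm_pow_toReal hp0 hp]
    rw [lintegral_iSup (fun m => (hG m).pow_const _)]
    exact fun i j hij x => ENNReal.rpow_le_rpow (hm hij x) hr.le

theorem eLpNorm_tsum_le {p : ℝ≥0∞} (hp : 1 ≤ p) {G : ℕ → α → ℝ≥0∞}
    (hG : ∀ m, Measurable (G m)) :
    eLpNorm (fun x => ∑' m, G m x) p μ ≤ ∑' m, eLpNorm (G m) p μ := by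
  have h : (fun x => ∑' m, G m x) = fun x => ⨆ N, (∑ m ∈ Finset.range N, G m) x := by
    funext x
    simp [ENNReal.tsum_eq_iSup_nat]
  rw [h, eLpNorm_iSup_of_monotone]
  · refine iSup_le fun N => (eLpNorm_sum_le (fun m _ => (hG m).aestronglyMeasurable) hp).trans ?_
    exact ENNReal.sum_le_tsum _
  · exact fun N => by
      simpa only [Finset.sum_fn] using Finset.measurable_sum _ fun m _ => hG m
  · refine monotone_nat_of_le_succ fun N x => ?_
    simp [Finset.sum_range_succ]

theorem ae_lt_top_of_eLpNorm {p : ℝ≥0∞} (hp : p ≠ 0) {G : α → ℝ≥0∞} (hG : Measurable G)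
    (h : eLpNorm G p μ < ∞) : ∀ᵐ x ∂μ, G x < ∞ := by
  rcases eq_or_ne p ∞ with rfl | hp'
  · rw [eLpNorm_exponent_top] at h
    filter_upwards [enorm_ae_le_eLpNormEssSup G μ] with x hx
    exact lt_of_le_of_lt (by simpa using hx) h
  · have hr := ENNReal.toReal_pos hp hp'
    have h1 : ∫⁻ x, G x ^ p.toReal ∂μ ≠ ∞ := by
      rw [← eLpNorm_pow_toReal hp hp']
      exact ENNReal.rpow_ne_top_of_nonneg hr.le h.ne
    filter_upwards [ae_lt_top (hG.pow_const _) h1] with x hx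
    simpa [ENNReal.rpow_lt_top_iff_of_pos hr] using hx

theorem one_le_of_conj {p p' : ℝ≥0∞} (h : p⁻¹ + p'⁻¹ = 1) : 1 ≤ p := by
  rw [← ENNReal.inv_le_one, ← h]
  exact le_self_add

theorem conj_one {p' : ℝ≥0∞} (h : (1 : ℝ≥0∞)⁻¹ + p'⁻¹ = 1) : p' = ∞ := by
  rw [inv_one] at h
  have : p'⁻¹ = 0 := by
    have h2 : (1 : ℝ≥0∞) + p'⁻¹ = 1 + 0 := by rw [h, add_zero]
    exact (ENNReal.add_right_inj ENNReal.one_ne_top).1 h2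
  simpa using this

theorem conj_top {p' : ℝ≥0∞} (h : (∞ : ℝ≥0∞)⁻¹ + p'⁻¹ = 1) : p' = 1 := by
  simpa using h

theorem conj_toReal {p p' : ℝ≥0∞} (h : p⁻¹ + p'⁻¹ = 1) (hp : 1 < p) (hp' : p ≠ ∞) :
    p.toReal.HolderConjugate p'.toReal := by
  have : ENNReal.HolderConjugate p p' := ENNReal.holderConjugate_iff.2 h
  refine ENNReal.HolderConjugate.toReal ?_
  exact (ENNReal.toReal_lt_toReal ENNReal.one_ne_top hp').2 hp

theorem conj_ne_top {p p' : ℝ≥0∞} (h : p⁻¹ + p'⁻¹ = 1) (hp : 1 < p) : p' ≠ ∞ := by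
  rintro rfl
  have : p = 1 := by simpa using h
  exact hp.ne' this

theorem conj_gt_one {p p' : ℝ≥0∞} (h : p⁻¹ + p'⁻¹ = 1) (hp : p ≠ ∞) : 1 < p' := by
  refine lt_of_le_of_ne (one_le_of_conj (by rw [add_comm]; exact h)) ?_
  rintro rfl
  exact hp (conj_one (by rw [add_comm]; exact h))

/-- **Hölder's inequality** for extended nonnegative functions and exponents in `[1, ∞]`. -/
theorem lintegral_mul_le_eLpNorm {p p' : ℝ≥0∞} (h : p⁻¹ + p'⁻¹ = 1) {G H : α → ℝ≥0∞}
    (hG : Measurable G) (hH : Measurable H) :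
    ∫⁻ x, G x * H x ∂μ ≤ eLpNorm G p μ * eLpNorm H p' μ := by
  have key : ∀ {G H : α → ℝ≥0∞}, Measurable G → ∫⁻ x, G x * H x ∂μ
      ≤ eLpNorm G 1 μ * eLpNorm H ∞ μ := by
    intro G H hG
    rw [eLpNorm_one_eq_lintegral_enorm, eLpNorm_exponent_top]
    simp only [enorm_eq_self]
    rw [← lintegral_mul_const _ hG]
    refine lintegral_mono_ae ?_
    filter_upwards [enorm_ae_le_eLpNormEssSup H μ] with x hx
    gcongr
    simpa using hx
  rcases (one_le_of_conj h).eq_or_lt with rfl | hp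
  · rw [conj_one h]
    exact key hG
  rcases eq_or_ne p ∞ with rfl | hp'
  · rw [conj_top h, mul_comm]
    simp_rw [mul_comm (G _)]
    exact key hH
  have hc := conj_toReal h hp hp'
  refine (ENNReal.lintegral_mul_le_Lp_mul_Lq μ hc hG.aemeasurable hH.aemeasurable).trans_eq ?_
  rw [eLpNorm_eq_lintegral_rpow_enorm_toReal (by positivity) hp',
    eLpNorm_eq_lintegral_rpow_enorm_toReal
      (by have := conj_gt_one h hp'; positivity) (conj_ne_top h hp)]
  simp

/-- Below the `L_p` norm of `G`, a norming function for `G` in the unit ball of `L_{p'}`. -/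
theorem exists_lt_lintegral_mul [SigmaFinite μ] {p p' : ℝ≥0∞} (h : p⁻¹ + p'⁻¹ = 1)
    {G : α → ℝ≥0∞} (hG : Measurable G) {T : ℝ≥0∞} (hT : T < eLpNorm G p μ) :
    ∃ H : α → ℝ≥0∞, Measurable H ∧ eLpNorm H p' μ ≤ 1 ∧ T ≤ ∫⁻ x, G x * H x ∂μ := by
  rcases (one_le_of_conj h).eq_or_lt with rfl | hp
  · refine ⟨fun _ => 1, measurable_const, ?_, ?_⟩
    · rw [conj_one h, eLpNorm_exponent_top]
      exact essSup_le_of_ae_le _ (ae_of_all _ fun x => by simp)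
    · rw [eLpNorm_one_eq_lintegral_enorm] at hT
      simpa using hT.le
  rcases eq_or_ne p ∞ with rfl | hp'
  · obtain rfl := conj_top h
    have h0 : 0 < μ {x | T < G x} := by
      rw [pos_iff_ne_zero]
      intro h0
      refine not_le.2 hT ?_
      rw [eLpNorm_exponent_top]
      refine essSup_le_of_ae_le _ ?_
      rw [EventuallyLE, ae_iff]
      simpa using h0
    obtain ⟨t, ht, hts, ht0, htt⟩ :=
      Measure.exists_subset_measure_lt_top (measurableSet_lt measurable_const hG) h0
    refine ⟨t.indicator fun _ => (μ t)⁻¹, measurable_const.indicator ht, ?_, ?_⟩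
    · rw [eLpNorm_one_eq_lintegral_enorm]
      simp only [enorm_eq_self]
      rw [lintegral_indicator ht, setLIntegral_const, ENNReal.inv_mul_cancel ht0.ne' htt.ne]
    · calc T = ∫⁻ x in t, T * (μ t)⁻¹ ∂μ := by
            rw [setLIntegral_const, mul_assoc, ENNReal.inv_mul_cancel ht0.ne' htt.ne, mul_one]
        _ ≤ ∫⁻ x in t, G x * (μ t)⁻¹ ∂μ := by
            refine setLIntegral_mono (hG.mul_const _) fun x hx => ?_
            gcongr
            exact (hts hx).le
        _ = _ := by
            rw [← lintegral_indicator ht]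
            refine lintegral_congr fun x => ?_
            by_cases hx : x ∈ t <;> simp [hx]
  have hc := conj_toReal h hp hp'
  have hp0 : p ≠ 0 := by positivity
  have hp'0 : p' ≠ 0 := by have := conj_gt_one h hp'; positivity
  have hr := hc.pos
  -- truncate `G` in value and in space, to make its norm finite
  set g : ℕ → α → ℝ≥0∞ := fun m => (spanningSets μ m).indicator fun x => min (G x) m with hg
  have hgm : ∀ m, Measurable (g m) := fun m =>
    (hG.min measurable_const).indicator (measurableSet_spanningSets μ m)
  have hmono : Monotone g := by
    intro i j hij x
    refine (indicator_le_indicator_of_subset (monotone_spanningSets μ hij)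
      (fun _ => zero_le) x).trans (indicator_le_indicator ?_)
    gcongr
  have hsup : (fun x => ⨆ m, g m x) = G := by
    funext x
    refine le_antisymm (iSup_le fun m => ?_) (le_of_forall_lt fun c hcG => ?_)
    · refine (indicator_le_self _ _ x).trans (min_le_left _ _)
    · obtain ⟨N, hN⟩ := ENNReal.exists_nat_gt (ne_top_of_lt hcG)
      obtain ⟨M, hM⟩ := mem_iUnion.1 ((iUnion_spanningSets μ).symm ▸ mem_univ x)
      refine lt_of_lt_of_le ?_ (le_iSup (fun m => g m x) (max N M))
      have hx : x ∈ spanningSets μ (max N M) := monotone_spanningSets μ (le_max_right _ _) hM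
      simp only [hg, indicator_of_mem hx]
      refine lt_min hcG (hN.trans_le ?_)
      exact_mod_cast le_max_left N M
  rw [← hsup, eLpNorm_iSup_of_monotone p hgm hmono, lt_iSup_iff] at hT
  obtain ⟨m, hm⟩ := hT
  set N := eLpNorm (g m) p μ with hN
  have hN0 : N ≠ 0 := (zero_le.trans_lt hm).ne'
  have hNr : N ^ p.toReal = ∫⁻ x, g m x ^ p.toReal ∂μ := eLpNorm_pow_toReal hp0 hp' _
  have hNt : N ≠ ∞ := by
    have : N ^ p.toReal < ∞ := by
      rw [hNr]
      calc ∫⁻ x, g m x ^ p.toReal ∂μ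
          ≤ ∫⁻ x, (spanningSets μ m).indicator (fun _ => (m : ℝ≥0∞) ^ p.toReal) x ∂μ := by
            refine lintegral_mono fun x => ?_
            by_cases hx : x ∈ spanningSets μ m
            · simp only [hg, indicator_of_mem hx]
              gcongr
              exact min_le_right _ _
            · simp [hg, hx, hr]
        _ = (m : ℝ≥0∞) ^ p.toReal * μ (spanningSets μ m) := by
            rw [lintegral_indicator (measurableSet_spanningSets μ m), setLIntegral_const]
        _ < ∞ := ENNReal.mul_lt_top (ENNReal.rpow_lt_top_of_nonneg hr.le (by simp))
            (measure_spanningSets_lt_top μ m)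
    exact ((ENNReal.rpow_lt_top_iff_of_pos hr).1 this).ne
  have hs : 0 < p.toReal - 1 := hc.sub_one_pos
  -- the extremal function of Hölder's inequality, normalised
  set c := N ^ (p.toReal - 1) with hcdef
  have hc0 : c ≠ 0 := by simp [hcdef, hN0, hNt]
  have hct : c ≠ ∞ := ENNReal.rpow_ne_top_of_nonneg hs.le hNt
  refine ⟨fun x => g m x ^ (p.toReal - 1) * c⁻¹, ((hgm m).pow_const _).mul_const _, ?_, ?_⟩
  · rw [← ENNReal.rpow_le_rpow_iff hc.symm.pos, eLpNorm_pow_toReal hp'0 (conj_ne_top h hp),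
      ENNReal.one_rpow]
    have : ∀ x, (g m x ^ (p.toReal - 1) * c⁻¹) ^ p'.toReal
        = g m x ^ p.toReal * (N ^ p.toReal)⁻¹ := by
      intro x
      rw [ENNReal.mul_rpow_of_nonneg _ _ hc.symm.nonneg, ENNReal.inv_rpow, hcdef,
        ← ENNReal.rpow_mul, ← ENNReal.rpow_mul, hc.sub_one_mul_conj]
    simp_rw [this]
    rw [lintegral_mul_const _ ((hgm m).pow_const _), ← hNr, ENNReal.mul_inv_cancel]
    · simp [hN0, hNt]
    · exact ENNReal.rpow_ne_top_of_nonneg hr.le hNt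
  · have hle : N ≤ ∫⁻ x, g m x * (g m x ^ (p.toReal - 1) * c⁻¹) ∂μ := by
      have : ∀ x, g m x * (g m x ^ (p.toReal - 1) * c⁻¹) = g m x ^ p.toReal * c⁻¹ := by
        intro x
        rw [← mul_assoc]
        congr 1
        nth_rewrite 1 [← ENNReal.rpow_one (g m x)]
        rw [← ENNReal.rpow_add_of_nonneg _ _ zero_le_one hs.le]
        congr 1
        ring
      simp_rw [this]
      rw [lintegral_mul_const _ ((hgm m).pow_const _), ← hNr, ← div_eq_mul_inv, hcdef,
        ← ENNReal.rpow_sub _ _ hN0 hNt]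
      simp
    refine hm.le.trans (hle.trans (lintegral_mono fun x => ?_))
    gcongr
    exact (indicator_le_self _ _ x).trans (min_le_left _ _)

/-- **Duality of `L_p` norms**: up to the factor `2`, a single function in the unit ball of
`L_{p'}` norms `G`, even if `‖G‖_p = ∞`. -/
theorem exists_le_lintegral_mul [SigmaFinite μ] {p p' : ℝ≥0∞} (h : p⁻¹ + p'⁻¹ = 1)
    {G : α → ℝ≥0∞} (hG : Measurable G) :
    ∃ H : α → ℝ≥0∞, Measurable H ∧ eLpNorm H p' μ ≤ 1 ∧
      eLpNorm G p μ ≤ 2 * ∫⁻ x, G x * H x ∂μ := by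
  rcases eq_or_ne (eLpNorm G p μ) 0 with h0 | h0
  · exact ⟨0, measurable_zero, by simp, by simp [h0]⟩
  rcases eq_or_ne (eLpNorm G p μ) ∞ with ht | ht
  · -- superpose functions norming `G` at rapidly growing levels, with summable weights
    have hex : ∀ m : ℕ, ∃ H : α → ℝ≥0∞, Measurable H ∧ eLpNorm H p' μ ≤ 1 ∧
        (2 : ℝ≥0∞) ^ (m + 1) * m ≤ ∫⁻ x, G x * H x ∂μ := fun m =>
      exists_lt_lintegral_mul h hG (by
        rw [ht]
        exact ENNReal.mul_lt_top (ENNReal.pow_lt_top (by simp)) (by simp))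
    choose H hHm hH1 hHT using hex
    have hw : ∑' m : ℕ, (2 : ℝ≥0∞)⁻¹ ^ (m + 1) = 1 := by
      rw [ENNReal.tsum_geometric_add_one, ENNReal.one_sub_inv_two, inv_inv,
        ENNReal.inv_mul_cancel (by simp) (by simp)]
    refine ⟨fun x => ∑' m, (2 : ℝ≥0∞)⁻¹ ^ (m + 1) * H m x,
      Measurable.tsum fun m => (hHm m).const_mul _, ?_, ?_⟩
    · refine (eLpNorm_tsum_le (one_le_of_conj (by rw [add_comm]; exact h))
        fun m => (hHm m).const_mul _).trans (le_trans ?_ hw.le)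
      refine ENNReal.tsum_le_tsum fun m => ?_
      have h2 := eLpNorm_const_mul_ennreal μ ((2 : ℝ)⁻¹ ^ (m + 1)) p' (H m)
      have h3 : ENNReal.ofReal |(2 : ℝ)⁻¹ ^ (m + 1)| = (2 : ℝ≥0∞)⁻¹ ^ (m + 1) := by
        rw [abs_of_pos (by positivity), ENNReal.ofReal_pow (by positivity),
          ENNReal.ofReal_inv_of_pos (by positivity)]
        simp
      rw [h3] at h2
      rw [h2]
      exact (mul_le_mul_right (hH1 m) _).trans_eq (mul_one _)
    · have : ∀ m : ℕ, (m : ℝ≥0∞) ≤ ∫⁻ x, G x * ∑' m, (2 : ℝ≥0∞)⁻¹ ^ (m + 1) * H m x ∂μ := by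
        intro m
        have h2 : (2 : ℝ≥0∞)⁻¹ ^ (m + 1) * (2 ^ (m + 1) * m) = m := by
          rw [← mul_assoc, ← mul_pow, ENNReal.inv_mul_cancel (by simp) (by simp), one_pow, one_mul]
        rw [← h2]
        refine (mul_le_mul_right (hHT m) _).trans ?_
        rw [← lintegral_const_mul _ (show Measurable fun x => G x * H m x from hG.mul (hHm m))]
        refine lintegral_mono fun x => ?_
        rw [mul_left_comm]
        gcongr
        exact ENNReal.le_tsum (f := fun m => (2 : ℝ≥0∞)⁻¹ ^ (m + 1) * H m x) m
      rw [ENNReal.eq_top_of_forall_nnreal_le (x := ∫⁻ x, G x * _ ∂μ)]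
      · simp
      · intro r
        obtain ⟨m, hm⟩ := exists_nat_ge r
        exact le_trans (by exact_mod_cast hm) (this m)
  · obtain ⟨H, hHm, hH1, hHT⟩ := exists_lt_lintegral_mul h hG (ENNReal.half_lt_self h0 ht)
    refine ⟨H, hHm, hH1, ?_⟩
    calc eLpNorm G p μ = 2 * (eLpNorm G p μ / 2) := by
          rw [ENNReal.mul_div_cancel (by simp) (by simp)]
      _ ≤ _ := by gcongr

end LpENNReal

/-! ### Dyadic cubes and dyadic averages -/

/-- Euclidean space `ℝⁿ`, the boundary of the half space. -/
abbrev Eucl (n : ℕ) : Type := EuclideanSpace ℝ (Fin n)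

/-- Index set of the dyadic cubes of `ℝⁿ`: the pair `(k, j)` stands for the half-open cube of
sidelength `2 ^ k` with lower corner `2 ^ k j`. -/
abbrev DyIndex (n : ℕ) : Type := ℤ × (Fin n → ℤ)

section Dyadic

variable {n : ℕ}

/-- Position of the dyadic cube of sidelength `2 ^ k` containing `x`. -/
noncomputable def dyIdx (k : ℤ) (x : Eucl n) : Fin n → ℤ := fun i => ⌊x i / 2 ^ k⌋

/-- The dyadic cube of sidelength `2 ^ k` at position `j`. -/
def dyCube (k : ℤ) (j : Fin n → ℤ) : Set (Eucl n) := {x | dyIdx k x = j}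

/-- The lower corner of the dyadic cube of sidelength `2 ^ k` at position `j`. -/
noncomputable def dyCorner (k : ℤ) (j : Fin n → ℤ) : Eucl n :=
  WithLp.toLp 2 fun i => j i * 2 ^ k

/-- The positions whose coordinates are at most `M` in absolute value. -/
noncomputable def posBox (n : ℕ) (M : ℤ) : Finset (Fin n → ℤ) := Finset.Icc (fun _ => -M) fun _ => M

theorem dyIdx_corner (k : ℤ) (j : Fin n → ℤ) : dyIdx k (dyCorner k j) = j := by
  funext i
  have h : (2 : ℝ) ^ k ≠ 0 := by positivity
  simp [dyIdx, dyCorner, h]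

theorem dyIdx_add_corner (k : ℤ) (x : Eucl n) (m : Fin n → ℤ) :
    dyIdx k (x + dyCorner k m) = dyIdx k x + m := by
  funext i
  have h : (2 : ℝ) ^ k ≠ 0 := by positivity
  simp [dyIdx, dyCorner, add_div, h]

theorem measurable_dyIdx (k : ℤ) : Measurable (dyIdx (n := n) k) := by
  refine measurable_pi_lambda _ fun i => Int.measurable_floor.comp ?_
  fun_prop

theorem measurableSet_dyCube (k : ℤ) (j : Fin n → ℤ) : MeasurableSet (dyCube k j) :=
  measurable_dyIdx k (measurableSet_singleton j)

theorem mem_dyCube_idx (k : ℤ) (x : Eucl n) : x ∈ dyCube k (dyIdx k x) := rfl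

theorem volume_dyCube (k : ℤ) (j : Fin n → ℤ) :
    volume (dyCube k j) = ENNReal.ofReal (2 ^ k) ^ n := by
  have hk : (0 : ℝ) < 2 ^ k := by positivity
  have h : dyCube k j = (MeasurableEquiv.toLp 2 (Fin n → ℝ)).symm ⁻¹'
      (Set.pi univ fun i => Ico (j i * 2 ^ k : ℝ) ((j i + 1) * 2 ^ k)) := by
    ext x
    simp only [dyCube, dyIdx, funext_iff, mem_ofPred_eq, Int.floor_eq_iff, mem_preimage,
      mem_univ_pi, mem_Ico, le_div_iff₀ hk, div_lt_iff₀ hk]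
    rfl
  rw [h, (EuclideanSpace.volume_preserving_symm_measurableEquiv_toLp (Fin n)).measure_preimage
    (MeasurableSet.univ_pi fun i => measurableSet_Ico).nullMeasurableSet, Real.volume_pi_Ico]
  simp [add_mul]

theorem volume_dyCube_ne_zero (k : ℤ) (j : Fin n → ℤ) : volume (dyCube k j) ≠ 0 := by
  rw [volume_dyCube]
  exact pow_ne_zero _ (by simpa using show (0 : ℝ) < 2 ^ k by positivity)

theorem volume_dyCube_ne_top (k : ℤ) (j : Fin n → ℤ) : volume (dyCube k j) ≠ ∞ := by
  rw [volume_dyCube]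
  exact ENNReal.pow_ne_top ENNReal.ofReal_ne_top

theorem dyIdx_floor {k i : ℤ} (h : k ≤ i) (x : Eucl n) :
    dyIdx i x = fun ι => dyIdx k x ι / ((2 ^ (i - k).toNat : ℕ) : ℤ) := by
  funext ι
  simp only [dyIdx]
  rw [← Int.floor_div_natCast, div_div]
  congr 2
  push_cast
  rw [← zpow_natCast, Int.toNat_of_nonneg (by omega), ← zpow_add₀ (by norm_num)]
  congr 1
  ring

/-- Dyadic cubes are nested. -/
theorem dyIdx_eq_of_le {k i : ℤ} (h : k ≤ i) {x y : Eucl n} (hxy : dyIdx k x = dyIdx k y) :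
    dyIdx i x = dyIdx i y := by
  rw [dyIdx_floor h, dyIdx_floor h, hxy]

/-- Points at distance at most `M 2 ^ k` in each coordinate lie in dyadic cubes whose positions
differ by at most `M`. -/
theorem exists_posBox {k M : ℤ} {x y : Eucl n} (h : ∀ i, |y i - x i| ≤ M * 2 ^ k) :
    ∃ m ∈ posBox n M, dyIdx k y = dyIdx k x + m := by
  have hk : (0 : ℝ) < 2 ^ k := by positivity
  have h1 : ∀ u v : ℝ, |u - v| ≤ M * 2 ^ k → ⌊u / 2 ^ k⌋ ≤ ⌊v / 2 ^ k⌋ + M := by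
    intro u v huv
    rw [← Int.floor_add_intCast]
    refine Int.floor_le_floor ?_
    rw [div_add' _ _ _ hk.ne']
    gcongr
    linarith [le_abs_self (u - v)]
  refine ⟨dyIdx k y - dyIdx k x, ?_, by abel⟩
  rw [posBox, Finset.mem_Icc]
  constructor
  · intro i
    have := h1 (x i) (y i) (by rw [abs_sub_comm]; exact h i)
    simp only [dyIdx, Pi.sub_apply]
    omega
  · intro i
    have := h1 (y i) (x i) (h i)
    simp only [dyIdx, Pi.sub_apply]
    omega

theorem lintegral_dyCube (k : ℤ) (u : Eucl n → ℝ≥0∞) :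
    ∫⁻ x, u x = ∑' j, ∫⁻ x in dyCube k j, u x := by
  rw [← lintegral_iUnion (fun j => measurableSet_dyCube k j), ← setLIntegral_univ]
  · congr
    symm
    exact eq_univ_of_forall fun x => mem_iUnion.2 ⟨_, mem_dyCube_idx k x⟩
  · intro i j hij
    refine disjoint_left.2 fun x hi hj => hij ?_
    rw [← show dyIdx k x = i from hi, show dyIdx k x = j from hj]

theorem lintegral_idx_mul (k : ℤ) (a : (Fin n → ℤ) → ℝ≥0∞) {u : Eucl n → ℝ≥0∞}
    (hu : Measurable u) :
    ∫⁻ x, a (dyIdx k x) * u x = ∑' j, a j * ∫⁻ x in dyCube k j, u x := by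
  rw [lintegral_dyCube k]
  refine tsum_congr fun j => ?_
  rw [← lintegral_const_mul _ hu]
  refine setLIntegral_congr_fun (measurableSet_dyCube k j) fun x hx => ?_
  rw [show dyIdx k x = j from hx]

/-- The average of `u` over a dyadic cube. -/
noncomputable def dyMean (u : Eucl n → ℝ≥0∞) (R : DyIndex n) : ℝ≥0∞ :=
  (volume (dyCube R.1 R.2))⁻¹ * ∫⁻ x in dyCube R.1 R.2, u x

/-- The conditional expectation of `u` on the dyadic cubes of sidelength `2 ^ k`. -/
noncomputable def dyAvg (k : ℤ) (u : Eucl n → ℝ≥0∞) (x : Eucl n) : ℝ≥0∞ :=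
  dyMean u (k, dyIdx k x)

/-- `a` is constant on the dyadic cubes of sidelength `2 ^ k`. -/
def DyConst (k : ℤ) (a : Eucl n → ℝ≥0∞) : Prop := ∀ x y, dyIdx k x = dyIdx k y → a x = a y

theorem DyConst.eq_comp {k : ℤ} {a : Eucl n → ℝ≥0∞} (h : DyConst k a) :
    a = fun x => a (dyCorner k (dyIdx k x)) :=
  funext fun _ => h _ _ (dyIdx_corner k _).symm

theorem measurable_comp_dyIdx (k : ℤ) (b : (Fin n → ℤ) → ℝ≥0∞) :
    Measurable fun x : Eucl n => b (dyIdx k x) :=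
  (measurable_of_countable b).comp (measurable_dyIdx k)

theorem DyConst.measurable {k : ℤ} {a : Eucl n → ℝ≥0∞} (h : DyConst k a) : Measurable a := by
  rw [h.eq_comp]
  exact measurable_comp_dyIdx k fun j => a (dyCorner k j)

theorem DyConst.mono {k i : ℤ} (hki : k ≤ i) {a : Eucl n → ℝ≥0∞} (h : DyConst i a) :
    DyConst k a := fun _ _ hxy => h _ _ (dyIdx_eq_of_le hki hxy)

theorem dyConst_comp (k : ℤ) (b : (Fin n → ℤ) → ℝ≥0∞) : DyConst k fun x => b (dyIdx k x) :=
  fun x y hxy => by simp only [hxy]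

theorem dyConst_dyAvg (k : ℤ) (u : Eucl n → ℝ≥0∞) : DyConst k (dyAvg k u) :=
  dyConst_comp k fun j => dyMean u (k, j)

theorem measurable_dyAvg (k : ℤ) (u : Eucl n → ℝ≥0∞) : Measurable (dyAvg k u) :=
  (dyConst_dyAvg k u).measurable

theorem DyConst.comp₂ {k : ℤ} {a b : Eucl n → ℝ≥0∞} (ha : DyConst k a) (hb : DyConst k b)
    (φ : ℝ≥0∞ → ℝ≥0∞ → ℝ≥0∞) : DyConst k fun x => φ (a x) (b x) :=
  fun x y hxy => by simp only [ha x y hxy, hb x y hxy]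

theorem setLIntegral_dyAvg (k : ℤ) (j : Fin n → ℤ) (u : Eucl n → ℝ≥0∞) :
    ∫⁻ x in dyCube k j, dyAvg k u x = ∫⁻ x in dyCube k j, u x := by
  have : ∫⁻ x in dyCube k j, dyAvg k u x = ∫⁻ x in dyCube k j, dyMean u (k, j) := by
    refine setLIntegral_congr_fun (measurableSet_dyCube k j) fun x hx => ?_
    simp only [dyAvg, show dyIdx k x = j from hx]
  rw [this, setLIntegral_const, dyMean, mul_comm, ← mul_assoc,
    ENNReal.mul_inv_cancel (volume_dyCube_ne_zero k j) (volume_dyCube_ne_top k j), one_mul]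

/-- Conditional expectations may be inserted next to a function constant on the cubes. -/
theorem DyConst.lintegral_mul {k : ℤ} {a : Eucl n → ℝ≥0∞} (ha : DyConst k a)
    {u : Eucl n → ℝ≥0∞} (hu : Measurable u) :
    ∫⁻ x, a x * u x = ∫⁻ x, a x * dyAvg k u x := by
  rw [ha.eq_comp, lintegral_idx_mul k (fun j => a (dyCorner k j)) hu,
    lintegral_idx_mul k (fun j => a (dyCorner k j)) (measurable_dyAvg k u)]
  simp only [setLIntegral_dyAvg]

theorem lintegral_dyAvg_mul (k : ℤ) {u v : Eucl n → ℝ≥0∞} (hu : Measurable u)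
    (hv : Measurable v) : ∫⁻ x, dyAvg k u x * v x = ∫⁻ x, u x * dyAvg k v x := by
  rw [(dyConst_dyAvg k u).lintegral_mul hv]
  simp_rw [mul_comm _ (dyAvg k v _)]
  rw [(dyConst_dyAvg k v).lintegral_mul hu]

theorem dyMean_mono {u v : Eucl n → ℝ≥0∞} (h : ∀ x, u x ≤ v x) (R : DyIndex n) :
    dyMean u R ≤ dyMean v R := by
  unfold dyMean
  gcongr with x
  exact h x

theorem dyAvg_mono (k : ℤ) {u v : Eucl n → ℝ≥0∞} (h : ∀ x, u x ≤ v x) (x : Eucl n) :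
    dyAvg k u x ≤ dyAvg k v x := dyMean_mono h _

theorem dyMean_const (c : ℝ≥0∞) (R : DyIndex n) : dyMean (fun _ => c) R = c := by
  rw [dyMean, setLIntegral_const, mul_comm, mul_assoc,
    ENNReal.mul_inv_cancel (volume_dyCube_ne_zero _ _) (volume_dyCube_ne_top _ _), mul_one]

theorem dyMean_tsum {ι : Type*} [Countable ι] {u : ι → Eucl n → ℝ≥0∞}
    (hu : ∀ k, Measurable (u k)) (R : DyIndex n) :
    dyMean (fun x => ∑' k, u k x) R = ∑' k, dyMean (u k) R := by
  simp only [dyMean]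
  rw [lintegral_tsum fun k => (hu k).aemeasurable, ENNReal.tsum_mul_left]

/-- **Jensen's inequality** for dyadic averages. -/
theorem dyMean_rpow_le {r : ℝ} (hr : 1 ≤ r) {u : Eucl n → ℝ≥0∞} (hu : Measurable u)
    (R : DyIndex n) : dyMean u R ^ r ≤ dyMean (fun x => u x ^ r) R := by
  set Q := dyCube R.1 R.2
  have h0 := volume_dyCube_ne_zero R.1 R.2
  have ht := volume_dyCube_ne_top R.1 R.2
  have hr0 : 0 < r := by linarith
  have h := eLpNorm'_le_eLpNorm'_mul_rpow_measure_univ (μ := volume.restrict Q) zero_lt_one hr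
    hu.aestronglyMeasurable
  simp only [eLpNorm', Measure.restrict_apply_univ, enorm_eq_self, ENNReal.rpow_one, div_one]
    at h
  have h2 := ENNReal.rpow_le_rpow h hr0.le
  rw [ENNReal.mul_rpow_of_nonneg _ _ hr0.le, ← ENNReal.rpow_mul, ← ENNReal.rpow_mul,
    one_div_mul_cancel hr0.ne', ENNReal.rpow_one, sub_mul, one_div_mul_cancel hr0.ne',
    one_mul] at h2
  simp only [dyMean]
  rw [ENNReal.mul_rpow_of_nonneg _ _ hr0.le, ENNReal.inv_rpow]
  calc (volume Q ^ r)⁻¹ * (∫⁻ x in Q, u x) ^ r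
      ≤ (volume Q ^ r)⁻¹ * ((∫⁻ x in Q, u x ^ r) * volume Q ^ (r - 1)) := by gcongr
    _ = volume Q ^ (-r) * volume Q ^ (r - 1) * ∫⁻ x in Q, u x ^ r := by
        rw [ENNReal.rpow_neg]
        ring
    _ = (volume Q)⁻¹ * ∫⁻ x in Q, u x ^ r := by
        rw [← ENNReal.rpow_add _ _ h0 ht, ← ENNReal.rpow_neg_one]
        congr 2
        ring

theorem dyAvg_eLpNorm_le {r : ℝ≥0∞} (hr : 1 ≤ r) (k : ℤ) {u : Eucl n → ℝ≥0∞}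
    (hu : Measurable u) : eLpNorm (dyAvg k u) r volume ≤ eLpNorm u r volume := by
  rcases eq_or_ne r ∞ with rfl | hrt
  · rw [eLpNorm_exponent_top, eLpNorm_exponent_top]
    refine essSup_le_of_ae_le _ (ae_of_all _ fun x => ?_)
    simp only [enorm_eq_self, dyAvg]
    refine le_trans ?_ (dyMean_const (eLpNormEssSup u volume) (k, dyIdx k x)).le
    unfold dyMean
    gcongr 1
    refine lintegral_mono_ae (ae_restrict_of_ae ?_)
    simpa using enorm_ae_le_eLpNormEssSup u volume
  · have hr0 : r ≠ 0 := by positivity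
    have hrp := ENNReal.toReal_pos hr0 hrt
    rw [← ENNReal.rpow_le_rpow_iff hrp, eLpNorm_pow_toReal hr0 hrt, eLpNorm_pow_toReal hr0 hrt]
    have h1 : 1 ≤ r.toReal := by
      simpa using (ENNReal.toReal_le_toReal ENNReal.one_ne_top hrt).2 hr
    refine (lintegral_mono fun x => dyMean_rpow_le h1 hu _).trans_eq ?_
    have := (dyConst_comp k fun _ : Fin n → ℤ => (1 : ℝ≥0∞)).lintegral_mul (hu.pow_const r.toReal)
    simpa [dyAvg] using this.symm

end Dyadic

/-! ### The dyadic maximal inequality -/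

section Chains

variable {n : ℕ}

/-- Conditional expectations on coarser and coarser cubes. -/
theorem dyAvg_dyAvg {k i : ℤ} (h : k ≤ i) {u : Eucl n → ℝ≥0∞} (hu : Measurable u) :
    dyAvg i (dyAvg k u) = dyAvg i u := by
  funext x
  simp only [dyAvg, dyMean]
  congr 1
  set j := dyIdx i x
  have ha : DyConst k ((dyCube i j).indicator fun _ => (1 : ℝ≥0∞)) := by
    intro y z hyz
    have hm : y ∈ dyCube i j ↔ z ∈ dyCube i j := by simp [dyCube, dyIdx_eq_of_le h hyz]
    by_cases hz : z ∈ dyCube i j <;> simp [hm, hz]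
  have h1 : ∀ v : Eucl n → ℝ≥0∞,
      ∫⁻ y, (dyCube i j).indicator (fun _ => (1 : ℝ≥0∞)) y * v y = ∫⁻ y in dyCube i j, v y := by
    intro v
    rw [← lintegral_indicator (measurableSet_dyCube i j)]
    refine lintegral_congr fun y => ?_
    by_cases hy : y ∈ dyCube i j <;> simp [hy]
  rw [← h1, ← h1, ha.lintegral_mul hu]
  rfl

/-- The supremum over scales of a family of functions. -/
noncomputable def scaleSup (F : ℤ → Eucl n → ℝ≥0∞) (x : Eucl n) : ℝ≥0∞ := ⨆ k, F k x

/-- The dyadic maximal function. -/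
noncomputable def dyMax (u : Eucl n → ℝ≥0∞) : Eucl n → ℝ≥0∞ := scaleSup fun k => dyAvg k u

theorem measurable_scaleSup {F : ℤ → Eucl n → ℝ≥0∞} (hF : ∀ k, Measurable (F k)) :
    Measurable (scaleSup F) := Measurable.iSup hF

theorem le_partialSups_scale (F : ℤ → Eucl n → ℝ≥0∞) {K : ℕ} {k : ℤ} (h1 : -(K : ℤ) ≤ k)
    (h2 : k ≤ K) (x : Eucl n) : F k x ≤ partialSups (fun j : ℕ => F (K - j)) (2 * K) x := by
  have h := le_partialSups_of_le (fun j : ℕ => F (K - j)) (i := (K - k).toNat) (j := 2 * K)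
    (by omega) x
  rwa [show (K : ℤ) - ((K - k).toNat : ℕ) = k by omega] at h

theorem partialSups_scale_le (F : ℤ → Eucl n → ℝ≥0∞) (K : ℤ) (J : ℕ) {G : Eucl n → ℝ≥0∞}
    (h : ∀ j : ℕ, j ≤ J → ∀ x, F (K - j) x ≤ G x) (x : Eucl n) :
    partialSups (fun j : ℕ => F (K - j)) J x ≤ G x :=
  partialSups_le (fun j : ℕ => F (K - j)) J G (fun j hj x => h j hj x) x

theorem monotone_partialSups_scale (F : ℤ → Eucl n → ℝ≥0∞) :
    Monotone fun K : ℕ => partialSups (fun j : ℕ => F (K - j)) (2 * K) := by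
  intro K L hKL x
  exact partialSups_scale_le F K _ (fun j hj x =>
    le_partialSups_scale F (by omega) (by omega) x) x

/-- Scales run downwards, from `2 ^ K` to `2 ^ (-K)`, so that the running maxima down to a given scale
are constant on the cubes of that scale if each `F k` is constant on the cubes of scale `2 ^ k`. -/
theorem scaleSup_eq_iSup (F : ℤ → Eucl n → ℝ≥0∞) :
    scaleSup F = fun x => ⨆ K : ℕ, partialSups (fun j : ℕ => F (K - j)) (2 * K) x := by
  funext x
  refine le_antisymm (iSup_le fun k => ?_) (iSup_le fun K => ?_)
  · exact (le_partialSups_scale F (K := k.natAbs) (by omega) (by omega) x).trans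
      (le_iSup (fun K : ℕ => partialSups (fun j : ℕ => F (K - j)) (2 * K) x) k.natAbs)
  · exact partialSups_scale_le F K _ (fun j _ x => le_iSup (fun k => F k x) _) x

theorem measurable_partialSups {f : ℕ → Eucl n → ℝ≥0∞} (hf : ∀ j, Measurable (f j)) (J : ℕ) :
    Measurable (partialSups f J) := by
  induction J with
  | zero => simpa using hf 0
  | succ J ih => rw [partialSups_add_one]; exact ih.sup (hf _)

theorem eLpNorm_scaleSup (p : ℝ≥0∞) {F : ℤ → Eucl n → ℝ≥0∞} (hF : ∀ k, Measurable (F k)) :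
    eLpNorm (scaleSup F) p volume
      = ⨆ K : ℕ, eLpNorm (partialSups (fun j : ℕ => F (K - j)) (2 * K)) p volume := by
  rw [scaleSup_eq_iSup]
  exact eLpNorm_iSup_of_monotone p (fun K => measurable_partialSups (fun j => hF _) _)
    (monotone_partialSups_scale F)

theorem dyConst_partialSups {K : ℤ} {f : ℕ → Eucl n → ℝ≥0∞}
    (hf : ∀ j : ℕ, DyConst (K - j) (f j)) (j : ℕ) : DyConst (K - j) (partialSups f j) := by
  induction j with
  | zero => simpa using hf 0
  | succ j ih =>
    rw [partialSups_add_one]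
    exact (ih.mono (by push_cast; omega)).comp₂ (hf (j + 1)) max

/-- The pointwise inequality behind Doob's inequality: a discrete form of
`d(s ^ r) ≤ r' e d(s ^ (r - 1))` for `s ≤ e`. -/
theorem max_rpow_add_le {r r' : ℝ} (h : r.HolderConjugate r') (y e : ℝ≥0∞) :
    max y e ^ r + ENNReal.ofReal r' * (e * y ^ (r - 1))
      ≤ y ^ r + ENNReal.ofReal r' * (e * max y e ^ (r - 1)) := by
  rcases le_total e y with hey | hey
  · rw [max_eq_left hey]
  rw [max_eq_right hey]
  have hr0 : ENNReal.ofReal r' ≠ 0 := by simpa using h.symm.pos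
  have hy := ENNReal.young_inequality e (y ^ (r - 1)) h
  rw [← ENNReal.rpow_mul, h.sub_one_mul_conj] at hy
  have he : e * e ^ (r - 1) = e ^ r := by
    nth_rewrite 1 [← ENNReal.rpow_one e]
    rw [← ENNReal.rpow_add_of_nonneg _ _ zero_le_one h.sub_one_pos.le]
    congr 1
    ring
  have hrr : (1 : ℝ≥0∞) + ENNReal.ofReal r' / ENNReal.ofReal r = ENNReal.ofReal r' := by
    rw [← ENNReal.ofReal_div_of_pos h.pos, ← ENNReal.ofReal_one,
      ← ENNReal.ofReal_add zero_le_one (div_nonneg h.symm.nonneg h.nonneg)]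
    congr 1
    have := h.symm.div_conj_eq_sub_one
    linarith
  calc e ^ r + ENNReal.ofReal r' * (e * y ^ (r - 1))
      ≤ e ^ r + ENNReal.ofReal r' * (e ^ r / ENNReal.ofReal r + y ^ r / ENNReal.ofReal r') := by
        gcongr
    _ = y ^ r + (1 + ENNReal.ofReal r' / ENNReal.ofReal r) * e ^ r := by
        rw [mul_add, ENNReal.mul_div_cancel hr0 ENNReal.ofReal_ne_top]
        simp only [div_eq_mul_inv]
        ring
    _ = _ := by rw [hrr, he]

/-- The main step of Doob's maximal inequality, for the maximum `m` of the averages of `u` over the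
scales from `2 ^ K` down to `2 ^ (K - J)`: `∫ m ^ r ≤ r' ∫ m ^ (r - 1) * u`. The proof is by
induction on `J`. Both `m J` and `m (J + 1)` are constant on the cubes of the new scale, so that the
average of `u` in `max_rpow_add_le` may be replaced by `u`. -/
theorem doob_chain {r r' : ℝ≥0∞} (h : r⁻¹ + r'⁻¹ = 1) (hr : 1 < r) (hrt : r ≠ ∞) (K : ℤ)
    {u : Eucl n → ℝ≥0∞} (hu : Measurable u) (hfin : eLpNorm u r volume < ∞) (J : ℕ) :
    eLpNorm (partialSups (fun j : ℕ => dyAvg (K - j) u) J) r volume < ∞ ∧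
      ∫⁻ x, partialSups (fun j : ℕ => dyAvg (K - j) u) J x ^ r.toReal
        ≤ ENNReal.ofReal r'.toReal *
          ∫⁻ x, partialSups (fun j : ℕ => dyAvg (K - j) u) J x ^ (r.toReal - 1) * u x := by
  have hc := conj_toReal h hr hrt
  have hr0 : r ≠ 0 := by positivity
  have hr'0 : r' ≠ 0 := by have := conj_gt_one h hrt; positivity
  set m := partialSups (fun j : ℕ => dyAvg (K - j) u) with hm
  have hmm : ∀ J, Measurable (m J) := measurable_partialSups fun j => measurable_dyAvg _ _
  have hmc : ∀ J : ℕ, DyConst (K - J) (m J) := dyConst_partialSups fun j => dyConst_dyAvg _ _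
  -- the integrals to be cancelled are finite
  have hmul : ∀ J, eLpNorm (m J) r volume < ∞ →
      ∫⁻ x, m J x ^ (r.toReal - 1) * u x < ∞ := by
    intro J hJ
    refine (lintegral_mul_le_eLpNorm (p := r') (p' := r) (by rw [add_comm]; exact h)
      ((hmm J).pow_const _) hu).trans_lt (ENNReal.mul_lt_top ?_ hfin)
    have h1 : eLpNorm (fun x => m J x ^ (r.toReal - 1)) r' volume ^ r'.toReal
        = eLpNorm (m J) r volume ^ r.toReal := by
      rw [eLpNorm_pow_toReal hr'0 (conj_ne_top h hr), eLpNorm_pow_toReal hr0 hrt]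
      refine lintegral_congr fun x => ?_
      rw [← ENNReal.rpow_mul, hc.sub_one_mul_conj]
    have h2 : eLpNorm (m J) r volume ^ r.toReal < ∞ :=
      ENNReal.rpow_lt_top_of_nonneg hc.nonneg hJ.ne
    rw [← h1] at h2
    exact (ENNReal.rpow_lt_top_iff_of_pos hc.symm.pos).1 h2
  induction J with
  | zero =>
    have h0 : m 0 = dyAvg K u := by simp [hm]
    rw [h0]
    refine ⟨(dyAvg_eLpNorm_le hr.le K hu).trans_lt hfin, ?_⟩
    have h1 : ∀ x, dyAvg K u x ^ r.toReal = dyAvg K u x ^ (r.toReal - 1) * dyAvg K u x := by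
      intro x
      nth_rewrite 3 [← ENNReal.rpow_one (dyAvg K u x)]
      rw [← ENNReal.rpow_add_of_nonneg _ _ hc.sub_one_pos.le zero_le_one]
      congr 1
      ring
    have h2 : DyConst K fun x => dyAvg K u x ^ (r.toReal - 1) :=
      (dyConst_dyAvg K u).comp₂ (dyConst_dyAvg K u) fun a _ => a ^ (r.toReal - 1)
    simp_rw [h1]
    rw [h2.lintegral_mul hu]
    refine le_mul_of_one_le_left zero_le ?_
    rw [← ENNReal.ofReal_one]
    exact ENNReal.ofReal_le_ofReal hc.symm.lt.le
  | succ J ih =>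
    obtain ⟨ih1, ih2⟩ := ih
    have hs : m (J + 1) = fun x => max (m J x) (dyAvg (K - (J + 1 : ℕ)) u x) := by
      rw [hm, partialSups_add_one]
      rfl
    have hfinJ : eLpNorm (m (J + 1)) r volume < ∞ := by
      have h1 : eLpNorm (m (J + 1)) r volume
          ≤ eLpNorm (m J + dyAvg (K - (J + 1 : ℕ)) u) r volume := by
        refine eLpNorm_mono_ennreal fun x => ?_
        rw [hs]
        exact max_le_add_of_nonneg zero_le zero_le
      refine h1.trans_lt ((eLpNorm_add_le (hmm J).aestronglyMeasurable
        (measurable_dyAvg _ _).aestronglyMeasurable hr.le).trans_lt ?_)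
      exact ENNReal.add_lt_top.2 ⟨ih1, (dyAvg_eLpNorm_le hr.le _ hu).trans_lt hfin⟩
    refine ⟨hfinJ, ?_⟩
    have hJ : DyConst (K - (J + 1 : ℕ)) fun x => m J x ^ (r.toReal - 1) :=
      ((hmc J).mono (by push_cast; omega)).comp₂ (dyConst_dyAvg _ u)
        fun a _ => a ^ (r.toReal - 1)
    have hJ1 : DyConst (K - (J + 1 : ℕ)) fun x => m (J + 1) x ^ (r.toReal - 1) :=
      (hmc (J + 1)).comp₂ (hmc (J + 1)) fun a _ => a ^ (r.toReal - 1)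
    have hp : ∫⁻ x, (m (J + 1) x ^ r.toReal + ENNReal.ofReal r'.toReal *
          (m J x ^ (r.toReal - 1) * dyAvg (K - (J + 1 : ℕ)) u x))
        ≤ ∫⁻ x, (m J x ^ r.toReal + ENNReal.ofReal r'.toReal *
          (m (J + 1) x ^ (r.toReal - 1) * dyAvg (K - (J + 1 : ℕ)) u x)) := by
      refine lintegral_mono fun x => ?_
      have := max_rpow_add_le hc (m J x) (dyAvg (K - (J + 1 : ℕ)) u x)
      rw [hs]
      simpa only [mul_comm] using this
    rw [lintegral_add_left ((hmm _).pow_const _), lintegral_add_left ((hmm _).pow_const _),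
      lintegral_const_mul' _ _ ENNReal.ofReal_ne_top,
      lintegral_const_mul' _ _ ENNReal.ofReal_ne_top,
      ← hJ.lintegral_mul hu, ← hJ1.lintegral_mul hu] at hp
    have h3 := hp.trans (add_le_add_left ih2 _)
    rw [add_comm] at h3
    exact (ENNReal.add_le_add_iff_left (ENNReal.mul_ne_top ENNReal.ofReal_ne_top
      (hmul J ih1).ne)).1 h3

/-- **The dyadic maximal inequality**: the dyadic maximal operator is bounded on `L_r` for
`1 < r ≤ ∞`. -/
theorem exists_eLpNorm_dyMax_le {r r' : ℝ≥0∞} (h : r⁻¹ + r'⁻¹ = 1) (hr : 1 < r) :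
    ∃ C : ℝ≥0∞, C ≠ ∞ ∧ ∀ u : Eucl n → ℝ≥0∞, Measurable u →
      eLpNorm (dyMax u) r volume ≤ C * eLpNorm u r volume := by
  rcases eq_or_ne r ∞ with rfl | hrt
  · refine ⟨1, ENNReal.one_ne_top, fun u hu => ?_⟩
    rw [one_mul, dyMax, eLpNorm_scaleSup _ fun k => measurable_dyAvg _ _]
    refine iSup_le fun K => ?_
    have h1 : ∀ j : ℕ, ∀ᵐ x, dyAvg (K - j) u x ≤ eLpNorm u ∞ volume := by
      intro j
      have h2 := dyAvg_eLpNorm_le (r := ∞) le_top (K - j) hu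
      filter_upwards [enorm_ae_le_eLpNormEssSup (dyAvg (K - j) u) volume] with x hx
      rw [← eLpNorm_exponent_top] at hx
      exact le_trans (by simpa using hx) h2
    rw [eLpNorm_exponent_top]
    refine essSup_le_of_ae_le _ ?_
    filter_upwards [ae_all_iff.2 h1] with x hx
    rw [enorm_eq_self, Pi.partialSups_apply]
    exact partialSups_le _ _ _ fun j _ => hx j
  have hc := conj_toReal h hr hrt
  have hr0 : r ≠ 0 := by positivity
  have hr'0 : r' ≠ 0 := by have := conj_gt_one h hrt; positivity
  have hr't := conj_ne_top h hr
  refine ⟨ENNReal.ofReal r'.toReal, ENNReal.ofReal_ne_top, fun u hu => ?_⟩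
  rcases eq_or_ne (eLpNorm u r volume) ∞ with htop | htop
  · rw [htop, ENNReal.mul_top]
    · exact le_top
    · simpa using hc.symm.pos
  rw [dyMax, eLpNorm_scaleSup _ fun k => measurable_dyAvg _ _]
  refine iSup_le fun K => ?_
  obtain ⟨h1, h2⟩ := doob_chain h hr hrt K hu (lt_top_iff_ne_top.2 htop) (2 * K)
  set m := partialSups (fun j : ℕ => dyAvg ((K : ℤ) - j) u) (2 * K) with hm
  have hmm : Measurable m := measurable_partialSups (fun j => measurable_dyAvg _ _) _
  rcases eq_or_ne (eLpNorm m r volume) 0 with h0 | h0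
  · rw [h0]
    exact zero_le
  have h3 := h2.trans (mul_le_mul_right (lintegral_mul_le_eLpNorm (p := r') (p' := r)
      (by rw [add_comm]; exact h) (hmm.pow_const _) hu) _)
  rw [← eLpNorm_pow_toReal hr0 hrt] at h3
  have h4 : eLpNorm (fun x => m x ^ (r.toReal - 1)) r' volume
      = eLpNorm m r volume ^ (r.toReal - 1) := by
    refine ENNReal.rpow_left_injective hc.symm.ne_zero ?_
    simp only
    rw [eLpNorm_pow_toReal hr'0 hr't,
      ← ENNReal.rpow_mul, hc.sub_one_mul_conj, eLpNorm_pow_toReal hr0 hrt]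
    refine lintegral_congr fun x => ?_
    rw [← ENNReal.rpow_mul, hc.sub_one_mul_conj]
  rw [h4] at h3
  have h5 : eLpNorm m r volume ^ r.toReal
      = eLpNorm m r volume ^ (r.toReal - 1) * eLpNorm m r volume := by
    nth_rewrite 3 [← ENNReal.rpow_one (eLpNorm m r volume)]
    rw [← ENNReal.rpow_add_of_nonneg _ _ hc.sub_one_pos.le zero_le_one]
    congr 1
    ring
  rw [h5, mul_left_comm] at h3
  exact (ENNReal.mul_le_mul_iff_right (by simp [h0, h1.ne])
    (ENNReal.rpow_ne_top_of_nonneg hc.sub_one_pos.le h1.ne)).1 h3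

end Chains

/-! ### The dyadic Carleson functional and its duality with the maximal functional -/

section Discrete

variable {n : ℕ}

/-- The sum of the functions attached to scales at most `2 ^ i`. -/
noncomputable def lowerSum (c : ℤ → Eucl n → ℝ≥0∞) (i : ℤ) (x : Eucl n) : ℝ≥0∞ :=
  ∑' k, if k ≤ i then c k x else 0

/-- The dyadic Carleson functional: the supremum over the dyadic cubes `Q` containing `x` of the
average over `Q` of the sum of the `c k` with `2 ^ k ≤ ℓ(Q)`. -/
noncomputable def dyCarleson (c : ℤ → Eucl n → ℝ≥0∞) : Eucl n → ℝ≥0∞ :=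
  scaleSup fun i => dyAvg i (lowerSum c i)

theorem measurable_lowerSum {c : ℤ → Eucl n → ℝ≥0∞} (hc : ∀ k, Measurable (c k)) (i : ℤ) :
    Measurable (lowerSum c i) := by
  refine Measurable.tsum fun k => ?_
  split_ifs
  exacts [hc k, measurable_const]

theorem measurable_dyCarleson (c : ℤ → Eucl n → ℝ≥0∞) : Measurable (dyCarleson c) :=
  measurable_scaleSup fun _ => measurable_dyAvg _ _

theorem lowerSum_mono {c d : ℤ → Eucl n → ℝ≥0∞} (h : ∀ k x, c k x ≤ d k x) (i : ℤ) (x : Eucl n) :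
    lowerSum c i x ≤ lowerSum d i x := by
  refine ENNReal.tsum_le_tsum fun k => ?_
  split_ifs
  exacts [h k x, le_rfl]

theorem dyCarleson_mono {c d : ℤ → Eucl n → ℝ≥0∞} (h : ∀ k x, c k x ≤ d k x) (x : Eucl n) :
    dyCarleson c x ≤ dyCarleson d x :=
  iSup_mono fun i => dyAvg_mono i (lowerSum_mono h i) x

/-- The increments of the running maxima of a sequence. -/
noncomputable def maxIncr (f : ℕ → Eucl n → ℝ≥0∞) : ℕ → Eucl n → ℝ≥0∞
  | 0 => f 0
  | j + 1 => fun x => partialSups f (j + 1) x - partialSups f j x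

theorem sum_maxIncr (f : ℕ → Eucl n → ℝ≥0∞) (j : ℕ) (x : Eucl n) :
    ∑ i ∈ Finset.range (j + 1), maxIncr f i x = partialSups f j x := by
  induction j with
  | zero => simp [maxIncr]
  | succ j ih =>
    rw [Finset.sum_range_succ, ih, maxIncr]
    exact add_tsub_cancel_of_le ((partialSups f).monotone (Nat.le_succ j) x)

theorem dyConst_maxIncr {K : ℤ} {f : ℕ → Eucl n → ℝ≥0∞}
    (hf : ∀ j : ℕ, DyConst (K - j) (f j)) (j : ℕ) : DyConst (K - j) (maxIncr f j) := by
  cases j with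
  | zero => exact hf 0
  | succ j =>
    exact (dyConst_partialSups hf (j + 1)).comp₂
      ((dyConst_partialSups hf j).mono (by push_cast; omega)) fun a b => a - b

theorem sum_le_lowerSum (c : ℤ → Eucl n → ℝ≥0∞) (K : ℤ) (i : ℕ) (s : Finset ℕ)
    (hs : ∀ j ∈ s, i ≤ j) (x : Eucl n) :
    ∑ j ∈ s, c (K - j) x ≤ lowerSum c (K - i) x := by
  have h1 : ∑ j ∈ s, c (K - j) x
      = ∑ k ∈ s.image (fun j : ℕ => K - j), if k ≤ K - i then c k x else 0 := by
    rw [Finset.sum_image fun a _ b _ hab => by simpa using hab]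
    refine Finset.sum_congr rfl fun j hj => ?_
    have := hs j hj
    rw [if_pos (by omega)]
  rw [h1]
  exact ENNReal.sum_le_tsum _

theorem tsum_int_eq_iSup (a : ℤ → ℝ≥0∞) :
    ∑' k, a k = ⨆ K : ℕ, ∑ j ∈ Finset.range (2 * K + 1), a (K - j) := by
  have h1 : ∀ K : ℕ, ∑ j ∈ Finset.range (2 * K + 1), a (K - j)
      = ∑ k ∈ (Finset.range (2 * K + 1)).image (fun j : ℕ => (K : ℤ) - j), a k := by
    intro K
    rw [Finset.sum_image fun a _ b _ hab => by simpa using hab]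
  simp_rw [h1]
  refine ENNReal.tsum_eq_iSup_sum' _ fun t => ?_
  refine ⟨t.sup Int.natAbs, fun k hk => ?_⟩
  have := Finset.le_sup (f := Int.natAbs) hk
  rw [Finset.mem_image]
  exact ⟨((t.sup Int.natAbs : ℕ) - k).toNat, by rw [Finset.mem_range]; omega, by omega⟩

/-- **Carleson's inequality**, in dyadic form. Summation by parts against the increments of the
maxima over the scales above `2 ^ k`: the increment at scale `i` meets exactly the sum over the
scales `k ≤ i`, and being constant on cubes of scale `i` it only sees the average of that sum. -/
theorem tsum_lintegral_mul_le {F c : ℤ → Eucl n → ℝ≥0∞} (hF : ∀ k, DyConst k (F k))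
    (hc : ∀ k, Measurable (c k)) :
    ∑' k, ∫⁻ x, F k x * c k x ≤ ∫⁻ x, scaleSup F x * dyCarleson c x := by
  rw [tsum_int_eq_iSup]
  refine iSup_le fun K => ?_
  set f : ℕ → Eucl n → ℝ≥0∞ := fun j => F (K - j) with hf
  have hfc : ∀ j : ℕ, DyConst (K - j) (f j) := fun j => hF _
  have hdm : ∀ j, Measurable (maxIncr f j) := fun j => (dyConst_maxIncr hfc j).measurable
  have hC := measurable_dyCarleson c
  rw [← lintegral_finsetSum _ fun j _ => (hF _).measurable.fun_mul (hc _)]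
  calc ∫⁻ x, ∑ j ∈ Finset.range (2 * K + 1), F (K - j) x * c (K - j) x
      ≤ ∫⁻ x, ∑ i ∈ Finset.range (2 * K + 1), maxIncr f i x * lowerSum c (K - i) x := by
        refine lintegral_mono fun x => ?_
        calc ∑ j ∈ Finset.range (2 * K + 1), F (K - j) x * c (K - j) x
            ≤ ∑ j ∈ Finset.range (2 * K + 1), ∑ i ∈ Finset.range (j + 1),
                maxIncr f i x * c (K - j) x := by
              refine Finset.sum_le_sum fun j _ => ?_
              rw [← Finset.sum_mul, sum_maxIncr]
              gcongr
              exact le_partialSups f j x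
          _ = ∑ i ∈ Finset.range (2 * K + 1), ∑ j ∈ (Finset.range (2 * K + 1)).filter (i ≤ ·),
                maxIncr f i x * c (K - j) x := by
              refine Finset.sum_comm' fun j i => ?_
              simp only [Finset.mem_range, Finset.mem_filter]
              omega
          _ ≤ _ := by
              refine Finset.sum_le_sum fun i _ => ?_
              rw [← Finset.mul_sum]
              gcongr
              exact sum_le_lowerSum c K i _ (fun j hj => (Finset.mem_filter.1 hj).2) x
    _ = ∑ i ∈ Finset.range (2 * K + 1), ∫⁻ x, maxIncr f i x * lowerSum c (K - i) x :=
        lintegral_finsetSum _ fun i _ => (hdm i).fun_mul (measurable_lowerSum hc _)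
    _ = ∑ i ∈ Finset.range (2 * K + 1),
          ∫⁻ x, maxIncr f i x * dyAvg (K - i) (lowerSum c (K - i)) x :=
        Finset.sum_congr rfl fun i _ =>
          (dyConst_maxIncr hfc i).lintegral_mul (measurable_lowerSum hc _)
    _ ≤ ∑ i ∈ Finset.range (2 * K + 1), ∫⁻ x, maxIncr f i x * dyCarleson c x := by
        gcongr with i _ x
        exact le_iSup (fun i => dyAvg i (lowerSum c i) x) _
    _ = ∫⁻ x, partialSups f (2 * K) x * dyCarleson c x := by
        rw [← lintegral_finsetSum _ fun i _ => (hdm i).fun_mul hC]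
        simp_rw [← Finset.sum_mul, sum_maxIncr]
    _ ≤ _ := by
        gcongr with x
        exact partialSups_scale_le F K _ (fun j _ x => le_iSup (fun k => F k x) _) x

/-- A measurable choice of the scale at which a maximum over finitely many scales is attained. -/
theorem exists_argmax {F : ℤ → Eucl n → ℝ≥0∞} (hF : ∀ k, Measurable (F k)) (K : ℤ) (J : ℕ) :
    ∃ κ : Eucl n → ℤ, Measurable κ ∧
      ∀ x, partialSups (fun j : ℕ => F (K - j)) J x ≤ F (κ x) x := by
  induction J with
  | zero => exact ⟨fun _ => K, measurable_const, fun x => by simp⟩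
  | succ J ih =>
    obtain ⟨κ, hκ, h⟩ := ih
    have hm : Measurable fun x => F (κ x) x :=
      (measurable_from_prod_countable_right (f := fun z : ℤ × Eucl n => F z.1 z.2) hF).comp
        (hκ.prodMk measurable_id)
    have hs : MeasurableSet {x | F (K - (J + 1 : ℕ)) x ≤ F (κ x) x} := measurableSet_le (hF _) hm
    classical
    refine ⟨fun x => if F (K - (J + 1 : ℕ)) x ≤ F (κ x) x then κ x else K - (J + 1 : ℕ),
      Measurable.ite hs hκ measurable_const, fun x => ?_⟩
    rw [partialSups_add_one]
    simp only [Pi.sup_apply]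
    split_ifs with hx
    · exact sup_le (h x) hx
    · exact sup_le ((h x).trans (not_le.1 hx).le) le_rfl

/-- The part of `h` on the set where `κ = k`. -/
noncomputable def levelPart (κ : Eucl n → ℤ) (h : Eucl n → ℝ≥0∞) (k : ℤ) : Eucl n → ℝ≥0∞ :=
  (κ ⁻¹' {k}).indicator h

theorem measurable_levelPart {κ : Eucl n → ℤ} (hκ : Measurable κ) {h : Eucl n → ℝ≥0∞}
    (hh : Measurable h) (k : ℤ) : Measurable (levelPart κ h k) :=
  hh.indicator (hκ (measurableSet_singleton k))

theorem tsum_levelPart_mul (κ : Eucl n → ℤ) (h : Eucl n → ℝ≥0∞) (F : ℤ → Eucl n → ℝ≥0∞)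
    (x : Eucl n) : ∑' k, levelPart κ h k x * F k x = h x * F (κ x) x := by
  rw [tsum_eq_single (κ x) fun k hk => by
    rw [levelPart, indicator_of_notMem (by simpa using hk.symm), zero_mul]]
  rw [levelPart, indicator_of_mem (by simp)]

theorem dyAvg_tsum (i : ℤ) {u : ℤ → Eucl n → ℝ≥0∞} (hu : ∀ k, Measurable (u k)) (x : Eucl n) :
    dyAvg i (fun x => ∑' k, u k x) x = ∑' k, dyAvg i (u k) x := dyMean_tsum hu _

/-- **Linearisation of the maximal functional**: below the norm of `scaleSup F`, the sequence `F`
is normed by a sequence with bounded Carleson functional, namely the conditional expectations of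
the parts of a function `h` on which the maximum is attained at the scale in question. -/
theorem exists_norming_scaleSup {p p' : ℝ≥0∞} (hpp : p⁻¹ + p'⁻¹ = 1) (hp : p ≠ ∞) :
    ∃ C : ℝ≥0∞, C ≠ ∞ ∧ ∀ F : ℤ → Eucl n → ℝ≥0∞, (∀ k, DyConst k (F k)) →
      ∀ T < eLpNorm (scaleSup F) p volume, ∃ c : ℤ → Eucl n → ℝ≥0∞, (∀ k, DyConst k (c k)) ∧
        eLpNorm (dyCarleson c) p' volume ≤ C ∧ T ≤ 2 * ∑' k, ∫⁻ x, F k x * c k x := by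
  have hpp' : p'⁻¹ + p⁻¹ = 1 := by rw [add_comm]; exact hpp
  obtain ⟨C, hC, hM⟩ := exists_eLpNorm_dyMax_le (n := n) hpp' (conj_gt_one hpp hp)
  refine ⟨C, hC, fun F hF T hT => ?_⟩
  have hFm : ∀ k, Measurable (F k) := fun k => (hF k).measurable
  rw [eLpNorm_scaleSup p hFm, lt_iSup_iff] at hT
  obtain ⟨K, hK⟩ := hT
  obtain ⟨κ, hκ, hmax⟩ := exists_argmax hFm K (2 * K)
  obtain ⟨h, hhm, hh1, hhT⟩ := exists_le_lintegral_mul hpp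
    (measurable_partialSups (fun j : ℕ => hFm (K - j)) (2 * K)) (μ := volume)
  have hlm := measurable_levelPart hκ hhm
  refine ⟨fun k => dyAvg k (levelPart κ h k), fun k => dyConst_dyAvg _ _, ?_, ?_⟩
  · -- the average of the lower sum is that of part of `h`, so the maximal function of `h` dominates
    refine (eLpNorm_mono_ennreal fun x => ?_).trans ((hM h hhm).trans
      ((mul_le_mul_right hh1 C).trans_eq (mul_one C)))
    refine iSup_mono fun i => ?_
    have h1 : dyAvg i (lowerSum (fun k => dyAvg k (levelPart κ h k)) i) x
        = ∑' k, if k ≤ i then dyAvg i (levelPart κ h k) x else 0 := by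
      unfold lowerSum
      rw [dyAvg_tsum i fun k => by split_ifs; exacts [measurable_dyAvg _ _, measurable_const]]
      refine tsum_congr fun k => ?_
      split_ifs with hk
      · rw [dyAvg_dyAvg hk (hlm k)]
      · exact dyMean_const 0 _
    have h2 : dyAvg i h x = ∑' k, dyAvg i (levelPart κ h k) x := by
      rw [← dyAvg_tsum i hlm]
      congr 1
      funext y
      simpa using (tsum_levelPart_mul κ h (fun _ _ => 1) y).symm
    change dyAvg i (lowerSum (fun k => dyAvg k (levelPart κ h k)) i) x ≤ dyAvg i h x
    rw [h1, h2]
    refine ENNReal.tsum_le_tsum fun k => ?_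
    split_ifs
    exacts [le_rfl, zero_le]
  · refine hK.le.trans (hhT.trans ?_)
    gcongr
    calc ∫⁻ x, partialSups (fun j : ℕ => F (K - j)) (2 * K) x * h x
        ≤ ∫⁻ x, ∑' k, levelPart κ h k x * F k x := by
          refine lintegral_mono fun x => ?_
          rw [tsum_levelPart_mul, mul_comm]
          gcongr
          exact hmax x
      _ = ∑' k, ∫⁻ x, F k x * levelPart κ h k x := by
          rw [lintegral_tsum fun k => ((hlm k).fun_mul (hFm k)).aemeasurable]
          simp_rw [mul_comm]
      _ = _ := tsum_congr fun k => (hF k).lintegral_mul (hlm k)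

/-- **Linearisation of the Carleson functional**: below the norm of `dyCarleson c`, the sequence
`c` is normed by a sequence whose maximal function is bounded. That maximal function is the adjoint
of a linearised maximal operator. -/
theorem exists_norming_dyCarleson {p p' : ℝ≥0∞} (hpp : p⁻¹ + p'⁻¹ = 1) (hp : p ≠ ∞) :
    ∃ C : ℝ≥0∞, C ≠ ∞ ∧ ∀ c : ℤ → Eucl n → ℝ≥0∞, (∀ k, Measurable (c k)) →
      ∀ T < eLpNorm (dyCarleson c) p' volume, ∃ F : ℤ → Eucl n → ℝ≥0∞, (∀ k, DyConst k (F k)) ∧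
        eLpNorm (scaleSup F) p volume ≤ C ∧ T ≤ 2 * ∑' k, ∫⁻ x, F k x * c k x := by
  have hpp' : p'⁻¹ + p⁻¹ = 1 := by rw [add_comm]; exact hpp
  obtain ⟨C, hC, hM⟩ := exists_eLpNorm_dyMax_le (n := n) hpp' (conj_gt_one hpp hp)
  refine ⟨2 * C, ENNReal.mul_ne_top (by simp) hC, fun c hc T hT => ?_⟩
  set e : ℤ → Eucl n → ℝ≥0∞ := fun i => dyAvg i (lowerSum c i) with he
  have hem : ∀ i, Measurable (e i) := fun i => measurable_dyAvg _ _
  rw [dyCarleson, eLpNorm_scaleSup p' hem, lt_iSup_iff] at hT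
  obtain ⟨K, hK⟩ := hT
  obtain ⟨κ, hκ, hmax⟩ := exists_argmax hem K (2 * K)
  obtain ⟨h, hhm, hh1, hhT⟩ := exists_le_lintegral_mul hpp'
    (measurable_partialSups (fun j : ℕ => hem (K - j)) (2 * K)) (μ := volume)
  have hlm := measurable_levelPart hκ hhm
  set a : ℤ → Eucl n → ℝ≥0∞ := fun i => dyAvg i (levelPart κ h i) with ha
  have ham : ∀ i, Measurable (a i) := fun i => measurable_dyAvg _ _
  -- summing over `i ≥ k` transposes the sum over `k ≤ i` in `lowerSum`
  refine ⟨fun k x => ∑' i, if k ≤ i then a i x else 0, ?_, ?_, ?_⟩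
  · intro k x y hxy
    refine tsum_congr fun i => ?_
    split_ifs with hki
    · exact (dyConst_dyAvg i _).mono hki x y hxy
    · rfl
  · have htm : Measurable fun x => ∑' i, a i x := Measurable.tsum ham
    refine (eLpNorm_mono_ennreal (H := fun x => ∑' i, a i x) fun x => iSup_le fun k =>
      ENNReal.tsum_le_tsum fun i => ?_).trans ?_
    · split_ifs
      exacts [le_rfl, zero_le]
    · -- the adjoint of `h ↦ ∑ i, a i` is `u ↦ dyAvg (κ x) u x`, which is dominated by `dyMax u`
      obtain ⟨u, hum, hu1, huT⟩ := exists_le_lintegral_mul hpp htm (μ := volume)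
      refine huT.trans ?_
      gcongr
      calc ∫⁻ x, (∑' i, a i x) * u x = ∑' i, ∫⁻ x, a i x * u x := by
            simp_rw [← ENNReal.tsum_mul_right]
            exact lintegral_tsum fun i => ((ham i).fun_mul hum).aemeasurable
        _ = ∑' i, ∫⁻ x, levelPart κ h i x * dyAvg i u x :=
            tsum_congr fun i => lintegral_dyAvg_mul i (hlm i) hum
        _ = ∫⁻ x, h x * dyAvg (κ x) u x := by
            rw [← lintegral_tsum fun i => ((hlm i).fun_mul (measurable_dyAvg _ _)).aemeasurable]
            simp_rw [tsum_levelPart_mul κ h (fun i => dyAvg i u)]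
        _ ≤ ∫⁻ x, h x * dyMax u x := by
            gcongr with x
            exact le_iSup (fun i => dyAvg i u x) _
        _ ≤ eLpNorm h p volume * eLpNorm (dyMax u) p' volume :=
            lintegral_mul_le_eLpNorm hpp hhm (measurable_scaleSup fun _ => measurable_dyAvg _ _)
        _ ≤ 1 * (C * 1) := by
            gcongr
            exact (hM u hum).trans (by gcongr)
        _ = C := by simp
  · refine hK.le.trans (hhT.trans ?_)
    gcongr
    calc ∫⁻ x, partialSups (fun j : ℕ => e (K - j)) (2 * K) x * h x
        ≤ ∫⁻ x, ∑' i, levelPart κ h i x * e i x := by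
          refine lintegral_mono fun x => ?_
          rw [tsum_levelPart_mul, mul_comm]
          gcongr
          exact hmax x
      _ = ∑' i, ∫⁻ x, levelPart κ h i x * e i x :=
          lintegral_tsum fun i => ((hlm i).fun_mul (hem i)).aemeasurable
      _ = ∑' i, ∫⁻ x, a i x * lowerSum c i x :=
          tsum_congr fun i => (lintegral_dyAvg_mul i (hlm i) (measurable_lowerSum hc i)).symm
      _ = ∑' i, ∑' k, ∫⁻ x, (if k ≤ i then a i x else 0) * c k x := by
          refine tsum_congr fun i => ?_
          simp only [lowerSum, ← ENNReal.tsum_mul_left]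
          rw [lintegral_tsum fun k => ((ham i).fun_mul
            (by split_ifs; exacts [hc k, measurable_const])).aemeasurable]
          refine tsum_congr fun k => lintegral_congr fun x => ?_
          split_ifs <;> simp
      _ = ∑' k, ∑' i, ∫⁻ x, (if k ≤ i then a i x else 0) * c k x := ENNReal.tsum_comm
      _ ≤ ∑' k, ∫⁻ x, (∑' i, if k ≤ i then a i x else 0) * c k x := by
          refine ENNReal.tsum_le_tsum fun k => ?_
          rw [← lintegral_tsum fun i => (Measurable.fun_mul (by
            split_ifs; exacts [ham i, measurable_const]) (hc k)).aemeasurable]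
          simp_rw [ENNReal.tsum_mul_right]
          exact le_rfl

/-- For `1 < r < ∞` the Carleson functional of `c` and the sum of all `c k` have comparable
`L_r` norms. -/
theorem exists_dyCarleson_equiv {r r' : ℝ≥0∞} (h : r⁻¹ + r'⁻¹ = 1) (hr : 1 < r) (hrt : r ≠ ∞) :
    ∃ C : ℝ≥0∞, C ≠ ∞ ∧ ∀ c : ℤ → Eucl n → ℝ≥0∞, (∀ k, DyConst k (c k)) →
      eLpNorm (dyCarleson c) r volume ≤ C * eLpNorm (fun x => ∑' k, c k x) r volume ∧
      eLpNorm (fun x => ∑' k, c k x) r volume ≤ C * eLpNorm (dyCarleson c) r volume := by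
  have h' : r'⁻¹ + r⁻¹ = 1 := by rw [add_comm]; exact h
  obtain ⟨C₁, hC₁, hM₁⟩ := exists_eLpNorm_dyMax_le (n := n) h hr
  obtain ⟨C₂, hC₂, hM₂⟩ := exists_eLpNorm_dyMax_le (n := n) h' (conj_gt_one h hrt)
  refine ⟨max C₁ (2 * C₂), by simp [hC₁, hC₂, ENNReal.mul_eq_top], fun c hcc => ?_⟩
  have hc : ∀ k, Measurable (c k) := fun k => (hcc k).measurable
  have hm : Measurable fun x => ∑' k, c k x := Measurable.tsum hc
  constructor
  · refine ((eLpNorm_mono_ennreal fun x => iSup_mono fun i => ?_).trans (hM₁ _ hm)).trans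
      (mul_le_mul_left (le_max_left _ _) _)
    refine dyAvg_mono i (fun y => ENNReal.tsum_le_tsum fun k => ?_) x
    split_ifs
    exacts [le_rfl, zero_le]
  · obtain ⟨u, hum, hu1, huT⟩ := exists_le_lintegral_mul h hm (μ := volume)
    refine huT.trans (le_trans ?_ (mul_le_mul_left (le_max_right C₁ _) _))
    rw [mul_assoc]
    gcongr
    calc ∫⁻ x, (∑' k, c k x) * u x = ∑' k, ∫⁻ x, c k x * u x := by
          simp_rw [← ENNReal.tsum_mul_right]
          rw [lintegral_tsum fun i => ((hc i).fun_mul hum).aemeasurable]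
      _ = ∑' k, ∫⁻ x, dyAvg k u x * c k x := by
          refine tsum_congr fun k => ?_
          rw [(hcc k).lintegral_mul hum]
          simp_rw [mul_comm]
      _ ≤ ∫⁻ x, dyMax u x * dyCarleson c x :=
          tsum_lintegral_mul_le (fun k => dyConst_dyAvg k u) hc
      _ ≤ eLpNorm (dyMax u) r' volume * eLpNorm (dyCarleson c) r volume :=
          lintegral_mul_le_eLpNorm h' (measurable_scaleSup fun _ => measurable_dyAvg _ _)
            (measurable_dyCarleson c)
      _ ≤ C₂ * 1 * eLpNorm (dyCarleson c) r volume := by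
          gcongr
          exact (hM₂ u hum).trans (by gcongr)
      _ = _ := by rw [mul_one]

theorem tendsto_tsum_of_dominated {c : ℕ → ℤ → ℝ≥0∞} {d : ℤ → ℝ≥0∞} (h : ∀ m k, c m k ≤ d k)
    (hd : ∑' k, d k ≠ ∞) (hc : ∀ k, Tendsto (fun m => c m k) atTop (𝓝 0)) :
    Tendsto (fun m => ∑' k, c m k) atTop (𝓝 0) := by
  have h1 := tendsto_lintegral_of_dominated_convergence (μ := Measure.count) (F := c)
    (f := fun _ : ℤ => 0) d (fun m => measurable_of_countable _)
    (fun m => ae_of_all _ fun k => h m k) (by rwa [lintegral_count]) (ae_of_all _ hc)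
  simpa [lintegral_count] using h1

theorem tendsto_eLpNorm_of_dominated {α : Type*} [MeasurableSpace α] {μ : Measure α} {r : ℝ≥0∞}
    (hr0 : r ≠ 0) (hrt : r ≠ ∞) {G : ℕ → α → ℝ≥0∞} {H : α → ℝ≥0∞} (hG : ∀ m, Measurable (G m))
    (h : ∀ m x, G m x ≤ H x) (hH : eLpNorm H r μ < ∞)
    (hlim : ∀ᵐ x ∂μ, Tendsto (fun m => G m x) atTop (𝓝 0)) :
    Tendsto (fun m => eLpNorm (G m) r μ) atTop (𝓝 0) := by
  have hrp := ENNReal.toReal_pos hr0 hrt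
  have hpow : Tendsto (fun m => ∫⁻ x, G m x ^ r.toReal ∂μ) atTop (𝓝 (∫⁻ _, 0 ∂μ)) := by
    refine tendsto_lintegral_of_dominated_convergence (fun x => H x ^ r.toReal)
      (fun m => (hG m).pow_const _) (fun m => ae_of_all _ fun x => ?_) ?_ ?_
    · exact ENNReal.rpow_le_rpow (h m x) hrp.le
    · rw [← eLpNorm_pow_toReal hr0 hrt]
      exact ENNReal.rpow_ne_top_of_nonneg hrp.le hH.ne
    · filter_upwards [hlim] with x hx
      have := (ENNReal.continuous_rpow_const (y := r.toReal)).tendsto 0 |>.comp hx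
      simpa [hrp, Function.comp_def] using this
  have h2 := (ENNReal.continuous_rpow_const (y := r.toReal⁻¹)).tendsto _ |>.comp hpow
  simp only [lintegral_zero, ENNReal.zero_rpow_of_pos (inv_pos.2 hrp)] at h2
  refine h2.congr fun m => ?_
  simp only [Function.comp_apply]
  rw [← eLpNorm_pow_toReal hr0 hrt, ← ENNReal.rpow_mul, mul_inv_cancel₀ hrp.ne', ENNReal.rpow_one]

/-- Dominated convergence for the norm of the Carleson functional, `1 < r < ∞`. -/
theorem tendsto_eLpNorm_dyCarleson {r r' : ℝ≥0∞} (h : r⁻¹ + r'⁻¹ = 1) (hr : 1 < r) (hrt : r ≠ ∞)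
    {c : ℕ → ℤ → Eucl n → ℝ≥0∞} {d : ℤ → Eucl n → ℝ≥0∞} (hc : ∀ m k, DyConst k (c m k))
    (hd : ∀ k, DyConst k (d k)) (hcd : ∀ m k x, c m k x ≤ d k x)
    (hfin : eLpNorm (dyCarleson d) r volume < ∞)
    (hlim : ∀ k x, Tendsto (fun m => c m k x) atTop (𝓝 0)) :
    Tendsto (fun m => eLpNorm (dyCarleson (c m)) r volume) atTop (𝓝 0) := by
  obtain ⟨C, hC, hE⟩ := exists_dyCarleson_equiv (n := n) h hr hrt
  have hr0 : r ≠ 0 := by positivity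
  have hdfin : eLpNorm (fun x => ∑' k, d k x) r volume < ∞ :=
    ((hE d hd).2).trans_lt (ENNReal.mul_lt_top (lt_top_iff_ne_top.2 hC) hfin)
  have h1 : Tendsto (fun m => eLpNorm (fun x => ∑' k, c m k x) r volume) atTop (𝓝 0) := by
    refine tendsto_eLpNorm_of_dominated hr0 hrt
      (fun m => Measurable.tsum fun k => (hc m k).measurable)
      (fun m x => ENNReal.tsum_le_tsum fun k => hcd m k x) hdfin ?_
    filter_upwards [ae_lt_top_of_eLpNorm hr0 (Measurable.tsum fun k => (hd k).measurable)
      hdfin] with x hx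
    exact tendsto_tsum_of_dominated (fun m k => hcd m k x) hx.ne fun k => hlim k x
  have h2 := ENNReal.Tendsto.const_mul (a := C) h1 (Or.inr hC)
  rw [mul_zero] at h2
  exact tendsto_of_tendsto_of_tendsto_of_le_of_le tendsto_const_nhds h2 (fun _ => zero_le)
    fun m => (hE (c m) (hc m)).1

/-! ### Translations by multiples of the sidelength -/

/-- The family obtained from `F` by translating `F k` by `2 ^ k m`. -/
noncomputable def scaleShift (m : Fin n → ℤ) (F : ℤ → Eucl n → ℝ≥0∞) (k : ℤ) (x : Eucl n) :
    ℝ≥0∞ := F k (x + dyCorner k m)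

theorem dyConst_scaleShift {F : ℤ → Eucl n → ℝ≥0∞} (hF : ∀ k, DyConst k (F k))
    (m : Fin n → ℤ) (k : ℤ) : DyConst k (scaleShift m F k) := fun x y hxy =>
  hF k _ _ (by rw [dyIdx_add_corner, dyIdx_add_corner, hxy])

/-- A translation by `2 ^ k m` moves a point to a neighbour, of bounded relative position, of its
dyadic cube of any larger sidelength `2 ^ i`. -/
theorem exists_posBox_add_corner {k i M : ℤ} (hki : k ≤ i) {m : Fin n → ℤ}
    (hm : m ∈ posBox n M) (x : Eucl n) :
    ∃ m' ∈ posBox n M, dyIdx i (x + dyCorner k m) = dyIdx i (x + dyCorner i m') := by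
  rw [posBox, Finset.mem_Icc] at hm
  obtain ⟨m', hm', h⟩ := exists_posBox (k := i) (M := M) (x := x) (y := x + dyCorner k m) fun ι => by
    have h1 : |(m ι : ℝ)| ≤ M := by
      exact_mod_cast abs_le.2 ⟨hm.1 ι, hm.2 ι⟩
    have h2 : (2 : ℝ) ^ k ≤ 2 ^ i := zpow_le_zpow_right₀ (by norm_num) hki
    simp only [dyCorner, PiLp.add_apply, add_sub_cancel_left, abs_mul]
    rw [abs_of_pos (show (0 : ℝ) < 2 ^ k by positivity)]
    gcongr
    exact (abs_nonneg _).trans h1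
  exact ⟨m', hm', by rw [h, dyIdx_add_corner]⟩

/-- Write `F` as a sum of increments of running maxima. At a smaller scale `k`, a translation by
`2 ^ k m` moves the increment at scale `i` to one of its boundedly many translates by multiples of
`2 ^ i`, none of which depends on `k`, and translations preserve integrals. -/
theorem lintegral_scaleSup_scaleShift_le {M : ℤ} {m : Fin n → ℤ} (hm : m ∈ posBox n M)
    {F : ℤ → Eucl n → ℝ≥0∞} (hF : ∀ k, DyConst k (F k)) :
    ∫⁻ x, scaleSup (scaleShift m F) x ≤ (posBox n M).card * ∫⁻ x, scaleSup F x := by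
  have hSm : ∀ k, Measurable (scaleShift m F k) := fun k => (dyConst_scaleShift hF m k).measurable
  have h1 := eLpNorm_scaleSup 1 hSm
  simp only [eLpNorm_one_eq_lintegral_enorm, enorm_eq_self] at h1
  rw [h1]
  refine iSup_le fun K => ?_
  set f : ℕ → Eucl n → ℝ≥0∞ := fun j => F (K - j) with hf
  have hfc : ∀ j : ℕ, DyConst (K - j) (f j) := fun j => hF _
  have hdm : ∀ j, Measurable (maxIncr f j) := fun j => (dyConst_maxIncr hfc j).measurable
  have hdt : ∀ (i : ℕ) (v : Eucl n), Measurable fun x => maxIncr f i (x + v) := fun i v =>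
    (hdm i).comp (measurable_add_const v)
  calc ∫⁻ x, partialSups (fun j : ℕ => scaleShift m F (K - j)) (2 * K) x
      ≤ ∫⁻ x, ∑ i ∈ Finset.range (2 * K + 1), ∑ m' ∈ posBox n M,
          maxIncr f i (x + dyCorner (K - i) m') := by
        refine lintegral_mono fun x => partialSups_scale_le (scaleShift m F) K (2 * K)
          (G := fun x => ∑ i ∈ Finset.range (2 * K + 1), ∑ m' ∈ posBox n M,
            maxIncr f i (x + dyCorner (K - i) m')) (fun j hj x => ?_) x
        calc F (K - j) (x + dyCorner (K - j) m)
            ≤ partialSups f j (x + dyCorner (K - j) m) := le_partialSups f j _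
          _ = ∑ i ∈ Finset.range (j + 1), maxIncr f i (x + dyCorner (K - j) m) :=
              (sum_maxIncr f j _).symm
          _ ≤ ∑ i ∈ Finset.range (j + 1), ∑ m' ∈ posBox n M,
                maxIncr f i (x + dyCorner (K - i) m') := by
              refine Finset.sum_le_sum fun i hi => ?_
              have hij : (K : ℤ) - j ≤ K - i := by
                have := Finset.mem_range.1 hi
                omega
              obtain ⟨m', hm', h⟩ := exists_posBox_add_corner hij hm x
              rw [dyConst_maxIncr hfc i _ _ h]
              exact Finset.single_le_sum
                (f := fun m' => maxIncr f i (x + dyCorner (K - i) m')) (fun _ _ => zero_le) hm'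
          _ ≤ _ := Finset.sum_le_sum_of_subset (Finset.range_mono (by omega))
    _ = ∑ i ∈ Finset.range (2 * K + 1), ∑ m' ∈ posBox n M, ∫⁻ x, maxIncr f i x := by
        rw [lintegral_finsetSum _ fun i _ => Finset.measurable_sum _ fun m' _ =>
          hdt i _]
        refine Finset.sum_congr rfl fun i _ => ?_
        rw [lintegral_finsetSum _ fun m' _ => hdt i _]
        exact Finset.sum_congr rfl fun m' _ => lintegral_add_right_eq_self _ _
    _ = (posBox n M).card * ∫⁻ x, partialSups f (2 * K) x := by
        simp only [Finset.sum_const, nsmul_eq_mul]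
        rw [← Finset.mul_sum, ← lintegral_finsetSum _ fun i _ => hdm i]
        simp_rw [sum_maxIncr]
    _ ≤ _ := by
        gcongr with x
        exact partialSups_scale_le F K _ (fun j _ x => le_iSup (fun k => F k x) _) x

/-- Replacing each dyadic cube by a neighbour of bounded relative position changes the norm of the
maximal functional by at most a constant factor. -/
theorem eLpNorm_scaleSup_scaleShift_le {p : ℝ≥0∞} (hp : 1 ≤ p) (M : ℤ) :
    ∃ C : ℝ≥0∞, C ≠ ∞ ∧ ∀ m ∈ posBox n M, ∀ F : ℤ → Eucl n → ℝ≥0∞, (∀ k, DyConst k (F k)) →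
      eLpNorm (scaleSup (scaleShift m F)) p volume ≤ C * eLpNorm (scaleSup F) p volume := by
  have hp0 : p ≠ 0 := by positivity
  rcases eq_or_ne p ∞ with rfl | hpt
  · refine ⟨1, ENNReal.one_ne_top, fun m _ F hF => ?_⟩
    rw [one_mul]
    have h1 : ∀ k, ∀ᵐ x, scaleShift m F k x ≤ eLpNorm (scaleSup F) ∞ volume := by
      intro k
      have h2 : ∀ᵐ x, F k x ≤ eLpNorm (scaleSup F) ∞ volume := by
        rw [eLpNorm_exponent_top]
        filter_upwards [enorm_ae_le_eLpNormEssSup (scaleSup F) volume] with x hx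
        exact (le_iSup (fun k => F k x) k).trans (show scaleSup F x ≤ _ by simpa using hx)
      exact (measurePreserving_add_right volume (dyCorner k m)).quasiMeasurePreserving.ae h2
    rw [eLpNorm_exponent_top (f := scaleSup (scaleShift m F))]
    refine essSup_le_of_ae_le _ ?_
    filter_upwards [ae_all_iff.2 h1] with x hx
    simpa [scaleSup] using hx
  · have hrp := ENNReal.toReal_pos hp0 hpt
    refine ⟨((posBox n M).card : ℝ≥0∞) ^ p.toReal⁻¹, ENNReal.rpow_ne_top_of_nonneg
      (inv_nonneg.2 hrp.le) (ENNReal.natCast_ne_top _), fun m hm F hF => ?_⟩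
    have hsup : ∀ G : ℤ → Eucl n → ℝ≥0∞, ∀ x, scaleSup G x ^ p.toReal
        = scaleSup (fun k x => G k x ^ p.toReal) x := fun G x =>
      (ENNReal.orderIsoRpow p.toReal hrp).map_iSup fun k => G k x
    rw [← ENNReal.rpow_le_rpow_iff hrp, ENNReal.mul_rpow_of_nonneg _ _ hrp.le, ← ENNReal.rpow_mul,
      inv_mul_cancel₀ hrp.ne', ENNReal.rpow_one, eLpNorm_pow_toReal hp0 hpt,
      eLpNorm_pow_toReal hp0 hpt]
    simp_rw [hsup]
    -- the case `p = 1`, for the family `F k ^ p`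
    exact lintegral_scaleSup_scaleShift_le hm
      (fun k => (hF k).comp₂ (hF k) fun a _ => a ^ p.toReal)

end Discrete

/-! ### Dyadic Whitney bricks -/

section Bricks

variable {n : ℕ}

/-- Ratio of height to sidelength of the dyadic Whitney bricks, large enough for the horizontal
extent of a brick to be small compared to its height. -/
noncomputable def aspect (n : ℕ) (S : Shape) : ℝ := (n + 1) / S.c₁

theorem aspect_pos (n : ℕ) (S : Shape) : 0 < aspect n S := by
  have := S.c₁_pos
  unfold aspect
  positivity

/-- The thickness of the bricks over the cubes of sidelength `2 ^ k`. -/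
noncomputable def thickness (n : ℕ) (S : Shape) (k : ℤ) : ℝ≥0∞ := ENNReal.ofReal (aspect n S * 2 ^ k)

/-- The dyadic Whitney brick over a dyadic cube. -/
def brick (S : Shape) (R : DyIndex n) : Set (ℝ × Eucl n) :=
  Ico (aspect n S * 2 ^ R.1) (aspect n S * 2 ^ (R.1 + 1)) ×ˢ dyCube R.1 R.2

/-- The scale of the brick at height `t`. -/
noncomputable def scaleAt (n : ℕ) (S : Shape) (t : ℝ) : ℤ := Int.log 2 (t / aspect n S)

/-- The index of the brick containing a point of the half space. -/
noncomputable def brickIdx (S : Shape) (z : ℝ × Eucl n) : DyIndex n :=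
  (scaleAt n S z.1, dyIdx (scaleAt n S z.1) z.2)

theorem scaleAt_le (S : Shape) {t : ℝ} (ht : 0 < t) : aspect n S * 2 ^ scaleAt n S t ≤ t := by
  have h := Int.zpow_log_le_self (b := 2) one_lt_two (div_pos ht (aspect_pos n S))
  rw [le_div_iff₀ (aspect_pos n S), mul_comm] at h
  exact_mod_cast h

theorem lt_scaleAt (S : Shape) (t : ℝ) : t < aspect n S * 2 ^ (scaleAt n S t + 1) := by
  have h := Int.lt_zpow_succ_log_self (b := 2) one_lt_two (t / aspect n S)
  rw [div_lt_iff₀ (aspect_pos n S), mul_comm] at h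
  exact_mod_cast h

theorem lt_of_mul_zpow_lt (S : Shape) {k i : ℤ} (h : aspect n S * 2 ^ k < aspect n S * 2 ^ i) :
    k < i :=
  (zpow_lt_zpow_iff_right₀ (one_lt_two : (1 : ℝ) < 2)).1
    (lt_of_mul_lt_mul_left h (aspect_pos n S).le)

theorem scaleAt_eq_iff (S : Shape) {t : ℝ} (ht : 0 < t) (k : ℤ) :
    scaleAt n S t = k ↔ t ∈ Ico (aspect n S * 2 ^ k) (aspect n S * 2 ^ (k + 1)) := by
  constructor
  · rintro rfl
    exact ⟨scaleAt_le S ht, lt_scaleAt S t⟩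
  · rintro ⟨h1, h2⟩
    have h3 := lt_of_mul_zpow_lt S (h1.trans_lt (lt_scaleAt S t))
    have h4 := lt_of_mul_zpow_lt S ((scaleAt_le S ht).trans_lt h2)
    omega

theorem pos_of_mem_brick {S : Shape} {R : DyIndex n} {z : ℝ × Eucl n} (hz : z ∈ brick S R) :
    0 < z.1 :=
  (mul_pos (aspect_pos n S) (by positivity)).trans_le hz.1.1

theorem mem_brick_iff (S : Shape) {z : ℝ × Eucl n} (hz : 0 < z.1) (R : DyIndex n) :
    z ∈ brick S R ↔ brickIdx S z = R := by
  rw [brick, mem_prod, ← scaleAt_eq_iff S hz, brickIdx, Prod.ext_iff]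
  constructor
  · rintro ⟨h1, h2⟩
    exact ⟨h1, by simp only [h1]; exact h2⟩
  · rintro ⟨h1, h2⟩
    simp only at h1
    exact ⟨h1, by simp only [h1] at h2; exact h2⟩

theorem brickIdx_eq {S : Shape} {R : DyIndex n} {z : ℝ × Eucl n} (hz : z ∈ brick S R) :
    brickIdx S z = R := (mem_brick_iff S (pos_of_mem_brick hz) R).1 hz

theorem measurableSet_brick (S : Shape) (R : DyIndex n) : MeasurableSet (brick S R) :=
  measurableSet_Ico.prod (measurableSet_dyCube _ _)

theorem brick_subset (S : Shape) (R : DyIndex n) : brick S R ⊆ halfSpace n :=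
  fun _ hz => pos_of_mem_brick hz

theorem iUnion_brick (S : Shape) : ⋃ R : DyIndex n, brick S R = halfSpace n :=
  subset_antisymm (iUnion_subset fun R => brick_subset S R) fun z hz =>
    mem_iUnion.2 ⟨brickIdx S z, (mem_brick_iff S hz _).2 rfl⟩

theorem pairwise_disjoint_brick (S : Shape) :
    Pairwise (Function.onFun Disjoint (brick (n := n) S)) := fun _ _ h =>
  disjoint_left.2 fun _ h1 h2 => h ((brickIdx_eq h1).symm.trans (brickIdx_eq h2))

theorem lintegral_halfVol (S : Shape) (H : ℝ × Eucl n → ℝ≥0∞) :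
    ∫⁻ z, H z ∂(halfVol n) = ∑' R, ∫⁻ z in brick S R, H z := by
  rw [halfVol, ← iUnion_brick S,
    lintegral_iUnion (measurableSet_brick S) (pairwise_disjoint_brick S)]

theorem thickness_ne_zero (S : Shape) (k : ℤ) : thickness n S k ≠ 0 := by
  have := aspect_pos n S
  rw [thickness, Ne, ENNReal.ofReal_eq_zero, not_le]
  positivity

theorem thickness_ne_top (S : Shape) (k : ℤ) : thickness n S k ≠ ∞ := ENNReal.ofReal_ne_top

theorem volume_brick (S : Shape) (R : DyIndex n) :
    volume (brick S R) = thickness n S R.1 * volume (dyCube R.1 R.2) := by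
  rw [brick, Measure.volume_eq_prod, Measure.prod_prod, Real.volume_Ico, thickness,
    zpow_add_one₀ two_ne_zero]
  congr 2
  ring

theorem volume_brick_ne_zero (S : Shape) (R : DyIndex n) : volume (brick S R) ≠ 0 := by
  rw [volume_brick]
  exact mul_ne_zero (thickness_ne_zero S _) (volume_dyCube_ne_zero _ _)

theorem volume_brick_ne_top (S : Shape) (R : DyIndex n) : volume (brick S R) ≠ ∞ := by
  rw [volume_brick]
  exact ENNReal.mul_ne_top (thickness_ne_top S _) (volume_dyCube_ne_top _ _)

/-- Bricks have the same volume as the Whitney regions of points at comparable height, up to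
constant factors. -/
theorem exists_volume_comparable (n : ℕ) (S : Shape) {b : ℝ} (hb : 0 < b) :
    ∃ C : ℝ≥0∞, C ≠ ∞ ∧ 1 ≤ C ∧ ∀ (z : ℝ × Eucl n) (R : DyIndex n), 0 < z.1 → z.1 ≤ b * 2 ^ R.1 →
      2 ^ R.1 ≤ b * z.1 → volume (whitney S z) ≤ C * volume (brick S R) ∧
        volume (brick S R) ≤ C * volume (whitney S z) := by
  set A := aspect n S
  have hA : 0 < A := aspect_pos n S
  set β := (volume (Metric.ball (0 : Eucl n) 1)).toReal with hβ
  have hβ0 : 0 < β := ENNReal.toReal_pos (Metric.measure_ball_pos _ _ one_pos).ne'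
    measure_ball_lt_top.ne
  have hc0 : 0 < S.c₀ - S.c₀⁻¹ := sub_pos.2
    ((inv_lt_one_of_one_lt₀ S.one_lt_c₀).trans S.one_lt_c₀)
  have hc1 := S.c₁_pos
  set κ := (S.c₀ - S.c₀⁻¹) * S.c₁ ^ n * β with hκ
  have hκ0 : 0 < κ := by positivity
  have hW : ∀ z : ℝ × Eucl n, 0 < z.1 →
      volume (whitney S z) = ENNReal.ofReal (κ * z.1 ^ (n + 1)) := by
    intro z hz
    rw [volume_whitney S hz, ← ENNReal.ofReal_toReal (measure_ball_lt_top
      (x := (0 : Eucl n)) (r := 1)).ne, ← ENNReal.ofReal_mul (by positivity),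
      ← ENNReal.ofReal_mul (by rw [← sub_mul]; positivity)]
    congr 1
    rw [hκ, mul_pow]
    ring
  have hR : ∀ R : DyIndex n, volume (brick S R) = ENNReal.ofReal (A * (2 ^ R.1) ^ (n + 1)) := by
    intro R
    rw [volume_brick, volume_dyCube, thickness, ← ENNReal.ofReal_pow (by positivity),
      ← ENNReal.ofReal_mul (by positivity)]
    congr 1
    ring
  refine ⟨ENNReal.ofReal (max 1 (max (κ * b ^ (n + 1) / A) (A * b ^ (n + 1) / κ))),
    ENNReal.ofReal_ne_top, ?_, fun z R hz h1 h2 => ?_⟩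
  · rw [← ENNReal.ofReal_one]
    exact ENNReal.ofReal_le_ofReal (le_max_left _ _)
  · rw [hW z hz, hR, ← ENNReal.ofReal_mul (by positivity), ← ENNReal.ofReal_mul (by positivity)]
    constructor
    · refine ENNReal.ofReal_le_ofReal ?_
      calc κ * z.1 ^ (n + 1) ≤ κ * (b * 2 ^ R.1) ^ (n + 1) := by gcongr
        _ = (κ * b ^ (n + 1) / A) * (A * (2 ^ R.1) ^ (n + 1)) := by
            rw [mul_pow]
            field_simp
        _ ≤ _ := by
            gcongr
            exact (le_max_left _ _).trans (le_max_right _ _)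
    · refine ENNReal.ofReal_le_ofReal ?_
      calc A * (2 ^ R.1) ^ (n + 1) ≤ A * (b * z.1) ^ (n + 1) := by gcongr
        _ = (A * b ^ (n + 1) / κ) * (κ * z.1 ^ (n + 1)) := by
            rw [mul_pow]
            field_simp
        _ ≤ _ := by
            gcongr
            exact (le_max_right _ _).trans (le_max_right _ _)

/-- Comparable volumes have comparable negative powers. The exponent is at most one, so the constant
does not depend on it. -/
theorem rpow_neg_le_of_le_mul {C u v : ℝ≥0∞} (hC : C ≠ ∞) (hC1 : 1 ≤ C) (h : u ≤ C * v) {e : ℝ}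
    (he0 : 0 ≤ e) (he1 : e ≤ 1) : v ^ (-e) ≤ C * u ^ (-e) := by
  have hC0 : C ≠ 0 := (zero_lt_one.trans_le hC1).ne'
  have h1 : u ^ e ≤ C * v ^ e := by
    refine (ENNReal.rpow_le_rpow h he0).trans ?_
    rw [ENNReal.mul_rpow_of_nonneg _ _ he0]
    gcongr
    exact (ENNReal.rpow_le_rpow_of_exponent_le hC1 he1).trans_eq (ENNReal.rpow_one C)
  rw [ENNReal.rpow_neg, ENNReal.rpow_neg, ← div_eq_mul_inv, ENNReal.le_div_iff_mul_le
    (Or.inr hC0) (Or.inr hC), mul_comm, ← div_eq_mul_inv]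
  exact ENNReal.div_le_of_le_mul h1

theorem exponent_mem {q : ℝ≥0∞} (hq : 1 ≤ q) : 0 ≤ (q⁻¹).toReal ∧ (q⁻¹).toReal ≤ 1 := by
  refine ⟨ENNReal.toReal_nonneg, ?_⟩
  have h : q⁻¹ ≤ 1 := ENNReal.inv_le_one.2 hq
  simpa using ENNReal.toReal_mono ENNReal.one_ne_top h

/-- The normalised `L_q` average of `f` over a dyadic Whitney brick. -/
noncomputable def brickAvg (S : Shape) (q : ℝ≥0∞) (f : ℝ × Eucl n → ℝ) (R : DyIndex n) : ℝ≥0∞ :=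
  volume (brick S R) ^ (-(q⁻¹).toReal) * eLpNorm f q (volume.restrict (brick S R))

/-- A sequence indexed by dyadic cubes, as a family of functions constant on cubes. -/
noncomputable def dyStep (F : DyIndex n → ℝ≥0∞) (k : ℤ) (x : Eucl n) : ℝ≥0∞ := F (k, dyIdx k x)

theorem dyConst_dyStep (F : DyIndex n → ℝ≥0∞) (k : ℤ) : DyConst k (dyStep F k) :=
  dyConst_comp k fun j => F (k, j)

/-- `dyStep F`, weighted by the thickness of the bricks. -/
noncomputable def weightedStep (S : Shape) (F : DyIndex n → ℝ≥0∞) (k : ℤ) (x : Eucl n) : ℝ≥0∞ :=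
  thickness n S k * dyStep F k x

theorem dyConst_weightedStep (S : Shape) (F : DyIndex n → ℝ≥0∞) (k : ℤ) :
    DyConst k (weightedStep S F k) := dyConst_comp k fun j => thickness n S k * F (k, j)

theorem eLpNorm_restrict_le_sum {α ι : Type*} [MeasurableSpace α] {μ : Measure α} {q : ℝ≥0∞}
    (hq : 1 ≤ q) {f : α → ℝ} (hf : Measurable f) {s : Set α} (hs : MeasurableSet s)
    {I : Finset ι} {t : ι → Set α} (ht : ∀ i, MeasurableSet (t i)) (hst : s ⊆ ⋃ i ∈ I, t i) :
    eLpNorm f q (μ.restrict s) ≤ ∑ i ∈ I, eLpNorm f q (μ.restrict (t i)) := by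
  have hm : ∀ i, Measurable ((t i).indicator fun z => ‖f z‖ₑ) := fun i => hf.enorm.indicator (ht i)
  have h1 : ∀ s, MeasurableSet s →
      eLpNorm f q (μ.restrict s) = eLpNorm (s.indicator fun z => ‖f z‖ₑ) q μ := by
    intro s hs
    rw [eLpNorm_indicator_eq_eLpNorm_restrict hs, eLpNorm_enorm]
  rw [h1 s hs]
  simp_rw [h1 _ (ht _)]
  refine le_trans (eLpNorm_mono_ennreal fun z => ?_)
    (eLpNorm_sum_le (fun i _ => (hm i).aestronglyMeasurable) hq)
  rw [Finset.sum_apply]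
  by_cases hz : z ∈ s
  · obtain ⟨i, hi, hzi⟩ := mem_iUnion₂.1 (hst hz)
    rw [indicator_of_mem hz]
    refine le_trans ?_ (Finset.single_le_sum
      (f := fun i => (t i).indicator (fun z => ‖f z‖ₑ) z) (fun _ _ => zero_le) hi)
    simp only [indicator_of_mem hzi, le_rfl]
  · rw [indicator_of_notMem hz]
    exact zero_le

/-! ### Bricks are dominated by Whitney regions -/

/-- The number of horizontal slices into which bricks are cut, large enough for the ratio of any two
heights in a slice to be less than `c₀`. -/
noncomputable def sliceNum (S : Shape) : ℕ := ⌈1 / (S.c₀ - 1)⌉₊ + 1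

theorem sliceNum_pos (S : Shape) : (0 : ℝ) < sliceNum S := by
  unfold sliceNum
  positivity

theorem one_add_inv_sliceNum_lt (S : Shape) : 1 + 1 / (sliceNum S : ℝ) < S.c₀ := by
  have h := sub_pos.2 S.one_lt_c₀
  have h1 : 1 / (S.c₀ - 1) < sliceNum S := by
    unfold sliceNum
    push_cast
    linarith [Nat.le_ceil (1 / (S.c₀ - 1))]
  have h2 := (one_div_lt h (sliceNum_pos S)).1 h1
  linarith

/-- The heights of the `i`-th slice of the bricks of scale `2 ^ k`. -/
def sliceHeights (n : ℕ) (S : Shape) (k : ℤ) (i : ℕ) : Set ℝ :=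
  Ico (aspect n S * 2 ^ k * (1 + i / sliceNum S)) (aspect n S * 2 ^ k * (1 + (i + 1) / sliceNum S))

theorem sliceHeights_subset (S : Shape) (k : ℤ) {i : ℕ} (hi : i < sliceNum S) :
    sliceHeights n S k i ⊆ Ico (aspect n S * 2 ^ k) (aspect n S * 2 ^ (k + 1)) := by
  have hA := aspect_pos n S
  have hB := sliceNum_pos S
  have h2 : (0 : ℝ) < 2 ^ k := by positivity
  refine Ico_subset_Ico ?_ ?_
  · refine le_mul_of_one_le_right (by positivity) ?_
    have : (0 : ℝ) ≤ i / sliceNum S := by positivity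
    linarith
  · rw [zpow_add_one₀ two_ne_zero, ← mul_assoc]
    gcongr
    have : ((i : ℝ) + 1) / sliceNum S ≤ 1 := by
      rw [div_le_one hB]
      exact_mod_cast hi
    linarith

theorem exists_mem_sliceHeights (S : Shape) {k : ℤ} {t : ℝ}
    (ht : t ∈ Ico (aspect n S * 2 ^ k) (aspect n S * 2 ^ (k + 1))) :
    ∃ i < sliceNum S, t ∈ sliceHeights n S k i := by
  have hA := aspect_pos n S
  have hB := sliceNum_pos S
  have h2 : (0 : ℝ) < aspect n S * 2 ^ k := by positivity
  set θ := (t / (aspect n S * 2 ^ k) - 1) * sliceNum S with hθ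
  have h3 : 1 ≤ t / (aspect n S * 2 ^ k) := by rw [le_div_iff₀ h2, one_mul]; exact ht.1
  have h4 : t / (aspect n S * 2 ^ k) < 2 := by
    rw [div_lt_iff₀ h2]
    calc t < aspect n S * 2 ^ (k + 1) := ht.2
      _ = 2 * (aspect n S * 2 ^ k) := by
          rw [zpow_add_one₀ two_ne_zero]
          ring
  have hθ0 : 0 ≤ θ := mul_nonneg (by linarith) hB.le
  have htθ : t = aspect n S * 2 ^ k * (1 + θ / sliceNum S) := by
    rw [hθ]
    field_simp
    ring
  refine ⟨⌊θ⌋₊, ?_, ?_, ?_⟩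
  · rw [Nat.floor_lt hθ0]
    calc θ < 1 * sliceNum S := by
          rw [hθ]
          gcongr
          linarith
      _ = _ := one_mul _
  · rw [htθ]
    gcongr
    exact Nat.floor_le hθ0
  · rw [htθ]
    gcongr
    exact Nat.lt_floor_add_one θ

theorem volume_sliceHeights (S : Shape) (k : ℤ) (i : ℕ) :
    volume (sliceHeights n S k i) = thickness n S k / sliceNum S := by
  rw [sliceHeights, Real.volume_Ico, thickness, ← ENNReal.ofReal_natCast,
    ← ENNReal.ofReal_div_of_pos (sliceNum_pos S)]
  congr 1
  have := sliceNum_pos S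
  field_simp
  ring

theorem disjoint_sliceHeights (S : Shape) (k : ℤ) :
    Pairwise (Function.onFun Disjoint (sliceHeights n S k)) := by
  have hA := aspect_pos n S
  have hB := sliceNum_pos S
  have key : ∀ i j : ℕ, i < j → Disjoint (sliceHeights n S k i) (sliceHeights n S k j) := by
    intro i j hij
    refine disjoint_left.2 fun t h1 h2 => not_le.2 h1.2 (le_trans ?_ h2.1)
    gcongr
    exact_mod_cast hij
  intro i j hij
  rcases lt_or_gt_of_ne hij with h | h
  exacts [key i j h, (key j i h).symm]

theorem norm_sub_lt_of_mem_dyCube {k : ℤ} {x y : Eucl n} (h : dyIdx k x = dyIdx k y) :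
    ‖x - y‖ < (n + 1) * 2 ^ k := by
  have hk : (0 : ℝ) < 2 ^ k := by positivity
  rw [EuclideanSpace.norm_eq, Real.sqrt_lt' (by positivity)]
  calc ∑ i, ‖(x - y) i‖ ^ 2 ≤ ∑ _i : Fin n, ((2 : ℝ) ^ k) ^ 2 := by
        refine Finset.sum_le_sum fun i _ => ?_
        have h1 := Int.abs_sub_lt_one_of_floor_eq_floor (congrFun h i)
        rw [← sub_div, abs_div, abs_of_pos hk, div_lt_one hk] at h1
        exact pow_le_pow_left₀ (norm_nonneg _) h1.le 2
    _ = n * ((2 : ℝ) ^ k) ^ 2 := by simp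
    _ < ((n + 1) * 2 ^ k) ^ 2 := by
        rw [mul_pow]
        gcongr
        nlinarith [(Nat.cast_nonneg n : (0 : ℝ) ≤ n)]

/-- A slice of a brick lies in the Whitney region of each of its points. The whole brick need not,
as `c₀` may be less than `2`. -/
theorem slice_subset_whitney (S : Shape) {k : ℤ} {i : ℕ} {j : Fin n → ℤ} {z : ℝ × Eucl n}
    (hi : i < sliceNum S) (hz : z ∈ sliceHeights n S k i ×ˢ dyCube k j) :
    sliceHeights n S k i ×ˢ dyCube k j ⊆ whitney S z := by
  have hA := aspect_pos n S
  have hB := sliceNum_pos S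
  have hc := one_add_inv_sliceNum_lt S
  have hpos : ∀ t ∈ sliceHeights n S k i, 0 < t := fun t ht =>
    lt_of_lt_of_le (by positivity) (sliceHeights_subset S k hi ht).1
  have hlt : ∀ s ∈ sliceHeights n S k i, ∀ t ∈ sliceHeights n S k i, s < S.c₀ * t := by
    intro s hs t ht
    calc s < aspect n S * 2 ^ k * (1 + (i + 1) / sliceNum S) := hs.2
      _ ≤ (1 + 1 / sliceNum S) * (aspect n S * 2 ^ k * (1 + i / sliceNum S)) := by
          rw [mul_left_comm (1 + 1 / (sliceNum S : ℝ))]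
          refine mul_le_mul_of_nonneg_left ?_ (by positivity)
          have : (0 : ℝ) ≤ 1 / sliceNum S * (i / sliceNum S) := by positivity
          rw [add_div]
          linarith
      _ ≤ S.c₀ * (aspect n S * 2 ^ k * (1 + i / sliceNum S)) := by gcongr
      _ ≤ S.c₀ * t := by
          have := S.one_lt_c₀
          gcongr
          exact ht.1
  rintro w ⟨hw1, hw2⟩
  have hz0 := hpos _ hz.1
  have hc0 : 0 < S.c₀ := by linarith [S.one_lt_c₀]
  refine ⟨?_, ?_, ?_⟩
  · refine (norm_sub_lt_of_mem_dyCube (k := k) (hw2.trans hz.2.symm)).trans_le ?_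
    have h1 : aspect n S * 2 ^ k ≤ z.1 := (sliceHeights_subset S k hi hz.1).1
    have hc1 := S.c₁_pos
    calc ((n : ℝ) + 1) * 2 ^ k = S.c₁ * (aspect n S * 2 ^ k) := by
          unfold aspect
          field_simp
      _ ≤ S.c₁ * z.1 := by gcongr
  · rw [lt_div_iff₀ hz0, inv_mul_lt_iff₀ hc0]
    exact hlt _ hz.1 _ hw1
  · rw [div_lt_iff₀ hz0]
    exact hlt _ hw1 _ hz.1

/-- The part of a brick average coming from one slice is dominated by the Whitney average at every
point of that slice. -/
theorem exists_slice_le_whitneyAvg (n : ℕ) (S : Shape) {q : ℝ≥0∞} (hq : 1 ≤ q) :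
    ∃ C : ℝ≥0∞, C ≠ ∞ ∧ ∀ (f : ℝ × Eucl n → ℝ) (k : ℤ) (j : Fin n → ℤ), ∀ i < sliceNum S,
      ∀ z ∈ sliceHeights n S k i ×ˢ dyCube k j,
        volume (brick S (k, j)) ^ (-(q⁻¹).toReal) *
          eLpNorm f q (volume.restrict (sliceHeights n S k i ×ˢ dyCube k j))
          ≤ C * whitneyAvg S q f z := by
  have hA := aspect_pos n S
  obtain ⟨C, hC, hC1, h⟩ := exists_volume_comparable n S
    (b := max (aspect n S * 2) (aspect n S)⁻¹) (by positivity)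
  refine ⟨C, hC, fun f k j i hi z hz => ?_⟩
  have ht := sliceHeights_subset S k hi hz.1
  have hz0 : 0 < z.1 := lt_of_lt_of_le (by positivity) ht.1
  have h2 : (0 : ℝ) < 2 ^ k := by positivity
  have hv := (h z (k, j) hz0 ?_ ?_).1
  · rw [whitneyAvg, ← mul_assoc]
    obtain ⟨he0, he1⟩ := exponent_mem hq
    refine mul_le_mul' (rpow_neg_le_of_le_mul hC hC1 hv he0 he1) ?_
    exact eLpNorm_mono_measure _ (Measure.restrict_mono (slice_subset_whitney S hi hz) le_rfl)
  · calc z.1 ≤ aspect n S * 2 ^ (k + 1) := ht.2.le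
      _ = aspect n S * 2 * 2 ^ k := by
          rw [zpow_add_one₀ two_ne_zero]
          ring
      _ ≤ _ := by
          gcongr
          exact le_max_left _ _
  · calc (2 : ℝ) ^ k = (aspect n S)⁻¹ * (aspect n S * 2 ^ k) := by field_simp
      _ ≤ (aspect n S)⁻¹ * z.1 := by
          gcongr
          exact ht.1
      _ ≤ _ := by
          gcongr
          exact le_max_right _ _

theorem brickAvg_le_sum_slices (S : Shape) {q : ℝ≥0∞} (hq : 1 ≤ q) {f : ℝ × Eucl n → ℝ}
    (hf : Measurable f) (k : ℤ) (j : Fin n → ℤ) :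
    brickAvg S q f (k, j) ≤ ∑ i ∈ Finset.range (sliceNum S),
      volume (brick S (k, j)) ^ (-(q⁻¹).toReal) *
        eLpNorm f q (volume.restrict (sliceHeights n S k i ×ˢ dyCube k j)) := by
  rw [← Finset.mul_sum, brickAvg]
  gcongr
  refine eLpNorm_restrict_le_sum hq hf (measurableSet_brick S _)
    (fun i => measurableSet_Ico.prod (measurableSet_dyCube _ _)) ?_
  rintro z ⟨hz1, hz2⟩
  obtain ⟨i, hi, hzi⟩ := exists_mem_sliceHeights S hz1
  exact mem_iUnion₂.2 ⟨i, Finset.mem_range.2 hi, hzi, hz2⟩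

theorem left_mem_sliceHeights (S : Shape) (k : ℤ) (i : ℕ) :
    aspect n S * 2 ^ k * (1 + i / sliceNum S) ∈ sliceHeights n S k i := by
  have hA := aspect_pos n S
  have hB := sliceNum_pos S
  refine ⟨le_rfl, ?_⟩
  gcongr
  linarith

/-- Every slice over a cube containing `y` contains a point on the vertical line through `y`. -/
theorem exists_scaleSup_brickAvg_le (n : ℕ) (S : Shape) {q : ℝ≥0∞} (hq : 1 ≤ q) :
    ∃ C : ℝ≥0∞, C ≠ ∞ ∧ ∀ f : ℝ × Eucl n → ℝ, Measurable f → ∀ y,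
      scaleSup (dyStep (brickAvg S q f)) y ≤ C * ntMax S (whitneyAvg S q f) y := by
  obtain ⟨C, hC, h⟩ := exists_slice_le_whitneyAvg n S hq
  refine ⟨sliceNum S * C, ENNReal.mul_ne_top (ENNReal.natCast_ne_top _) hC,
    fun f hf y => iSup_le fun k => ?_⟩
  refine (brickAvg_le_sum_slices S hq hf k _).trans ?_
  rw [mul_assoc]
  refine (Finset.sum_le_card_nsmul _ _ (C * ntMax S (whitneyAvg S q f) y)
    fun i hi => ?_).trans_eq (by simp)
  have hi' := Finset.mem_range.1 hi
  have hmem := left_mem_sliceHeights (n := n) S k i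
  have hA := aspect_pos n S
  have h0 : 0 < aspect n S * 2 ^ k * (1 + i / sliceNum S) :=
    lt_of_lt_of_le (by positivity) (sliceHeights_subset S k hi' hmem).1
  refine (h f k _ i hi' (_, y) ⟨hmem, mem_dyCube_idx k y⟩).trans ?_
  gcongr
  refine le_iSup₂_of_le (_, y) ⟨h0, ?_⟩ le_rfl
  simp only [sub_self, norm_zero]
  exact (mul_pos S.a_pos h0).le

/-- On each vertical line, the integral of the Whitney averages dominates the brick averages. -/
theorem exists_weightedStep_le (n : ℕ) (S : Shape) {q : ℝ≥0∞} (hq : 1 ≤ q) :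
    ∃ C : ℝ≥0∞, C ≠ ∞ ∧ ∀ g : ℝ × Eucl n → ℝ, Measurable g → ∀ k x,
      weightedStep S (brickAvg S q g) k x ≤ C *
        ∫⁻ t in Ico (aspect n S * 2 ^ k) (aspect n S * 2 ^ (k + 1)), whitneyAvg S q g (t, x) := by
  obtain ⟨C, hC, h⟩ := exists_slice_le_whitneyAvg n S hq
  refine ⟨sliceNum S * C, ENNReal.mul_ne_top (ENNReal.natCast_ne_top _) hC, fun g hg k x => ?_⟩
  have hB0 : (sliceNum S : ℝ≥0∞) ≠ 0 := by
    have := sliceNum_pos S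
    exact_mod_cast this.ne'
  have hWm : Measurable fun t : ℝ => whitneyAvg S q g (t, x) :=
    (whitneyAvg_lsc S q hg.aestronglyMeasurable).measurable.comp measurable_prodMk_right
  set a : ℕ → ℝ≥0∞ := fun i => volume (brick S (k, dyIdx k x)) ^ (-(q⁻¹).toReal) *
    eLpNorm g q (volume.restrict (sliceHeights n S k i ×ˢ dyCube k (dyIdx k x))) with ha
  have h1 : ∀ i < sliceNum S, a i * (thickness n S k / sliceNum S) ≤
      C * ∫⁻ t in sliceHeights n S k i, whitneyAvg S q g (t, x) := by
    intro i hi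
    rw [← volume_sliceHeights S k i, ← setLIntegral_const, ← lintegral_const_mul _ hWm]
    exact setLIntegral_mono (hWm.const_mul _) fun t ht => h g k _ i hi (t, x) ⟨ht, rfl⟩
  calc weightedStep S (brickAvg S q g) k x
      ≤ thickness n S k * ∑ i ∈ Finset.range (sliceNum S), a i := by
        unfold weightedStep
        gcongr
        exact brickAvg_le_sum_slices S hq hg k _
    _ = sliceNum S * ∑ i ∈ Finset.range (sliceNum S), a i * (thickness n S k / sliceNum S) := by
        rw [← Finset.sum_mul, mul_left_comm, ENNReal.mul_div_cancel hB0 (by simp), mul_comm]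
    _ ≤ sliceNum S * ∑ i ∈ Finset.range (sliceNum S),
          C * ∫⁻ t in sliceHeights n S k i, whitneyAvg S q g (t, x) := by
        exact mul_le_mul_right
          (Finset.sum_le_sum fun i hi => h1 i (Finset.mem_range.1 hi)) _
    _ = sliceNum S * C * ∫⁻ t in ⋃ i ∈ Finset.range (sliceNum S), sliceHeights n S k i,
          whitneyAvg S q g (t, x) := by
        rw [← Finset.mul_sum, lintegral_biUnion_finset
          (fun i _ j _ hij => disjoint_sliceHeights S k hij)
          (fun i _ => (measurableSet_Ico : MeasurableSet (sliceHeights n S k i))), mul_assoc]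
    _ ≤ _ := by
        gcongr
        exact iUnion₂_subset fun i hi => sliceHeights_subset S k (Finset.mem_range.1 hi)

end Bricks

section Comparison

variable {n : ℕ}

/-! ### The dyadic Carleson functional is dominated by the continuous one -/

/-- **Fubini's theorem** over a box, with the integration along vertical lines first. -/
theorem setLIntegral_vertical (s : Set ℝ) (Q : Set (Eucl n)) {H : ℝ × Eucl n → ℝ≥0∞}
    (hH : Measurable H) : ∫⁻ x in Q, ∫⁻ t in s, H (t, x) = ∫⁻ z in s ×ˢ Q, H z := by
  rw [Measure.volume_eq_prod, ← Measure.prod_restrict, lintegral_prod_symm' _ hH]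

theorem setLIntegral_biUnion_finset_le {α ι : Type*} [MeasurableSpace α] {μ : Measure α}
    (s : Finset ι) (t : ι → Set α) (H : α → ℝ≥0∞) :
    ∫⁻ x in ⋃ i ∈ s, t i, H x ∂μ ≤ ∑ i ∈ s, ∫⁻ x in t i, H x ∂μ := by
  classical
  induction s using Finset.induction_on with
  | empty => simp
  | insert i s hi ih =>
    rw [Finset.set_biUnion_insert, Finset.sum_insert hi]
    exact (lintegral_union_le _ _ _).trans (by gcongr)

theorem abs_sub_lt_of_mem_dyCube {k : ℤ} {x y : Eucl n} (h : dyIdx k x = dyIdx k y) (i : Fin n) :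
    |x i - y i| < 2 ^ k := by
  have hk : (0 : ℝ) < 2 ^ k := by positivity
  have h1 := Int.abs_sub_lt_one_of_floor_eq_floor (congrFun h i)
  rwa [← sub_div, abs_div, abs_of_pos hk, div_lt_one hk] at h1

theorem disjoint_heights (S : Shape) : Pairwise (Function.onFun Disjoint fun k : ℤ =>
    Ico (aspect n S * 2 ^ k) (aspect n S * 2 ^ (k + 1))) := by
  have hA := aspect_pos n S
  intro k i hki
  refine disjoint_left.2 fun t h1 h2 => hki ?_
  have ht : 0 < t := lt_of_lt_of_le (by positivity) h1.1
  rw [← (scaleAt_eq_iff S ht k).2 h1, (scaleAt_eq_iff S ht i).2 h2]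

/-- A dyadic cube, together with all bricks of at most its scale above it, is contained in the box
over a cube of comparable sidelength. -/
theorem exists_dyCarleson_brickAvg_le (n : ℕ) (S : Shape) {q : ℝ≥0∞} (hq : 1 ≤ q) :
    ∃ C : ℝ≥0∞, C ≠ ∞ ∧ ∀ g : ℝ × Eucl n → ℝ, Measurable g → ∀ y,
      dyCarleson (weightedStep S (brickAvg S q g)) y ≤ C * carleson (whitneyAvg S q g) y := by
  have hA := aspect_pos n S
  obtain ⟨C, hC, h⟩ := exists_weightedStep_le n S hq
  -- a cube of sidelength `L * 2 ^ i` centred at `y` contains the dyadic cube of scale `i` at `y`,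
  -- and its sidelength exceeds the heights of the bricks of scale at most `i`
  set L : ℝ := 4 * (aspect n S + 1) with hL
  have hL0 : 0 < L := by positivity
  refine ⟨C * ENNReal.ofReal L ^ n, ENNReal.mul_ne_top hC (ENNReal.pow_ne_top ENNReal.ofReal_ne_top),
    fun g hg y => iSup_le fun i => ?_⟩
  set W := whitneyAvg S q g with hW
  have hWm : Measurable W := (whitneyAvg_lsc S q hg.aestronglyMeasurable).measurable
  have hi0 : (0 : ℝ) < 2 ^ i := by positivity
  set l : ℝ := L * 2 ^ i with hl
  have hl0 : 0 < l := by positivity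
  set v : Eucl n := WithLp.toLp 2 fun ι => y ι - l / 2 with hv
  set Q := dyCube i (dyIdx i y) with hQ
  have hl2 : 2 ^ i ≤ l / 2 := by
    rw [hl, hL]
    nlinarith
  have hy : y ∈ cube v l := fun ι => by
    simp only [hv]
    constructor <;> linarith
  have hQc : Q ⊆ cube v l := fun x hx ι => by
    have := abs_lt.1 (abs_sub_lt_of_mem_dyCube (show dyIdx i x = dyIdx i y from hx) ι)
    simp only [hv]
    constructor <;> linarith [this.1, this.2]
  have hheights : ⋃ k : {k : ℤ // k ≤ i}, Ico (aspect n S * 2 ^ k.1) (aspect n S * 2 ^ (k.1 + 1))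
      ⊆ Ioo 0 l := by
    refine iUnion_subset fun k t ht => ⟨lt_of_lt_of_le (by positivity) ht.1, ht.2.trans_le ?_⟩
    calc aspect n S * 2 ^ (k.1 + 1) ≤ aspect n S * 2 ^ (i + 1) := by
          gcongr
          exacts [one_le_two, k.2]
      _ ≤ l := by
          rw [hl, hL, zpow_add_one₀ two_ne_zero]
          nlinarith
  have hsum : ∀ x, lowerSum (weightedStep S (brickAvg S q g)) i x
      ≤ C * ∫⁻ t in Ioo 0 l, W (t, x) := by
    intro x
    calc lowerSum (weightedStep S (brickAvg S q g)) i x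
        = ∑' k : {k : ℤ // k ≤ i}, weightedStep S (brickAvg S q g) k x := by
          rw [show (∑' k : {k : ℤ // k ≤ i}, weightedStep S (brickAvg S q g) k x) = _ from
            tsum_subtype {k : ℤ | k ≤ i} fun k => weightedStep S (brickAvg S q g) k x]
          exact tsum_congr fun k => by by_cases hk : k ≤ i <;> simp [hk]
      _ ≤ ∑' k : {k : ℤ // k ≤ i}, C *
            ∫⁻ t in Ico (aspect n S * 2 ^ k.1) (aspect n S * 2 ^ (k.1 + 1)), W (t, x) :=
          ENNReal.tsum_le_tsum fun k => h g hg k x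
      _ = C * ∫⁻ t in ⋃ k : {k : ℤ // k ≤ i},
            Ico (aspect n S * 2 ^ k.1) (aspect n S * 2 ^ (k.1 + 1)), W (t, x) := by
          rw [ENNReal.tsum_mul_left, lintegral_iUnion (fun _ => measurableSet_Ico)]
          exact fun k k' hkk => disjoint_heights S fun h => hkk (Subtype.ext h)
      _ ≤ _ := by
          gcongr
  have hvol : (volume Q)⁻¹ = ENNReal.ofReal L ^ n * (volume (cube v l))⁻¹ := by
    rw [hQ, volume_dyCube, volume_cube, hl, ENNReal.ofReal_mul hL0.le, mul_pow,
      ENNReal.mul_inv (by left; simp [hL0]) (by left; finiteness), ← mul_assoc,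
      ENNReal.mul_inv_cancel (by simp [hL0]) (by finiteness), one_mul]
  calc dyAvg i (lowerSum (weightedStep S (brickAvg S q g)) i) y
      ≤ (volume Q)⁻¹ * ∫⁻ x in Q, C * ∫⁻ t in Ioo 0 l, W (t, x) := by
        simp only [dyAvg, dyMean]
        gcongr with x
        exact hsum x
    _ = (volume Q)⁻¹ * (C * ∫⁻ z in Ioo 0 l ×ˢ Q, W z) := by
        rw [lintegral_const_mul' _ _ hC, setLIntegral_vertical _ _ hWm]
    _ ≤ (volume Q)⁻¹ * (C * ∫⁻ z in box v l, W z) := by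
        gcongr
        exact prod_mono_right hQc
    _ = C * ENNReal.ofReal L ^ n * ((volume (cube v l))⁻¹ * ∫⁻ z in box v l, W z) := by
        rw [hvol]
        ring
    _ ≤ _ := by
        gcongr
        exact le_carleson W ⟨hl0, hy⟩

/-! ### Whitney regions are dominated by bricks -/

theorem exists_two_pow_ge (r : ℝ) : ∃ K : ℕ, r ≤ 2 ^ K := by
  obtain ⟨K, hK⟩ := pow_unbounded_of_one_lt r one_lt_two
  exact ⟨K, hK.le⟩

/-- The Whitney average at a point of the cone over `y` is controlled by the brick averages over
boundedly many neighbours of the dyadic cubes containing `y`. -/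
theorem exists_whitneyAvg_le (n : ℕ) (S : Shape) {q : ℝ≥0∞} (hq : 1 ≤ q) :
    ∃ (C : ℝ≥0∞) (K : ℕ) (M : ℤ), C ≠ ∞ ∧ 0 ≤ M ∧ ∀ f : ℝ × Eucl n → ℝ, Measurable f →
      ∀ (z : ℝ × Eucl n) (y : Eucl n), 0 < z.1 → ‖z.2 - y‖ ≤ S.a * z.1 →
        whitneyAvg S q f z ≤ C * ∑ i ∈ Finset.Icc (-(K : ℤ)) K, ∑ m ∈ posBox n M,
          scaleShift m (dyStep (brickAvg S q f)) (scaleAt n S z.1 + i) y := by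
  have hA := aspect_pos n S
  have hc0 : 0 < S.c₀ := by linarith [S.one_lt_c₀]
  have hc1 := S.c₁_pos
  have ha := S.a_pos
  obtain ⟨K, hK⟩ := exists_two_pow_ge S.c₀
  set b := max (aspect n S * 2 ^ (K + 1)) (2 ^ K / aspect n S) with hb
  obtain ⟨C, hC, hC1, hvol⟩ := exists_volume_comparable n S (b := b) (by positivity)
  set M : ℤ := ⌈(S.c₁ + S.a) * (S.c₀ * (aspect n S * 2))⌉ with hM
  refine ⟨C, K, M, hC, Int.ceil_nonneg (by positivity), fun f hf z y hz hzy => ?_⟩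
  set k := scaleAt n S z.1 with hk
  have hk1 : aspect n S * 2 ^ k ≤ z.1 := scaleAt_le S hz
  have hk2 : z.1 < aspect n S * 2 ^ (k + 1) := lt_scaleAt S z.1
  obtain ⟨he0, he1⟩ := exponent_mem hq
  -- the bricks meeting the Whitney region
  have hcover : whitney S z ⊆ ⋃ r ∈ Finset.Icc (-(K : ℤ)) K ×ˢ posBox n M,
      brick S (k + r.1, dyIdx (k + r.1) (y + dyCorner (k + r.1) r.2)) := by
    intro w hw
    have hw0 : 0 < w.1 := whitney_subset S z hw
    obtain ⟨hw1, hw2, hw3⟩ := hw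
    rw [lt_div_iff₀ hz, inv_mul_lt_iff₀ hc0] at hw2
    rw [div_lt_iff₀ hz] at hw3
    set k' := scaleAt n S w.1 with hk'
    have hk'1 : aspect n S * 2 ^ k' ≤ w.1 := scaleAt_le S hw0
    have hk'2 : w.1 < aspect n S * 2 ^ (k' + 1) := lt_scaleAt S w.1
    have hup : k' < k + 1 + K := by
      refine lt_of_mul_zpow_lt S (n := n) ?_
      calc aspect n S * 2 ^ k' < S.c₀ * z.1 := hk'1.trans_lt hw3
        _ ≤ 2 ^ K * (aspect n S * 2 ^ (k + 1)) := by gcongr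
        _ = aspect n S * 2 ^ (k + 1 + K) := by
            rw [zpow_add₀ two_ne_zero (k + 1) K, zpow_natCast]
            ring
    have hlow : k < k' + 1 + K := by
      refine lt_of_mul_zpow_lt S (n := n) ?_
      calc aspect n S * 2 ^ k < S.c₀ * w.1 := hk1.trans_lt hw2
        _ ≤ 2 ^ K * (aspect n S * 2 ^ (k' + 1)) := by gcongr
        _ = aspect n S * 2 ^ (k' + 1 + K) := by
            rw [zpow_add₀ two_ne_zero (k' + 1) K, zpow_natCast]
            ring
    obtain ⟨m, hm, hmk⟩ := exists_posBox (k := k') (M := M) (x := y) (y := w.2) fun ι => by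
      calc |w.2 ι - y ι| ≤ ‖w.2 - y‖ := PiLp.norm_apply_le (w.2 - y) ι
        _ ≤ ‖w.2 - z.2‖ + ‖z.2 - y‖ := norm_sub_le_norm_sub_add_norm_sub _ _ _
        _ ≤ (S.c₁ + S.a) * z.1 := by linarith
        _ ≤ (S.c₁ + S.a) * (S.c₀ * (aspect n S * 2 ^ (k' + 1))) := by
            gcongr
            exact hw2.le.trans (by gcongr)
        _ = (S.c₁ + S.a) * (S.c₀ * (aspect n S * 2)) * 2 ^ k' := by
            rw [zpow_add_one₀ two_ne_zero]
            ring
        _ ≤ M * 2 ^ k' := by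
            gcongr
            exact Int.le_ceil _
    refine mem_iUnion₂.2 ⟨(k' - k, m), Finset.mem_product.2
      ⟨Finset.mem_Icc.2 ⟨by simp only; omega, by simp only; omega⟩, hm⟩, ?_⟩
    have hkk : k + (k' - k) = k' := by ring
    simp only [hkk]
    exact (mem_brick_iff S hw0 _).2 (by rw [brickIdx, dyIdx_add_corner, ← hmk])
  have hterm : ∀ i ∈ Finset.Icc (-(K : ℤ)) K, ∀ j : Fin n → ℤ, volume (whitney S z) ^ (-(q⁻¹).toReal)
      ≤ C * volume (brick S (k + i, j)) ^ (-(q⁻¹).toReal) := by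
    intro i hi j
    rw [Finset.mem_Icc] at hi
    refine rpow_neg_le_of_le_mul hC hC1 (hvol z (k + i, j) hz ?_ ?_).2 he0 he1
    · calc z.1 ≤ aspect n S * 2 ^ (k + 1) := hk2.le
        _ ≤ aspect n S * 2 ^ ((K + 1 : ℕ) + (k + i)) := by
            refine mul_le_mul_of_nonneg_left (zpow_le_zpow_right₀ one_le_two ?_) hA.le
            push_cast
            omega
        _ = aspect n S * 2 ^ (K + 1) * 2 ^ (k + i) := by
            rw [zpow_add₀ two_ne_zero ((K + 1 : ℕ) : ℤ), zpow_natCast]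
            ring
        _ ≤ _ := by
            gcongr
            exact le_max_left _ _
    · calc (2 : ℝ) ^ (k + i) ≤ 2 ^ (k + (K : ℕ)) := by
            gcongr
            exacts [one_le_two, hi.2]
        _ = 2 ^ K / aspect n S * (aspect n S * 2 ^ k) := by
            rw [zpow_add₀ two_ne_zero, zpow_natCast]
            field_simp
        _ ≤ _ := by
            gcongr
            exact le_max_right _ _
  calc whitneyAvg S q f z
      ≤ volume (whitney S z) ^ (-(q⁻¹).toReal) * ∑ r ∈ Finset.Icc (-(K : ℤ)) K ×ˢ posBox n M,
          eLpNorm f q (volume.restrict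
            (brick S (k + r.1, dyIdx (k + r.1) (y + dyCorner (k + r.1) r.2)))) := by
        unfold whitneyAvg
        gcongr
        exact eLpNorm_restrict_le_sum hq hf (isOpen_whitney S z).measurableSet
          (fun r => measurableSet_brick S _) hcover
    _ ≤ ∑ r ∈ Finset.Icc (-(K : ℤ)) K ×ˢ posBox n M,
          C * scaleShift r.2 (dyStep (brickAvg S q f)) (k + r.1) y := by
        rw [Finset.mul_sum]
        refine Finset.sum_le_sum fun r hr => ?_
        rw [scaleShift, dyStep, brickAvg, ← mul_assoc]
        gcongr
        exact hterm r.1 (Finset.mem_product.1 hr).1 _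
    _ = _ := by rw [← Finset.mul_sum, Finset.sum_product]

/-- Each Whitney average in the cone over `y` is a bounded sum of terms of the suprema on the
right. -/
theorem exists_ntMax_le (n : ℕ) (S : Shape) {q : ℝ≥0∞} (hq : 1 ≤ q) :
    ∃ (C : ℝ≥0∞) (M : ℤ), C ≠ ∞ ∧ ∀ f : ℝ × Eucl n → ℝ, Measurable f → ∀ y,
      ntMax S (whitneyAvg S q f) y
        ≤ C * ∑ m ∈ posBox n M, scaleSup (scaleShift m (dyStep (brickAvg S q f))) y := by
  obtain ⟨C, K, M, hC, -, h⟩ := exists_whitneyAvg_le n S hq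
  refine ⟨C * (Finset.Icc (-(K : ℤ)) K).card, M, ENNReal.mul_ne_top hC (by simp),
    fun f hf y => iSup₂_le fun z hz => (h f hf z y hz.1 hz.2).trans ?_⟩
  rw [mul_assoc]
  gcongr
  refine (Finset.sum_le_card_nsmul _ _ _ fun i _ => ?_).trans_eq (nsmul_eq_mul _ _)
  exact Finset.sum_le_sum fun m _ => le_iSup
    (fun k => scaleShift m (dyStep (brickAvg S q f)) k y) _

/-- The box over a cube of sidelength `l` is covered by bricks of scales `k` with `2 ^ k ≲ l`. They
are neighbours of bricks over the cubes of scale `κ` near `y`, where `2 ^ κ` is comparable to `l`. -/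
theorem exists_carleson_le (n : ℕ) (S : Shape) {q : ℝ≥0∞} (hq : 1 ≤ q) :
    ∃ (C : ℝ≥0∞) (M : ℤ), C ≠ ∞ ∧ ∀ g : ℝ × Eucl n → ℝ, Measurable g → ∀ y,
      carleson (whitneyAvg S q g) y ≤ C * ∑ m ∈ posBox n M, scaleSup (scaleShift m
        fun i => dyAvg i (lowerSum (weightedStep S (brickAvg S q g)) i)) y := by
  have hA := aspect_pos n S
  obtain ⟨C, K, M, hC, hM0, h⟩ := exists_whitneyAvg_le n S hq
  set L : ℝ := 2 ^ K / aspect n S + 1 with hL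
  have hL0 : 0 < L := by positivity
  set N : ℕ := (Finset.Icc (-(K : ℤ)) K).card * (posBox n M).card with hN
  refine ⟨C * 2 ^ K * N * ENNReal.ofReal (2 * L) ^ n, M + 1, ?_, fun g hg y => ?_⟩
  · have : (2 : ℝ≥0∞) ^ K ≠ ∞ := ENNReal.pow_ne_top (by simp)
    finiteness
  set W := whitneyAvg S q g with hW
  have hWm : Measurable W := (whitneyAvg_lsc S q hg.aestronglyMeasurable).measurable
  set c := weightedStep S (brickAvg S q g) with hc
  have hcc : ∀ k, DyConst k (c k) := dyConst_weightedStep S _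
  have hcm : ∀ k, Measurable (c k) := fun k => (hcc k).measurable
  refine iSup₂_le fun v l => iSup_le fun ⟨hl, hy⟩ => ?_
  -- a dyadic scale comparable to `l`
  set κ := Int.clog 2 (L * l) with hκ
  have hκ1 : L * l ≤ 2 ^ κ := by exact_mod_cast Int.self_le_zpow_clog one_lt_two (L * l)
  have hκ2 : (2 : ℝ) ^ κ ≤ 2 * L * l := by
    have := Int.zpow_pred_clog_lt_self (b := 2) (r := L * l) one_lt_two (by positivity)
    rw [← hκ] at this
    push_cast at this
    rw [zpow_sub_one₀ two_ne_zero] at this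
    linarith
  have hl1 : l ≤ 2 ^ κ := by
    refine le_trans ?_ hκ1
    have : 1 ≤ L := by
      rw [hL]
      linarith [show 0 < 2 ^ K / aspect n S by positivity]
    nlinarith
  set e : ℝ≥0∞ := ∑ m ∈ posBox n (M + 1),
    ∫⁻ x in dyCube κ (dyIdx κ (y + dyCorner κ m)), lowerSum c κ x with he
  -- integrate the pointwise bound along vertical lines
  have hvert : ∀ x, ∫⁻ t in Ioo 0 l, W (t, x) ≤ C * 2 ^ K * ∑ i ∈ Finset.Icc (-(K : ℤ)) K,
      ∑ m ∈ posBox n M, ∑' k, if k ≤ κ then scaleShift m c k x else 0 := by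
    intro x
    have hbd : ∀ k : ℤ, ∫⁻ t in Ico (aspect n S * 2 ^ k) (aspect n S * 2 ^ (k + 1)) ∩ Ioo 0 l,
        W (t, x) ≤ C * 2 ^ K * ∑ i ∈ Finset.Icc (-(K : ℤ)) K, ∑ m ∈ posBox n M,
          if k + i ≤ κ then scaleShift m c (k + i) x else 0 := by
      intro k
      by_cases hkl : aspect n S * 2 ^ k < l
      swap
      · have : Ico (aspect n S * 2 ^ k) (aspect n S * 2 ^ (k + 1)) ∩ Ioo 0 l = ∅ := by
          ext t
          simp only [mem_inter_iff, mem_Ico, mem_Ioo, mem_empty_iff_false, iff_false, not_and]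
          intro h1 _ h2
          exact hkl (h1.1.trans_lt h2)
        simp [this]
      have hvol : volume (Ico (aspect n S * 2 ^ k) (aspect n S * 2 ^ (k + 1))) = thickness n S k := by
        rw [Real.volume_Ico, thickness, zpow_add_one₀ two_ne_zero]
        congr 1
        ring
      calc ∫⁻ t in Ico (aspect n S * 2 ^ k) (aspect n S * 2 ^ (k + 1)) ∩ Ioo 0 l, W (t, x)
          ≤ ∫⁻ t in Ico (aspect n S * 2 ^ k) (aspect n S * 2 ^ (k + 1)), W (t, x) :=
            lintegral_mono_set inter_subset_left
        _ ≤ ∫⁻ _t in Ico (aspect n S * 2 ^ k) (aspect n S * 2 ^ (k + 1)),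
              C * ∑ i ∈ Finset.Icc (-(K : ℤ)) K, ∑ m ∈ posBox n M,
                scaleShift m (dyStep (brickAvg S q g)) (k + i) x := by
            refine setLIntegral_mono measurable_const fun t ht => ?_
            have ht0 : 0 < t := lt_of_lt_of_le (by positivity) ht.1
            have := h g hg (t, x) x ht0 (by
              simp only [sub_self, norm_zero]
              exact (mul_pos S.a_pos ht0).le)
            rwa [(scaleAt_eq_iff S ht0 k).2 ht] at this
        _ = ∑ i ∈ Finset.Icc (-(K : ℤ)) K, ∑ m ∈ posBox n M,
              C * (thickness n S k * scaleShift m (dyStep (brickAvg S q g)) (k + i) x) := by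
            rw [setLIntegral_const, hvol, Finset.mul_sum, Finset.sum_mul]
            refine Finset.sum_congr rfl fun i _ => ?_
            rw [Finset.mul_sum, Finset.sum_mul]
            refine Finset.sum_congr rfl fun m _ => ?_
            ring
        _ ≤ _ := by
            rw [Finset.mul_sum]
            refine Finset.sum_le_sum fun i hi => ?_
            rw [Finset.mul_sum]
            refine Finset.sum_le_sum fun m _ => ?_
            rw [Finset.mem_Icc] at hi
            have hle : k + i ≤ κ := by
              rw [← zpow_le_zpow_iff_right₀ (one_lt_two : (1 : ℝ) < 2)]
              refine le_trans ?_ hκ1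
              calc (2 : ℝ) ^ (k + i) ≤ 2 ^ (k + (K : ℕ)) := by
                    gcongr
                    exacts [one_le_two, hi.2]
                _ = 2 ^ K / aspect n S * (aspect n S * 2 ^ k) := by
                    rw [zpow_add₀ two_ne_zero, zpow_natCast]
                    field_simp
                _ ≤ L * l := by
                    gcongr
                    rw [hL]
                    linarith
            rw [if_pos hle, mul_assoc]
            refine mul_le_mul_right ?_ _
            simp only [scaleShift, hc, weightedStep]
            rw [← mul_assoc]
            gcongr
            have h2K : (2 : ℝ≥0∞) ^ K = ENNReal.ofReal (2 ^ K) := by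
              rw [ENNReal.ofReal_pow zero_le_two]
              simp
            rw [thickness, thickness, h2K, ← ENNReal.ofReal_mul (by positivity)]
            refine ENNReal.ofReal_le_ofReal ?_
            calc aspect n S * 2 ^ k ≤ aspect n S * 2 ^ ((K : ℕ) + (k + i)) := by
                  gcongr
                  · exact one_le_two
                  · omega
              _ = 2 ^ K * (aspect n S * 2 ^ (k + i)) := by
                  rw [zpow_add₀ two_ne_zero (K : ℤ), zpow_natCast]
                  ring
    have hU : Ioo 0 l ⊆ ⋃ k : ℤ,
        Ico (aspect n S * 2 ^ k) (aspect n S * 2 ^ (k + 1)) ∩ Ioo 0 l := fun t ht =>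
      mem_iUnion.2 ⟨scaleAt n S t, (scaleAt_eq_iff S ht.1 _).1 rfl, ht⟩
    calc ∫⁻ t in Ioo 0 l, W (t, x)
        ≤ ∑' k : ℤ, ∫⁻ t in Ico (aspect n S * 2 ^ k) (aspect n S * 2 ^ (k + 1)) ∩ Ioo 0 l,
            W (t, x) := (lintegral_mono_set hU).trans (lintegral_iUnion_le _ _)
      _ ≤ ∑' k : ℤ, C * 2 ^ K * ∑ i ∈ Finset.Icc (-(K : ℤ)) K, ∑ m ∈ posBox n M,
            if k + i ≤ κ then scaleShift m c (k + i) x else 0 := ENNReal.tsum_le_tsum hbd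
      _ = _ := by
          rw [ENNReal.tsum_mul_left, Summable.tsum_finsetSum fun _ _ => ENNReal.summable]
          congr 1
          refine Finset.sum_congr rfl fun i _ => ?_
          rw [Summable.tsum_finsetSum fun _ _ => ENNReal.summable]
          refine Finset.sum_congr rfl fun m _ => ?_
          exact (Equiv.addRight i).tsum_eq fun k => if k ≤ κ then scaleShift m c k x else 0
  -- a translation by `m * 2 ^ k`, `k ≤ κ`, moves the cube into neighbours of scale `κ` of `y`
  have hshift : ∀ m ∈ posBox n M, ∀ k ≤ κ, ∫⁻ x in cube v l, scaleShift m c k x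
      ≤ ∑ m' ∈ posBox n (M + 1), ∫⁻ x in dyCube κ (dyIdx κ (y + dyCorner κ m')), c k x := by
    intro m hm k hk
    have hk2 : (2 : ℝ) ^ k ≤ 2 ^ κ := zpow_le_zpow_right₀ one_le_two hk
    rw [posBox, Finset.mem_Icc] at hm
    set U : Set (Eucl n) := ⋃ m' ∈ posBox n (M + 1), dyCube κ (dyIdx κ (y + dyCorner κ m')) with hU
    have hUm : MeasurableSet U := Finset.measurableSet_biUnion _ fun _ _ => measurableSet_dyCube _ _
    calc ∫⁻ x in cube v l, scaleShift m c k x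
        ≤ ∫⁻ x, U.indicator (c k) (x + dyCorner k m) := by
          rw [← lintegral_indicator (isOpen_cube v l).measurableSet]
          refine lintegral_mono fun x => ?_
          by_cases hx : x ∈ cube v l
          swap
          · rw [indicator_of_notMem hx]
            exact zero_le
          rw [indicator_of_mem hx]
          obtain ⟨m', hm', hmk⟩ := exists_posBox (k := κ) (M := M + 1) (x := y)
            (y := x + dyCorner k m) fun ι => by
              have h1 : |(m ι : ℝ)| ≤ M := by
                exact_mod_cast abs_le.2 ⟨hm.1 ι, hm.2 ι⟩
              have h2 : |x ι - y ι| ≤ l := abs_le.2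
                ⟨by linarith [(hx ι).1, (hy ι).2], by linarith [(hx ι).2, (hy ι).1]⟩
              have h3 : |(m ι : ℝ) * 2 ^ k| ≤ M * 2 ^ κ := by
                rw [abs_mul, abs_of_pos (show (0 : ℝ) < 2 ^ k by positivity)]
                gcongr
              calc |(x + dyCorner k m) ι - y ι| = |(x ι - y ι) + m ι * 2 ^ k| := by
                    simp only [dyCorner, PiLp.add_apply]
                    congr 1
                    ring
                _ ≤ |x ι - y ι| + |(m ι : ℝ) * 2 ^ k| := abs_add_le _ _
                _ ≤ ((M + 1 : ℤ) : ℝ) * 2 ^ κ := by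
                    push_cast
                    linarith
          have hxU : x + dyCorner k m ∈ U := mem_iUnion₂.2 ⟨m', hm', by
            change dyIdx κ _ = _
            rw [hmk, dyIdx_add_corner]⟩
          rw [indicator_of_mem hxU, scaleShift]
      _ = ∫⁻ x in U, c k x := by
          rw [lintegral_add_right_eq_self (fun x => U.indicator (c k) x),
            lintegral_indicator hUm]
      _ ≤ _ := by
          exact setLIntegral_biUnion_finset_le _ _ _
  have hint : ∫⁻ z in box v l, W z ≤ C * 2 ^ K * N * e := by
    rw [box, ← setLIntegral_vertical _ _ hWm]
    refine (lintegral_mono fun x => hvert x).trans ?_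
    have hm1 : ∀ (m : Fin n → ℤ) (k : ℤ),
        Measurable fun x => if k ≤ κ then scaleShift m c k x else 0 := by
      intro m k
      split_ifs
      exacts [(dyConst_scaleShift hcc m k).measurable, measurable_const]
    have hm2 : ∀ m : Fin n → ℤ,
        Measurable fun x => ∑' k, if k ≤ κ then scaleShift m c k x else 0 := fun m =>
      Measurable.tsum fun k => hm1 m k
    have h2K : (2 : ℝ≥0∞) ^ K ≠ ∞ := ENNReal.pow_ne_top (by simp)
    rw [lintegral_const_mul' _ _ (ENNReal.mul_ne_top hC h2K), mul_assoc (C * 2 ^ K)]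
    gcongr
    rw [lintegral_finsetSum _ fun i _ => Finset.measurable_sum _ fun m _ => hm2 m]
    simp_rw [lintegral_finsetSum (posBox n M) fun m _ => hm2 m]
    have : ∀ m ∈ posBox n M,
        ∫⁻ x in cube v l, ∑' k, (if k ≤ κ then scaleShift m c k x else 0) ≤ e := by
      intro m hm
      rw [lintegral_tsum fun k => (hm1 m k).aemeasurable, he]
      simp only [lowerSum]
      simp_rw [lintegral_tsum fun k => (show Measurable fun x => if k ≤ κ then c k x else 0 by
        split_ifs
        exacts [hcm k, measurable_const]).aemeasurable]
      rw [← Summable.tsum_finsetSum fun _ _ => ENNReal.summable]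
      refine ENNReal.tsum_le_tsum fun k => ?_
      split_ifs with hk
      · exact hshift m hm k hk
      · simp
    calc ∑ i ∈ Finset.Icc (-(K : ℤ)) K, ∑ m ∈ posBox n M,
          ∫⁻ x in cube v l, ∑' k, (if k ≤ κ then scaleShift m c k x else 0)
        ≤ ∑ i ∈ Finset.Icc (-(K : ℤ)) K, ∑ m ∈ posBox n M, e :=
          Finset.sum_le_sum fun i _ => Finset.sum_le_sum this
      _ = N * e := by
          simp only [Finset.sum_const, nsmul_eq_mul, hN]
          push_cast
          ring
  have hvol : (volume (cube v l))⁻¹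
      ≤ ENNReal.ofReal (2 * L) ^ n * (ENNReal.ofReal (2 ^ κ) ^ n)⁻¹ := by
    rw [volume_cube, ← div_eq_mul_inv, ENNReal.le_div_iff_mul_le (by left; exact pow_ne_zero _ (by simpa using show (0 : ℝ) < 2 ^ κ by positivity)) (by left; finiteness),
      mul_comm, ← div_eq_mul_inv, ENNReal.div_le_iff (by simp [hl]) (by finiteness), ← mul_pow,
      ← ENNReal.ofReal_mul (by positivity)]
    gcongr
  calc (volume (cube v l))⁻¹ * ∫⁻ z in box v l, W z
      ≤ ENNReal.ofReal (2 * L) ^ n * (ENNReal.ofReal (2 ^ κ) ^ n)⁻¹ * (C * 2 ^ K * N * e) := by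
        gcongr
    _ = C * 2 ^ K * N * ENNReal.ofReal (2 * L) ^ n * ((ENNReal.ofReal (2 ^ κ) ^ n)⁻¹ * e) := by
        ring
    _ ≤ _ := by
        gcongr
        rw [he, Finset.mul_sum]
        refine Finset.sum_le_sum fun m _ => ?_
        refine le_trans (le_of_eq ?_) (le_iSup
          (fun k => scaleShift m (fun i => dyAvg i (lowerSum c i)) k y) κ)
        simp only [scaleShift, dyAvg, dyMean, volume_dyCube]

/-! ### Equivalence of the norms with their dyadic versions -/

theorem eLpNorm_const_mul_le {α : Type*} [MeasurableSpace α] (μ : Measure α) {C : ℝ≥0∞}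
    (hC : C ≠ ∞) (p : ℝ≥0∞) (G : α → ℝ≥0∞) :
    eLpNorm (fun y => C * G y) p μ ≤ C * eLpNorm G p μ := by
  have h := eLpNorm_const_mul_ennreal μ C.toReal p G
  rw [abs_of_nonneg ENNReal.toReal_nonneg, ENNReal.ofReal_toReal hC] at h
  exact h.le

theorem exists_eLpNorm_sum_scaleShift_le {p : ℝ≥0∞} (hp : 1 ≤ p) (M : ℤ) :
    ∃ C : ℝ≥0∞, C ≠ ∞ ∧ ∀ F : ℤ → Eucl n → ℝ≥0∞, (∀ k, DyConst k (F k)) →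
      eLpNorm (fun y => ∑ m ∈ posBox n M, scaleSup (scaleShift m F) y) p volume
        ≤ C * eLpNorm (scaleSup F) p volume := by
  obtain ⟨C, hC, h⟩ := eLpNorm_scaleSup_scaleShift_le (n := n) hp M
  refine ⟨(posBox n M).card * C, ENNReal.mul_ne_top (by simp) hC, fun F hF => ?_⟩
  have h1 := eLpNorm_sum_le (μ := volume) (p := p) (s := posBox n M)
    (f := fun m => scaleSup (scaleShift m F)) (fun m _ => (measurable_scaleSup fun k =>
      (dyConst_scaleShift hF m k).measurable).aestronglyMeasurable) hp
  rw [Finset.sum_fn] at h1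
  refine h1.trans ((Finset.sum_le_card_nsmul _ _ _ fun m hm => h m hm F hF).trans_eq ?_)
  rw [nsmul_eq_mul, mul_assoc]

/-- The norm of `N_{p,q}` is equivalent to its dyadic version. -/
theorem exists_ntENorm_equiv (n : ℕ) (S : Shape) {p q : ℝ≥0∞} (hp : 1 ≤ p) (hq : 1 ≤ q) :
    ∃ C : ℝ≥0∞, C ≠ ∞ ∧ ∀ f : ℝ × Eucl n → ℝ, Measurable f →
      ntENorm S p q f ≤ C * eLpNorm (scaleSup (dyStep (brickAvg S q f))) p volume ∧
      eLpNorm (scaleSup (dyStep (brickAvg S q f))) p volume ≤ C * ntENorm S p q f := by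
  obtain ⟨C₁, M, hC₁, h₁⟩ := exists_ntMax_le n S hq
  obtain ⟨C₂, hC₂, h₂⟩ := exists_eLpNorm_sum_scaleShift_le (n := n) hp M
  obtain ⟨C₃, hC₃, h₃⟩ := exists_scaleSup_brickAvg_le n S hq
  refine ⟨max (C₁ * C₂) C₃, by simp [ENNReal.mul_eq_top, hC₁, hC₂, hC₃], fun f hf => ⟨?_, ?_⟩⟩
  · refine le_trans ?_ (mul_le_mul_left (le_max_left _ _) _)
    refine (eLpNorm_mono_ennreal (h₁ f hf)).trans ((eLpNorm_const_mul_le _ hC₁ _ _).trans ?_)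
    rw [mul_assoc]
    gcongr
    exact h₂ _ (dyConst_dyStep _)
  · refine le_trans ?_ (mul_le_mul_left (le_max_right _ _) _)
    exact (eLpNorm_mono_ennreal (h₃ f hf)).trans (eLpNorm_const_mul_le _ hC₃ _ _)

/-- The norm of `C_{p,q}` is equivalent to its dyadic version. -/
theorem exists_carlesonENorm_equiv (n : ℕ) (S : Shape) {p q : ℝ≥0∞} (hp : 1 ≤ p) (hq : 1 ≤ q) :
    ∃ C : ℝ≥0∞, C ≠ ∞ ∧ ∀ g : ℝ × Eucl n → ℝ, Measurable g →
      carlesonENorm S p q g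
        ≤ C * eLpNorm (dyCarleson (weightedStep S (brickAvg S q g))) p volume ∧
      eLpNorm (dyCarleson (weightedStep S (brickAvg S q g))) p volume
        ≤ C * carlesonENorm S p q g := by
  obtain ⟨C₁, M, hC₁, h₁⟩ := exists_carleson_le n S hq
  obtain ⟨C₂, hC₂, h₂⟩ := exists_eLpNorm_sum_scaleShift_le (n := n) hp M
  obtain ⟨C₃, hC₃, h₃⟩ := exists_dyCarleson_brickAvg_le n S hq
  refine ⟨max (C₁ * C₂) C₃, by simp [ENNReal.mul_eq_top, hC₁, hC₂, hC₃], fun g hg => ⟨?_, ?_⟩⟩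
  · refine le_trans ?_ (mul_le_mul_left (le_max_left _ _) _)
    refine (eLpNorm_mono_ennreal (h₁ g hg)).trans ((eLpNorm_const_mul_le _ hC₁ _ _).trans ?_)
    rw [mul_assoc]
    gcongr
    exact h₂ _ fun k => dyConst_dyAvg _ _
  · refine le_trans ?_ (mul_le_mul_left (le_max_right _ _) _)
    exact (eLpNorm_mono_ennreal (h₃ g hg)).trans (eLpNorm_const_mul_le _ hC₃ _ _)

end Comparison

/-! ### Countable subadditivity and completeness -/

section Completeness

variable {n : ℕ}

theorem whitneyAvg_le_tsum (S : Shape) {q : ℝ≥0∞} (hq : 1 ≤ q) {f : ℝ × Eucl n → ℝ}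
    {F : ℕ → ℝ × Eucl n → ℝ} (hF : ∀ m, Measurable (F m))
    (h : ∀ᵐ z ∂(halfVol n), ‖f z‖ₑ ≤ ∑' m, ‖F m z‖ₑ) (z : ℝ × Eucl n) :
    whitneyAvg S q f z ≤ ∑' m, whitneyAvg S q (F m) z := by
  simp only [whitneyAvg]
  rw [ENNReal.tsum_mul_left]
  gcongr
  calc eLpNorm f q (volume.restrict (whitney S z))
      ≤ eLpNorm (fun w => ∑' m, ‖F m w‖ₑ) q (volume.restrict (whitney S z)) :=
        eLpNorm_mono_enorm_ae ((h.filter_mono (ae_mono (restrict_le S z))).mono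
          fun w hw => by simpa using hw)
    _ ≤ ∑' m, eLpNorm (fun w => ‖F m w‖ₑ) q (volume.restrict (whitney S z)) :=
        eLpNorm_tsum_le hq fun m => (hF m).enorm
    _ = _ := tsum_congr fun m => eLpNorm_enorm _

theorem measurable_whitneyAvg (S : Shape) (q : ℝ≥0∞) {f : ℝ × Eucl n → ℝ} (hf : Measurable f) :
    Measurable (whitneyAvg S q f) := (whitneyAvg_lsc S q hf.aestronglyMeasurable).measurable

theorem ntENorm_le_tsum (S : Shape) {p q : ℝ≥0∞} (hp : 1 ≤ p) (hq : 1 ≤ q) {f : ℝ × Eucl n → ℝ}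
    {F : ℕ → ℝ × Eucl n → ℝ} (hF : ∀ m, Measurable (F m))
    (h : ∀ᵐ z ∂(halfVol n), ‖f z‖ₑ ≤ ∑' m, ‖F m z‖ₑ) :
    ntENorm S p q f ≤ ∑' m, ntENorm S p q (F m) := by
  refine (eLpNorm_mono_ennreal (H := fun y => ∑' m, ntMax S (whitneyAvg S q (F m)) y)
    fun y => iSup₂_le fun z hz => (whitneyAvg_le_tsum S hq hF h z).trans ?_).trans
    (eLpNorm_tsum_le hp fun m =>
      (ntMax_lsc S (whitneyAvg_lsc S q (hF m).aestronglyMeasurable)).measurable)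
  exact ENNReal.tsum_le_tsum fun m => le_iSup₂_of_le z hz le_rfl

theorem carlesonENorm_le_tsum (S : Shape) {p q : ℝ≥0∞} (hp : 1 ≤ p) (hq : 1 ≤ q)
    {f : ℝ × Eucl n → ℝ} {F : ℕ → ℝ × Eucl n → ℝ} (hF : ∀ m, Measurable (F m))
    (h : ∀ᵐ z ∂(halfVol n), ‖f z‖ₑ ≤ ∑' m, ‖F m z‖ₑ) :
    carlesonENorm S p q f ≤ ∑' m, carlesonENorm S p q (F m) := by
  refine (eLpNorm_mono_ennreal (H := fun y => ∑' m, carleson (whitneyAvg S q (F m)) y)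
    fun y => iSup₂_le fun v l => iSup_le fun hl => ?_).trans
    (eLpNorm_tsum_le hp fun m => (carleson_lsc _).measurable)
  calc (volume (cube v l))⁻¹ * ∫⁻ w in box v l, whitneyAvg S q f w
      ≤ (volume (cube v l))⁻¹ * ∫⁻ w in box v l, ∑' m, whitneyAvg S q (F m) w := by
        gcongr with w
        exact whitneyAvg_le_tsum S hq hF h w
    _ = ∑' m, (volume (cube v l))⁻¹ * ∫⁻ w in box v l, whitneyAvg S q (F m) w := by
        rw [lintegral_tsum fun m => (measurable_whitneyAvg S q (hF m)).aemeasurable,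
          ENNReal.tsum_mul_left]
    _ ≤ _ := ENNReal.tsum_le_tsum fun m => le_carleson _ hl

/-- An extended norm on functions modulo null sets which is monotone and countably subadditive. -/
def CountablySubadditive (φ : ExtNorm (HalfFun n)) : Prop :=
  ∀ (f : HalfFun n) (F : ℕ → HalfFun n), (∀ᵐ z ∂(halfVol n), ‖f z‖ₑ ≤ ∑' m, ‖F m z‖ₑ) →
    φ.toFun f ≤ ∑' m, φ.toFun (F m)

theorem countablySubadditive_ntExtNorm (S : Shape) (p q : ℝ≥0∞) [hp : Fact (1 ≤ p)]
    [hq : Fact (1 ≤ q)] : CountablySubadditive (ntExtNorm n S p q) := fun _ F h =>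
  ntENorm_le_tsum S hp.out hq.out (fun m => (F m).measurable) h

theorem countablySubadditive_carlesonExtNorm (S : Shape) (p q : ℝ≥0∞) [hp : Fact (1 ≤ p)]
    [hq : Fact (1 ≤ q)] : CountablySubadditive (carlesonExtNorm n S p q) := fun _ F h =>
  carlesonENorm_le_tsum S hp.out hq.out (fun m => (F m).measurable) h

/-- A series converges absolutely almost everywhere if its extended norms are summable. -/
theorem CountablySubadditive.ae_tsum_ne_top {φ : ExtNorm (HalfFun n)}
    (hφ : CountablySubadditive φ) {F : ℕ → HalfFun n} (hF : ∑' m, φ.toFun (F m) ≠ ∞) :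
    ∀ᵐ z ∂(halfVol n), ∑' m, ‖F m z‖ₑ ≠ ∞ := by
  set E : Set (ℝ × Eucl n) := {z | ∑' m, ‖F m z‖ₑ = ∞} with hE
  have hEm : MeasurableSet E :=
    (Measurable.tsum fun m => (F m).measurable.enorm) (measurableSet_singleton ∞)
  set χ : HalfFun n := AEEqFun.mk (E.indicator fun _ => (1 : ℝ))
    (measurable_const.indicator hEm).aestronglyMeasurable with hχ
  have hχE : χ =ᵐ[halfVol n] E.indicator fun _ => (1 : ℝ) := AEEqFun.coeFn_mk _ _
  -- every multiple of the indicator function of `E` is dominated by the series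
  have hle : ∀ r : ℕ, r * φ.toFun χ ≤ ∑' m, φ.toFun (F m) := by
    intro r
    have h1 := φ.smul' r χ
    rw [abs_of_nonneg (Nat.cast_nonneg r), ENNReal.ofReal_natCast] at h1
    rw [← h1]
    refine hφ _ _ ?_
    filter_upwards [hχE, AEEqFun.coeFn_smul (r : ℝ) χ] with z hz hz'
    rw [hz', Pi.smul_apply, hz]
    by_cases hzE : z ∈ E
    · rw [show ∑' m, ‖F m z‖ₑ = ∞ from hzE]
      exact le_top
    · simp [indicator_of_notMem hzE]
  have h0 : φ.toFun χ = 0 := by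
    by_contra hne
    obtain ⟨r, hr⟩ := ENNReal.exists_nat_mul_gt hne hF
    exact absurd (hle r) (not_le.2 hr)
  have hχ0 := φ.eq_zero' _ h0
  have h2 : χ =ᵐ[halfVol n] 0 := by
    rw [hχ0]
    exact AEEqFun.coeFn_zero
  filter_upwards [hχE, h2] with z hz hz' hzE
  rw [hz', indicator_of_mem (show z ∈ E from hzE)] at hz
  exact zero_ne_one hz

/-- **Riesz–Fischer**: an absolutely convergent series converges pointwise almost everywhere, and
countable subadditivity bounds the norms of the tails. -/
theorem CountablySubadditive.completeSpace {φ : ExtNorm (HalfFun n)}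
    (hφ : CountablySubadditive φ) : CompleteSpace φ.finite := by
  refine NormedAddCommGroup.completeSpace_of_summable_imp_tendsto fun u hu => ?_
  have hnorm : ∀ m, ENNReal.ofReal ‖u m‖ = φ.toFun (u m).1 := fun m => by
    rw [ExtNorm.norm_def, ENNReal.ofReal_toReal (ne_of_lt (u m).2)]
  have hfin : ∑' m, φ.toFun (u m).1 ≠ ∞ := by
    simp_rw [← hnorm]
    exact hu.tsum_ofReal_ne_top
  have hae := hφ.ae_tsum_ne_top hfin
  have hsummable : ∀ᵐ z ∂(halfVol n), Summable fun m => (u m).1 z := by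
    filter_upwards [hae] with z hz
    refine Summable.of_norm ?_
    have h1 := ENNReal.summable_toReal hz
    simpa using h1
  have hmeas : AEStronglyMeasurable (fun z => ∑' m, (u m).1 z) (halfVol n) := by
    refine aestronglyMeasurable_of_tendsto_ae atTop
      (f := fun N z => ∑ m ∈ Finset.range N, (u m).1 z) (fun N => ?_) ?_
    · exact (Finset.measurable_sum _ fun m _ => (u m).1.measurable).aestronglyMeasurable
    · filter_upwards [hsummable] with z hz
      exact hz.hasSum.tendsto_sum_nat
  set f : HalfFun n := AEEqFun.mk _ hmeas with hf
  have hfe : f =ᵐ[halfVol n] fun z => ∑' m, (u m).1 z := AEEqFun.coeFn_mk _ _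
  have hsum : ∀ N, ⇑(∑ m ∈ Finset.range N, (u m).1) =ᵐ[halfVol n]
      fun z => ∑ m ∈ Finset.range N, (u m).1 z := by
    intro N
    induction N with
    | zero =>
      simp only [Finset.range_zero, Finset.sum_empty]
      exact AEEqFun.coeFn_zero
    | succ N ih =>
      rw [Finset.sum_range_succ]
      filter_upwards [AEEqFun.coeFn_add (∑ m ∈ Finset.range N, (u m).1) (u N).1, ih] with z h1 h2
      rw [h1, Pi.add_apply, h2, Finset.sum_range_succ]
  have hdiff : ∀ N, φ.toFun (∑ m ∈ Finset.range N, (u m).1 - f)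
      ≤ ∑' m, φ.toFun (u (m + N)).1 := by
    intro N
    refine hφ _ _ ?_
    filter_upwards [hfe, hsum N, hsummable,
      AEEqFun.coeFn_sub (∑ m ∈ Finset.range N, (u m).1) f] with z h1 h2 h3 h4
    rw [h4, Pi.sub_apply, h1, h2, ← enorm_neg, neg_sub, ← h3.sum_add_tsum_nat_add N,
      add_sub_cancel_left]
    exact enorm_tsum_le_tsum_enorm
  have hfmem : f ∈ φ.finite := by
    have h0 := hdiff 0
    simp only [Finset.range_zero, Finset.sum_empty, add_zero] at h0
    have : 0 - f ∈ φ.finite := h0.trans_lt hfin.lt_top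
    simpa using this
  refine ⟨⟨f, hfmem⟩, tendsto_iff_norm_sub_tendsto_zero.2 ?_⟩
  have htail := ENNReal.tendsto_sum_nat_add _ hfin
  have hlim : Tendsto (fun N => φ.toFun (∑ m ∈ Finset.range N, (u m).1 - f)) atTop (𝓝 0) :=
    tendsto_of_tendsto_of_tendsto_of_le_of_le tendsto_const_nhds htail (fun _ => zero_le) hdiff
  refine ((ENNReal.tendsto_toReal ENNReal.zero_ne_top).comp hlim).congr fun N => ?_
  rw [ExtNorm.norm_def]
  simp

end Completeness

section Pairing

variable {n : ℕ}

/-! ### Functions built from data on bricks -/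

theorem measurable_scaleAt (S : Shape) : Measurable (scaleAt n S) := by
  refine measurable_to_countable' fun k => ?_
  have h : scaleAt n S ⁻¹' {k} = (Ioi 0 ∩ Ico (aspect n S * 2 ^ k) (aspect n S * 2 ^ (k + 1))) ∪
      (Iic 0 ∩ {_t | (0 : ℤ) = k}) := by
    ext t
    rcases lt_or_ge 0 t with ht | ht
    · simp [← scaleAt_eq_iff S ht k, ht]
    · have : scaleAt n S t = 0 := by
        rw [scaleAt, Int.log_of_right_le_zero _ (div_nonpos_of_nonpos_of_nonneg ht
          (aspect_pos n S).le)]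
      simp [this, ht]
  rw [h]
  exact (measurableSet_Ioi.inter measurableSet_Ico).union
    (measurableSet_Iic.inter (MeasurableSet.const _))

theorem measurable_brickIdx (S : Shape) : Measurable (brickIdx (n := n) S) := by
  have h : Measurable fun w : ℤ × Eucl n => dyIdx w.1 w.2 :=
    measurable_from_prod_countable_right fun k => measurable_dyIdx k
  have h1 : Measurable fun z : ℝ × Eucl n => scaleAt n S z.1 :=
    (measurable_scaleAt S).comp measurable_fst
  exact h1.prodMk (h.comp (h1.prodMk measurable_snd))

theorem measurable_comp_brickIdx (S : Shape) {β : Type*} [MeasurableSpace β]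
    (H : DyIndex n → β) : Measurable fun z => H (brickIdx S z) :=
  (measurable_of_countable H).comp (measurable_brickIdx S)

/-- Gluing functions given on the individual bricks. -/
theorem measurable_glue (S : Shape) {Φ : DyIndex n → ℝ × Eucl n → ℝ≥0∞}
    (hΦ : ∀ R, Measurable (Φ R)) : Measurable fun z => Φ (brickIdx S z) z := by
  have h : Measurable fun w : DyIndex n × (ℝ × Eucl n) => Φ w.1 w.2 :=
    measurable_from_prod_countable_right fun R => hΦ R
  exact h.comp ((measurable_brickIdx S).prodMk measurable_id)

theorem brick_scaling (S : Shape) (q : ℝ≥0∞) (R : DyIndex n) :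
    volume (brick S R) ^ (-(q⁻¹).toReal) * volume (brick S R) ^ (q⁻¹).toReal = 1 := by
  rw [← ENNReal.rpow_add _ _ (volume_brick_ne_zero S R) (volume_brick_ne_top S R),
    neg_add_cancel, ENNReal.rpow_zero]

theorem eLpNorm_eq_brickAvg (S : Shape) (q : ℝ≥0∞) (f : ℝ × Eucl n → ℝ) (R : DyIndex n) :
    eLpNorm f q (volume.restrict (brick S R))
      = volume (brick S R) ^ (q⁻¹).toReal * brickAvg S q f R := by
  rw [brickAvg, ← mul_assoc, mul_comm (_ ^ (q⁻¹).toReal), brick_scaling, one_mul]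

theorem brickAvg_comp_brickIdx (S : Shape) {q : ℝ≥0∞} (hq : 1 ≤ q) (H : DyIndex n → ℝ)
    (R : DyIndex n) : brickAvg S q (fun z => H (brickIdx S z)) R = ‖H R‖ₑ := by
  have hq0 : q ≠ 0 := by positivity
  have h1 : (fun z => H (brickIdx S z)) =ᵐ[volume.restrict (brick S R)] fun _ => H R := by
    filter_upwards [ae_restrict_mem (measurableSet_brick S R)] with z hz
    rw [brickIdx_eq hz]
  have hne : volume.restrict (brick S R) ≠ 0 := by
    rw [Ne, Measure.restrict_eq_zero]
    exact volume_brick_ne_zero S R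
  rw [brickAvg, eLpNorm_congr_ae h1, eLpNorm_const _ hq0 hne, Measure.restrict_apply_univ,
    mul_left_comm]
  have : (1 / q.toReal) = (q⁻¹).toReal := by rw [ENNReal.toReal_inv, one_div]
  rw [this, brick_scaling, mul_one]

theorem conj_exponent_add {q q' : ℝ≥0∞} (h : q⁻¹ + q'⁻¹ = 1) :
    (q⁻¹).toReal + (q'⁻¹).toReal = 1 := by
  have h1 : q⁻¹ ≠ ∞ := ne_top_of_le_ne_top ENNReal.one_ne_top (h ▸ le_self_add)
  have h2 : q'⁻¹ ≠ ∞ := ne_top_of_le_ne_top ENNReal.one_ne_top (h ▸ le_add_self)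
  rw [← ENNReal.toReal_add h1 h2, h, ENNReal.toReal_one]

theorem brick_scaling_conj (S : Shape) {q q' : ℝ≥0∞} (h : q⁻¹ + q'⁻¹ = 1) (R : DyIndex n) :
    volume (brick S R) ^ (q⁻¹).toReal * volume (brick S R) ^ (q'⁻¹).toReal
      = volume (brick S R) := by
  rw [← ENNReal.rpow_add _ _ (volume_brick_ne_zero S R) (volume_brick_ne_top S R),
    conj_exponent_add h, ENNReal.rpow_one]

/-- A weighted sum over bricks as a sum over scales of integrals over `ℝⁿ`. -/
theorem tsum_volume_brick_mul (S : Shape) (F G : DyIndex n → ℝ≥0∞) :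
    ∑' R, volume (brick S R) * F R * G R
      = ∑' k, ∫⁻ x, dyStep F k x * weightedStep S G k x := by
  rw [ENNReal.tsum_prod']
  refine tsum_congr fun k => ?_
  have h := lintegral_idx_mul (n := n) k (fun j => F (k, j) * (thickness n S k * G (k, j)))
    (u := fun _ => 1) measurable_const
  simp only [mul_one, setLIntegral_const, one_mul] at h
  simp only [dyStep, weightedStep]
  rw [h]
  refine tsum_congr fun j => ?_
  rw [volume_brick]
  ring

/-! ### The pairing -/

/-- The integral of `|f g|` is bounded by the product of the dyadic norms. -/
theorem lintegral_mul_le_dyadic (S : Shape) {p p' q q' : ℝ≥0∞} (hp : p⁻¹ + p'⁻¹ = 1)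
    (hq : q⁻¹ + q'⁻¹ = 1) {f g : ℝ × Eucl n → ℝ} (hf : Measurable f) (hg : Measurable g) :
    ∫⁻ z, ‖f z‖ₑ * ‖g z‖ₑ ∂(halfVol n)
      ≤ eLpNorm (scaleSup (dyStep (brickAvg S q f))) p volume *
        eLpNorm (dyCarleson (weightedStep S (brickAvg S q' g))) p' volume := by
  rw [lintegral_halfVol S]
  calc ∑' R, ∫⁻ z in brick S R, ‖f z‖ₑ * ‖g z‖ₑ
      ≤ ∑' R, volume (brick S R) * brickAvg S q f R * brickAvg S q' g R := by
        refine ENNReal.tsum_le_tsum fun R => ?_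
        refine (lintegral_mul_le_eLpNorm hq hf.enorm hg.enorm).trans_eq ?_
        rw [eLpNorm_enorm, eLpNorm_enorm, eLpNorm_eq_brickAvg, eLpNorm_eq_brickAvg,
          mul_mul_mul_comm, brick_scaling_conj S hq R, mul_assoc]
    _ = ∑' k, ∫⁻ x, dyStep (brickAvg S q f) k x * weightedStep S (brickAvg S q' g) k x :=
        tsum_volume_brick_mul S _ _
    _ ≤ ∫⁻ x, scaleSup (dyStep (brickAvg S q f)) x *
          dyCarleson (weightedStep S (brickAvg S q' g)) x :=
        tsum_lintegral_mul_le (dyConst_dyStep _) fun k => (dyConst_weightedStep S _ k).measurable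
    _ ≤ _ := lintegral_mul_le_eLpNorm hp
        (measurable_scaleSup fun k => (dyConst_dyStep _ k).measurable) (measurable_dyCarleson _)

/-- **Hölder's inequality** for `N_{p,q}` and `C_{p',q'}`. -/
theorem exists_lintegral_mul_le (n : ℕ) (S : Shape) {p p' q q' : ℝ≥0∞} (hp : p⁻¹ + p'⁻¹ = 1)
    (hq : q⁻¹ + q'⁻¹ = 1) : ∃ C : ℝ≥0∞, C ≠ ∞ ∧ ∀ f g : ℝ × Eucl n → ℝ,
      Measurable f → Measurable g → ∫⁻ z, ‖f z‖ₑ * ‖g z‖ₑ ∂(halfVol n)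
        ≤ C * ntENorm S p q f * carlesonENorm S p' q' g := by
  have hp' : p'⁻¹ + p⁻¹ = 1 := by rw [add_comm]; exact hp
  have hq' : q'⁻¹ + q⁻¹ = 1 := by rw [add_comm]; exact hq
  obtain ⟨C₁, hC₁, h₁⟩ := exists_ntENorm_equiv n S (one_le_of_conj hp) (one_le_of_conj hq)
  obtain ⟨C₂, hC₂, h₂⟩ := exists_carlesonENorm_equiv n S (one_le_of_conj hp') (one_le_of_conj hq')
  refine ⟨C₁ * C₂, ENNReal.mul_ne_top hC₁ hC₂, fun f g hf hg => ?_⟩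
  refine (lintegral_mul_le_dyadic S hp hq hf hg).trans
    ((mul_le_mul' (h₁ f hf).2 (h₂ g hg).2).trans_eq ?_)
  ring

/-! ### Norming functions -/

/-- A function on the half space is normed, brick by brick, by a function with prescribed brick
averages. -/
theorem exists_norming_on_bricks (S : Shape) {q q' : ℝ≥0∞} (hq : q⁻¹ + q'⁻¹ = 1)
    {f : ℝ × Eucl n → ℝ} (hf : Measurable f) {G : DyIndex n → ℝ≥0∞} (hG : ∀ R, G R ≠ ∞) :
    ∃ g : ℝ × Eucl n → ℝ, Measurable g ∧ (∀ z, 0 ≤ f z * g z) ∧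
      (∀ R, brickAvg S q' g R ≤ G R) ∧
      ∑' R, volume (brick S R) * brickAvg S q f R * G R
        ≤ 2 * ∫⁻ z, ‖f z‖ₑ * ‖g z‖ₑ ∂(halfVol n) := by
  have hq' : q'⁻¹ + q⁻¹ = 1 := by rw [add_comm]; exact hq
  have hq'0 : q' ≠ 0 := (zero_lt_one.trans_le (one_le_of_conj hq')).ne'
  choose φ hφm hφ1 hφ2 using fun R : DyIndex n =>
    exists_le_lintegral_mul (μ := volume.restrict (brick S R)) hq hf.enorm
  -- rescale the norming function on the brick `R` to brick average at most `G R`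
  set Φ : DyIndex n → ℝ × Eucl n → ℝ≥0∞ := fun R z =>
    G R * volume (brick S R) ^ (q'⁻¹).toReal * φ R z with hΦ
  have hΦm : ∀ R, Measurable (Φ R) := fun R => (hφm R).const_mul _
  have hscale : ∀ R, G R * volume (brick S R) ^ (q'⁻¹).toReal ≠ ∞ := fun R =>
    ENNReal.mul_ne_top (hG R) (ENNReal.rpow_ne_top_of_nonneg ENNReal.toReal_nonneg
      (volume_brick_ne_top S R))
  set h : ℝ × Eucl n → ℝ := fun z => (Φ (brickIdx S z) z).toReal with hh
  have hhm : Measurable h := (measurable_glue S hΦm).ennreal_toReal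
  set s : ℝ × Eucl n → ℝ := fun z => if 0 ≤ f z then 1 else -1 with hs
  have hsm : Measurable s :=
    Measurable.ite (measurableSet_le measurable_const hf) measurable_const measurable_const
  have hsn : ∀ z, ‖s z‖ₑ = 1 := fun z => by
    simp only [hs]
    split_ifs <;> simp
  have hgn : ∀ z, ‖s z * h z‖ₑ = ‖h z‖ₑ := fun z => by rw [enorm_mul, hsn, one_mul]
  have hfin : ∀ R, ∀ᵐ z ∂(volume.restrict (brick S R)), ‖h z‖ₑ = Φ R z := by
    intro R
    filter_upwards [ae_restrict_mem (measurableSet_brick S R),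
      ae_lt_top_of_eLpNorm hq'0 (hφm R) ((hφ1 R).trans_lt ENNReal.one_lt_top)] with z hz hz'
    simp only [hh]
    rw [brickIdx_eq hz, Real.enorm_eq_ofReal ENNReal.toReal_nonneg, ENNReal.ofReal_toReal]
    exact ENNReal.mul_ne_top (hscale R) hz'.ne
  refine ⟨fun z => s z * h z, hsm.mul hhm, fun z => ?_, fun R => ?_, ?_⟩
  · have h0 : 0 ≤ h z := ENNReal.toReal_nonneg
    simp only [hs]
    split_ifs with h1
    · rw [one_mul]
      exact mul_nonneg h1 h0
    · nlinarith
  · have h1 : eLpNorm (fun z => s z * h z) q' (volume.restrict (brick S R))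
        ≤ G R * volume (brick S R) ^ (q'⁻¹).toReal := by
      calc eLpNorm (fun z => s z * h z) q' (volume.restrict (brick S R))
          ≤ eLpNorm (Φ R) q' (volume.restrict (brick S R)) := by
            refine eLpNorm_mono_enorm_ae ?_
            filter_upwards [hfin R] with z hz
            rw [hgn, hz, enorm_eq_self]
        _ ≤ G R * volume (brick S R) ^ (q'⁻¹).toReal *
              eLpNorm (φ R) q' (volume.restrict (brick S R)) :=
            eLpNorm_const_mul_le _ (hscale R) _ _
        _ ≤ _ := mul_le_of_le_one_right' (hφ1 R)
    rw [brickAvg]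
    calc volume (brick S R) ^ (-(q'⁻¹).toReal) *
          eLpNorm (fun z => s z * h z) q' (volume.restrict (brick S R))
        ≤ volume (brick S R) ^ (-(q'⁻¹).toReal) *
            (G R * volume (brick S R) ^ (q'⁻¹).toReal) := by gcongr
      _ = G R * (volume (brick S R) ^ (-(q'⁻¹).toReal) *
            volume (brick S R) ^ (q'⁻¹).toReal) := by ring
      _ = G R := by rw [brick_scaling, mul_one]
  · rw [lintegral_halfVol S, ← ENNReal.tsum_mul_left]
    refine ENNReal.tsum_le_tsum fun R => ?_
    have h1 : ∫⁻ z in brick S R, ‖f z‖ₑ * ‖s z * h z‖ₑ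
        = G R * volume (brick S R) ^ (q'⁻¹).toReal * ∫⁻ z in brick S R, ‖f z‖ₑ * φ R z := by
      rw [← lintegral_const_mul' _ _ (hscale R)]
      refine lintegral_congr_ae ?_
      filter_upwards [hfin R] with z hz
      rw [hgn, hz, hΦ]
      ring
    have h2 := hφ2 R
    rw [eLpNorm_enorm, eLpNorm_eq_brickAvg] at h2
    calc volume (brick S R) * brickAvg S q f R * G R
        = G R * volume (brick S R) ^ (q'⁻¹).toReal *
            (volume (brick S R) ^ (q⁻¹).toReal * brickAvg S q f R) := by
          conv_lhs => rw [← brick_scaling_conj S hq R]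
          ring
      _ ≤ G R * volume (brick S R) ^ (q'⁻¹).toReal *
            (2 * ∫⁻ z in brick S R, ‖f z‖ₑ * φ R z) := by gcongr
      _ = _ := by
          rw [h1]
          ring

/-- Cubes have positive measure, so that a function constant on cubes is finite everywhere if it is
finite almost everywhere. -/
theorem DyConst.lt_top {k : ℤ} {a : Eucl n → ℝ≥0∞} (h : DyConst k a)
    (hae : ∀ᵐ x ∂(volume : Measure (Eucl n)), a x < ∞) (x : Eucl n) : a x < ∞ := by
  by_contra hx
  refine volume_dyCube_ne_zero (n := n) k (dyIdx k x) (measure_mono_null ?_ (ae_iff.1 hae))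
  intro y hy
  rwa [mem_ofPred_eq, h y x hy]

theorem le_dyCarleson {c : ℤ → Eucl n → ℝ≥0∞} (hc : ∀ k, DyConst k (c k)) (k : ℤ) (x : Eucl n) :
    c k x ≤ dyCarleson c x := by
  have h1 : dyAvg k (c k) x = c k x := by
    rw [dyAvg, dyMean, setLIntegral_congr_fun (g := fun _ => c k x) (measurableSet_dyCube _ _)
      fun y hy => hc k y x hy, ← dyMean, dyMean_const]
  rw [← h1]
  refine le_trans (dyAvg_mono k (fun y => ?_) x) (le_iSup (fun i => dyAvg i (lowerSum c i) x) k)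
  refine le_trans ?_ (ENNReal.le_tsum k)
  simp

theorem DyConst.eq_dyStep {F : ℤ → Eucl n → ℝ≥0∞} (hF : ∀ k, DyConst k (F k)) :
    dyStep (fun R => F R.1 (dyCorner R.1 R.2)) = F := by
  funext k
  exact (hF k).eq_comp.symm

theorem DyConst.eq_weightedStep (S : Shape) {c : ℤ → Eucl n → ℝ≥0∞} (hc : ∀ k, DyConst k (c k)) :
    weightedStep S (fun R => (thickness n S R.1)⁻¹ * c R.1 (dyCorner R.1 R.2)) = c := by
  funext k x
  simp only [weightedStep, dyStep]
  rw [← mul_assoc, ENNReal.mul_inv_cancel (thickness_ne_zero S k) (thickness_ne_top S k), one_mul]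
  exact (congrFun (hc k).eq_comp x).symm

theorem exists_lt_of_lt_mul {C A T : ℝ≥0∞} (hC : C ≠ ∞) (hT : T < C * A) :
    ∃ T' < A, T ≤ C * T' := by
  by_contra! hcon
  refine absurd hT (not_lt.2 (le_of_forall_lt fun u hu => ?_))
  rcases eq_or_ne C 0 with rfl | h0
  · simp at hu
  have : u / C < A := by rwa [ENNReal.div_lt_iff (Or.inl h0) (Or.inl hC), mul_comm]
  have h2 := hcon _ this
  rwa [ENNReal.mul_div_cancel h0 hC] at h2

/-- Below its norm in `N_{p,q}`, a function is normed by a function in `C_{p',q'}`. -/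
theorem exists_norming_of_lt_ntENorm (n : ℕ) (S : Shape) {p p' q q' : ℝ≥0∞}
    (hp : p⁻¹ + p'⁻¹ = 1) (hq : q⁻¹ + q'⁻¹ = 1) (hpt : p ≠ ∞) : ∃ C : ℝ≥0∞, C ≠ ∞ ∧
      ∀ f : ℝ × Eucl n → ℝ, Measurable f → ∀ T < ntENorm S p q f, ∃ g : ℝ × Eucl n → ℝ,
        Measurable g ∧ (∀ z, 0 ≤ f z * g z) ∧ carlesonENorm S p' q' g ≤ C ∧
          T ≤ C * ∫⁻ z, ‖f z‖ₑ * ‖g z‖ₑ ∂(halfVol n) := by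
  have hp' : p'⁻¹ + p⁻¹ = 1 := by rw [add_comm]; exact hp
  have hq' : q'⁻¹ + q⁻¹ = 1 := by rw [add_comm]; exact hq
  have hp'0 : p' ≠ 0 := (zero_lt_one.trans_le (one_le_of_conj hp')).ne'
  obtain ⟨C₁, hC₁, h₁⟩ := exists_ntENorm_equiv n S (one_le_of_conj hp) (one_le_of_conj hq)
  obtain ⟨C₂, hC₂, h₂⟩ := exists_carlesonENorm_equiv n S (one_le_of_conj hp') (one_le_of_conj hq')
  obtain ⟨C₃, hC₃, h₃⟩ := exists_norming_scaleSup (n := n) hp hpt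
  refine ⟨max (C₂ * C₃) (C₁ * 4), by simp [ENNReal.mul_eq_top, hC₁, hC₂, hC₃],
    fun f hf T hT => ?_⟩
  have hT' : T < C₁ * eLpNorm (scaleSup (dyStep (brickAvg S q f))) p volume :=
    hT.trans_le (h₁ f hf).1
  obtain ⟨T', hT'1, hT'2⟩ := exists_lt_of_lt_mul hC₁ hT'
  obtain ⟨c, hc, hcC, hcT⟩ := h₃ _ (dyConst_dyStep _) T' hT'1
  have hcfin : ∀ k x, c k x < ∞ := fun k => (hc k).lt_top <| by
    filter_upwards [ae_lt_top_of_eLpNorm hp'0 (measurable_dyCarleson c)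
      (hcC.trans_lt hC₃.lt_top)] with x hx
    exact (le_dyCarleson hc k x).trans_lt hx
  obtain ⟨g, hg, hfg, hgG, hgT⟩ := exists_norming_on_bricks S hq hf
    (G := fun R => (thickness n S R.1)⁻¹ * c R.1 (dyCorner R.1 R.2)) fun R =>
      ENNReal.mul_ne_top (ENNReal.inv_ne_top.2 (thickness_ne_zero S _)) (hcfin _ _).ne
  refine ⟨g, hg, hfg, ?_, ?_⟩
  · refine ((h₂ g hg).1.trans ?_).trans (le_max_left _ _)
    gcongr
    refine le_trans (eLpNorm_mono_ennreal (dyCarleson_mono fun k x => ?_)) hcC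
    rw [← congrFun (congrFun (DyConst.eq_weightedStep S hc) k) x]
    exact mul_le_mul_right (hgG _) _
  · refine le_trans ?_ (mul_le_mul_left (le_max_right _ _) _)
    rw [tsum_volume_brick_mul, DyConst.eq_weightedStep S hc] at hgT
    calc T ≤ C₁ * T' := hT'2
      _ ≤ C₁ * (2 * (2 * ∫⁻ z, ‖f z‖ₑ * ‖g z‖ₑ ∂(halfVol n))) := by
          gcongr
          exact hcT.trans (by gcongr)
      _ = _ := by ring

/-- Below its norm in `C_{p',q'}`, a function is normed by a function in `N_{p,q}`. -/
theorem exists_norming_of_lt_carlesonENorm (n : ℕ) (S : Shape) {p p' q q' : ℝ≥0∞}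
    (hp : p⁻¹ + p'⁻¹ = 1) (hq : q⁻¹ + q'⁻¹ = 1) (hpt : p ≠ ∞) : ∃ C : ℝ≥0∞, C ≠ ∞ ∧
      ∀ g : ℝ × Eucl n → ℝ, Measurable g → ∀ T < carlesonENorm S p' q' g,
        ∃ f : ℝ × Eucl n → ℝ, Measurable f ∧ (∀ z, 0 ≤ f z * g z) ∧ ntENorm S p q f ≤ C ∧
          T ≤ C * ∫⁻ z, ‖f z‖ₑ * ‖g z‖ₑ ∂(halfVol n) := by
  have hp' : p'⁻¹ + p⁻¹ = 1 := by rw [add_comm]; exact hp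
  have hq' : q'⁻¹ + q⁻¹ = 1 := by rw [add_comm]; exact hq
  have hp0 : p ≠ 0 := (zero_lt_one.trans_le (one_le_of_conj hp)).ne'
  obtain ⟨C₁, hC₁, h₁⟩ := exists_ntENorm_equiv n S (one_le_of_conj hp) (one_le_of_conj hq)
  obtain ⟨C₂, hC₂, h₂⟩ := exists_carlesonENorm_equiv n S (one_le_of_conj hp') (one_le_of_conj hq')
  obtain ⟨C₃, hC₃, h₃⟩ := exists_norming_dyCarleson (n := n) hp hpt
  refine ⟨max (C₁ * C₃) (C₂ * 4), by simp [ENNReal.mul_eq_top, hC₁, hC₂, hC₃],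
    fun g hg T hT => ?_⟩
  obtain ⟨T', hT'1, hT'2⟩ := exists_lt_of_lt_mul hC₂ (hT.trans_le (h₂ g hg).1)
  obtain ⟨F, hF, hFC, hFT⟩ := h₃ _ (fun k => (dyConst_weightedStep S _ k).measurable) T' hT'1
  have hFfin : ∀ k x, F k x < ∞ := fun k => (hF k).lt_top <| by
    filter_upwards [ae_lt_top_of_eLpNorm hp0 (measurable_scaleSup fun k => (hF k).measurable)
      (hFC.trans_lt hC₃.lt_top)] with x hx
    exact (le_iSup (fun k => F k x) k).trans_lt hx
  obtain ⟨f, hf, hgf, hfF, hfT⟩ := exists_norming_on_bricks S hq' hg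
    (G := fun R => F R.1 (dyCorner R.1 R.2)) fun R => (hFfin _ _).ne
  refine ⟨f, hf, fun z => by rw [mul_comm]; exact hgf z, ?_, ?_⟩
  · refine ((h₁ f hf).1.trans ?_).trans (le_max_left _ _)
    gcongr
    refine le_trans (eLpNorm_mono_ennreal fun x => iSup_mono fun k => ?_) hFC
    rw [← congrFun (congrFun (DyConst.eq_dyStep hF) k) x]
    exact hfF _
  · refine le_trans ?_ (mul_le_mul_left (le_max_right _ _) _)
    simp_rw [mul_right_comm _ (brickAvg S q' g _)] at hfT
    rw [tsum_volume_brick_mul, DyConst.eq_dyStep hF] at hfT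
    calc T ≤ C₂ * T' := hT'2
      _ ≤ C₂ * (2 * (2 * ∫⁻ z, ‖g z‖ₑ * ‖f z‖ₑ ∂(halfVol n))) := by
          gcongr
          exact hFT.trans (by gcongr)
      _ = _ := by
          simp_rw [mul_comm ‖g _‖ₑ]
          ring

end Pairing

/-! ### The spaces and their pairing -/

section Spaces

variable {n : ℕ}

theorem ntENorm_congr (S : Shape) (p q : ℝ≥0∞) {f g : ℝ × Eucl n → ℝ} (h : f =ᵐ[halfVol n] g) :
    ntENorm S p q f = ntENorm S p q g := by
  rw [ntENorm, whitneyAvg_congr S q h, ntENorm]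

theorem carlesonENorm_congr (S : Shape) (p q : ℝ≥0∞) {f g : ℝ × Eucl n → ℝ}
    (h : f =ᵐ[halfVol n] g) : carlesonENorm S p q f = carlesonENorm S p q g := by
  rw [carlesonENorm, whitneyAvg_congr S q h, carlesonENorm]

variable (S : Shape) {p p' q q' : ℝ≥0∞} [Fact (1 ≤ p)] [Fact (1 ≤ p')] [Fact (1 ≤ q)]
  [Fact (1 ≤ q')]

/-- The element of `N_{p,q}` represented by a function. -/
noncomputable def NSpace.of (f : ℝ × Eucl n → ℝ) (hf : Measurable f) (h : ntENorm S p q f < ∞) :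
    NSpace n S p q :=
  ⟨AEEqFun.mk f hf.aestronglyMeasurable, by
    change ntENorm S p q _ < ∞
    rwa [ntENorm_congr S p q (AEEqFun.coeFn_mk f _)]⟩

/-- The element of `C_{p,q}` represented by a function. -/
noncomputable def CSpace.of (g : ℝ × Eucl n → ℝ) (hg : Measurable g)
    (h : carlesonENorm S p q g < ∞) : CSpace n S p q :=
  ⟨AEEqFun.mk g hg.aestronglyMeasurable, by
    change carlesonENorm S p q _ < ∞
    rwa [carlesonENorm_congr S p q (AEEqFun.coeFn_mk g _)]⟩

variable {S}

theorem NSpace.coe_of {f : ℝ × Eucl n → ℝ} (hf : Measurable f) (h : ntENorm S p q f < ∞) :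
    (NSpace.of S f hf h).1 =ᵐ[halfVol n] f := AEEqFun.coeFn_mk f _

theorem CSpace.coe_of {g : ℝ × Eucl n → ℝ} (hg : Measurable g) (h : carlesonENorm S p q g < ∞) :
    (CSpace.of S g hg h).1 =ᵐ[halfVol n] g := AEEqFun.coeFn_mk g _

theorem NSpace.norm_of {f : ℝ × Eucl n → ℝ} (hf : Measurable f) (h : ntENorm S p q f < ∞) :
    ‖NSpace.of S f hf h‖ = (ntENorm S p q f).toReal := by
  rw [ExtNorm.norm_def, ← ntENorm_congr S p q (NSpace.coe_of hf h)]
  rfl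

theorem CSpace.norm_of {g : ℝ × Eucl n → ℝ} (hg : Measurable g)
    (h : carlesonENorm S p q g < ∞) :
    ‖CSpace.of S g hg h‖ = (carlesonENorm S p q g).toReal := by
  rw [ExtNorm.norm_def, ← carlesonENorm_congr S p q (CSpace.coe_of hg h)]
  rfl

theorem NSpace.measurable (f : NSpace n S p q) : Measurable f.1 := f.1.measurable

theorem CSpace.measurable (g : CSpace n S p q) : Measurable g.1 := g.1.measurable

theorem NSpace.ntENorm_eq (f : NSpace n S p q) : ntENorm S p q f.1 = ENNReal.ofReal ‖f‖ :=
  (ENNReal.ofReal_toReal (ne_of_lt f.2)).symm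

theorem CSpace.carlesonENorm_eq (g : CSpace n S p q) :
    carlesonENorm S p q g.1 = ENNReal.ofReal ‖g‖ :=
  (ENNReal.ofReal_toReal (ne_of_lt g.2)).symm

/-- The pairing `∬ f g` as a bounded bilinear form. -/
theorem exists_pairing (n : ℕ) (S : Shape) (p p' q q' : ℝ≥0∞) [Fact (1 ≤ p)] [Fact (1 ≤ p')]
    [Fact (1 ≤ q)] [Fact (1 ≤ q')] (hp : p⁻¹ + p'⁻¹ = 1) (hq : q⁻¹ + q'⁻¹ = 1) :
    ∃ L : CSpace n S p' q' →L[ℝ] StrongDual ℝ (NSpace n S p q),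
      ∀ (f : NSpace n S p q) (g : CSpace n S p' q'),
        Integrable (fun z => f.1 z * g.1 z) (halfVol n) ∧
          L g f = ∫ z, f.1 z * g.1 z ∂(halfVol n) := by
  obtain ⟨C, hC, h⟩ := exists_lintegral_mul_le n S hp hq
  have hbd : ∀ (f : NSpace n S p q) (g : CSpace n S p' q'),
      ∫⁻ z, ‖f.1 z * g.1 z‖ₑ ∂(halfVol n) ≤ ENNReal.ofReal (C.toReal * ‖g‖ * ‖f‖) := by
    intro f g
    simp only [enorm_mul]
    refine (h f.1 g.1 f.measurable g.measurable).trans_eq ?_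
    rw [f.ntENorm_eq, g.carlesonENorm_eq, ENNReal.ofReal_mul (by positivity),
      ENNReal.ofReal_mul ENNReal.toReal_nonneg, ENNReal.ofReal_toReal hC]
    ring
  have hint : ∀ (f : NSpace n S p q) (g : CSpace n S p' q'),
      Integrable (fun z => f.1 z * g.1 z) (halfVol n) := fun f g =>
    ⟨(f.measurable.mul g.measurable).aestronglyMeasurable,
      (hbd f g).trans_lt ENNReal.ofReal_lt_top⟩
  refine ⟨(LinearMap.mk₂ ℝ (fun (g : CSpace n S p' q') (f : NSpace n S p q) =>
    ∫ z, f.1 z * g.1 z ∂(halfVol n)) ?_ ?_ ?_ ?_).mkContinuous₂ C.toReal ?_,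
    fun f g => ⟨hint f g, rfl⟩⟩
  · intro g₁ g₂ f
    rw [← integral_add (hint f g₁) (hint f g₂)]
    refine integral_congr_ae ?_
    filter_upwards [AEEqFun.coeFn_add g₁.1 g₂.1] with z hz
    rw [Submodule.coe_add, hz, Pi.add_apply, mul_add]
  · intro r g f
    rw [smul_eq_mul, ← integral_const_mul]
    refine integral_congr_ae ?_
    filter_upwards [AEEqFun.coeFn_smul r g.1] with z hz
    rw [Submodule.coe_smul, hz, Pi.smul_apply, smul_eq_mul]
    ring
  · intro g f₁ f₂
    rw [← integral_add (hint f₁ g) (hint f₂ g)]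
    refine integral_congr_ae ?_
    filter_upwards [AEEqFun.coeFn_add f₁.1 f₂.1] with z hz
    rw [Submodule.coe_add, hz, Pi.add_apply, add_mul]
  · intro r g f
    rw [smul_eq_mul, ← integral_const_mul]
    refine integral_congr_ae ?_
    filter_upwards [AEEqFun.coeFn_smul r f.1] with z hz
    rw [Submodule.coe_smul, hz, Pi.smul_apply, smul_eq_mul]
    ring
  · intro g f
    rw [LinearMap.mk₂_apply]
    exact (ENNReal.ofReal_le_ofReal_iff (by positivity)).1
      (by
        rw [← Real.enorm_eq_ofReal (norm_nonneg _), enorm_norm]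
        exact (enorm_integral_le_lintegral_enorm _).trans (hbd f g))

/-- For a pair with nonnegative product, the absolute integral is the pairing. -/
theorem lintegral_mul_eq_pairing {f g f' g' : ℝ × Eucl n → ℝ} (hf : f' =ᵐ[halfVol n] f)
    (hg : g' =ᵐ[halfVol n] g) (h0 : ∀ z, 0 ≤ f z * g z)
    (hint : Integrable (fun z => f' z * g' z) (halfVol n)) :
    ∫⁻ z, ‖f z‖ₑ * ‖g z‖ₑ ∂(halfVol n)
      = ENNReal.ofReal (∫ z, f' z * g' z ∂(halfVol n)) := by
  have h1 : (fun z => f' z * g' z) =ᵐ[halfVol n] fun z => f z * g z := by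
    filter_upwards [hf, hg] with z h1 h2
    rw [h1, h2]
  rw [integral_congr_ae h1, ofReal_integral_eq_lintegral_ofReal (hint.congr h1) (ae_of_all _ h0)]
  refine lintegral_congr fun z => ?_
  rw [← enorm_mul, Real.enorm_eq_ofReal (h0 z)]

/-- The pairing is bounded below on `C_{p',q'}`. -/
theorem antilipschitz_pairing (hp : p⁻¹ + p'⁻¹ = 1) (hq : q⁻¹ + q'⁻¹ = 1) (hpt : p ≠ ∞)
    {L : CSpace n S p' q' →L[ℝ] StrongDual ℝ (NSpace n S p q)}
    (hL : ∀ (f : NSpace n S p q) (g : CSpace n S p' q'),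
        Integrable (fun z => f.1 z * g.1 z) (halfVol n) ∧
          L g f = ∫ z, f.1 z * g.1 z ∂(halfVol n)) : ∃ K : ℝ≥0, AntilipschitzWith K L := by
  obtain ⟨C, hC, h⟩ := exists_norming_of_lt_carlesonENorm n S hp hq hpt
  refine ⟨(C * C).toNNReal, AddMonoidHomClass.antilipschitz_of_bound L fun g => ?_⟩
  have hle : carlesonENorm S p' q' g.1 ≤ ENNReal.ofReal ((C * C).toNNReal * ‖L g‖) := by
    refine le_of_forall_lt fun T hT => ?_
    obtain ⟨T', hTT', hT'⟩ := exists_between hT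
    refine hTT'.trans_le ?_
    obtain ⟨f, hf, hfg, hfC, hfT⟩ := h g.1 g.measurable T' hT'
    set F := NSpace.of S f hf (hfC.trans_lt hC.lt_top) with hF
    rw [lintegral_mul_eq_pairing (NSpace.coe_of hf (hfC.trans_lt hC.lt_top)) EventuallyEq.rfl hfg
      (hL F g).1, ← (hL F g).2] at hfT
    calc T' ≤ C * ENNReal.ofReal (L g F) := hfT
      _ ≤ C * ENNReal.ofReal (‖L g‖ * ‖F‖) := by
          gcongr
          exact (le_abs_self _).trans ((L g).le_opNorm F)
      _ = C * (ENNReal.ofReal ‖L g‖ * ntENorm S p q f) := by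
          rw [ENNReal.ofReal_mul (norm_nonneg _), hF, NSpace.norm_of,
            ENNReal.ofReal_toReal (hfC.trans_lt hC.lt_top).ne]
      _ ≤ C * (ENNReal.ofReal ‖L g‖ * C) := by gcongr
      _ = _ := by
          rw [ENNReal.ofReal_mul (NNReal.coe_nonneg _), ENNReal.ofReal_coe_nnreal,
            ENNReal.coe_toNNReal (ENNReal.mul_ne_top hC hC)]
          ring
  rw [g.carlesonENorm_eq] at hle
  exact (ENNReal.ofReal_le_ofReal_iff (by positivity)).1 hle

/-- The pairing is bounded below on `N_{p,q}`. -/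
theorem antilipschitz_pairing_flip (hp : p⁻¹ + p'⁻¹ = 1) (hq : q⁻¹ + q'⁻¹ = 1) (hpt : p ≠ ∞)
    {L' : NSpace n S p q →L[ℝ] StrongDual ℝ (CSpace n S p' q')}
    (hL' : ∀ (f : NSpace n S p q) (g : CSpace n S p' q'),
        Integrable (fun z => f.1 z * g.1 z) (halfVol n) ∧
          L' f g = ∫ z, f.1 z * g.1 z ∂(halfVol n)) : ∃ K : ℝ≥0, AntilipschitzWith K L' := by
  obtain ⟨C, hC, h⟩ := exists_norming_of_lt_ntENorm n S hp hq hpt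
  refine ⟨(C * C).toNNReal, AddMonoidHomClass.antilipschitz_of_bound L' fun f => ?_⟩
  have hle : ntENorm S p q f.1 ≤ ENNReal.ofReal ((C * C).toNNReal * ‖L' f‖) := by
    refine le_of_forall_lt fun T hT => ?_
    obtain ⟨T', hTT', hT'⟩ := exists_between hT
    refine hTT'.trans_le ?_
    obtain ⟨g, hg, hfg, hgC, hgT⟩ := h f.1 f.measurable T' hT'
    set G := CSpace.of S g hg (hgC.trans_lt hC.lt_top) with hG
    rw [lintegral_mul_eq_pairing EventuallyEq.rfl (CSpace.coe_of hg (hgC.trans_lt hC.lt_top)) hfg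
      (hL' f G).1, ← (hL' f G).2] at hgT
    calc T' ≤ C * ENNReal.ofReal (L' f G) := hgT
      _ ≤ C * ENNReal.ofReal (‖L' f‖ * ‖G‖) := by
          gcongr
          exact (le_abs_self _).trans ((L' f).le_opNorm G)
      _ = C * (ENNReal.ofReal ‖L' f‖ * carlesonENorm S p' q' g) := by
          rw [ENNReal.ofReal_mul (norm_nonneg _), hG, CSpace.norm_of,
            ENNReal.ofReal_toReal (hgC.trans_lt hC.lt_top).ne]
      _ ≤ C * (ENNReal.ofReal ‖L' f‖ * C) := by gcongr
      _ = _ := by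
          rw [ENNReal.ofReal_mul (NNReal.coe_nonneg _), ENNReal.ofReal_coe_nnreal,
            ENNReal.coe_toNNReal (ENNReal.mul_ne_top hC hC)]
          ring
  rw [f.ntENorm_eq] at hle
  exact (ENNReal.ofReal_le_ofReal_iff (by positivity)).1 hle

end Spaces

/-! ### Functionals which escape to infinity -/

/-- A map into a dual space is not surjective if a bounded sequence `L (y m)` has a weak-star
cluster point which takes the value `1` on a sequence converging to zero against the range. -/
theorem not_surjective_of_escaping {E F : Type*} [NormedAddCommGroup E] [NormedSpace ℝ E]
    [NormedAddCommGroup F] [NormedSpace ℝ F] (L : F →L[ℝ] StrongDual ℝ E) {x : ℕ → E} {y : ℕ → F}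
    {K : ℝ} (hy : ∀ m, ‖y m‖ ≤ K) (h1 : ∀ M m, M ≤ m → L (y m) (x M) = 1)
    (h0 : ∀ v, Tendsto (fun M => L v (x M)) atTop (𝓝 0)) : ¬ Function.Surjective L := by
  intro hsurj
  have hcomp := WeakDual.isCompact_closedBall (𝕜 := ℝ) (E := E) (0 : StrongDual ℝ E) (‖L‖ * K)
  obtain ⟨ξ, -, hξ⟩ := hcomp.exists_mapClusterPt (f := atTop)
    (u := fun m => StrongDual.toWeakDual (L (y m))) (by
      refine tendsto_principal.2 (Eventually.of_forall fun m => ?_)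
      simp only [mem_preimage, Metric.mem_closedBall, dist_zero_right]
      exact (L.le_opNorm _).trans (by gcongr; exact hy m))
  obtain ⟨v, hv⟩ := hsurj (WeakDual.toStrongDual ξ)
  have hval : ∀ M, L v (x M) = 1 := by
    intro M
    have hc : ContinuousAt (fun η : WeakDual ℝ E => η (x M)) ξ :=
      (WeakDual.eval_continuous (x M)).continuousAt
    have h2 := hξ.continuousAt_comp hc
    rw [hv]
    by_contra hne
    obtain ⟨m, hm, hMm⟩ := ((h2.frequently (p := fun r => r ≠ 1)
      (isOpen_ne.mem_nhds hne)).and_eventually (eventually_ge_atTop M)).exists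
    exact hm (h1 M m hMm)
  have := h0 v
  simp only [hval] at this
  exact one_ne_zero (tendsto_nhds_unique tendsto_const_nhds this)

/-! ### The ranges are proper subspaces -/

section Proper

variable {n : ℕ}

theorem integral_comp_brickIdx (S : Shape) {H G : DyIndex n → ℝ} (hH : ∀ R, 0 ≤ H R)
    (hG : ∀ R, 0 ≤ G R) : ∫ z, H (brickIdx S z) * G (brickIdx S z) ∂(halfVol n)
      = (∑' R, volume (brick S R) * ENNReal.ofReal (H R) * ENNReal.ofReal (G R)).toReal := by
  rw [integral_eq_lintegral_of_nonneg_ae (ae_of_all _ fun z => mul_nonneg (hH _) (hG _))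
    (measurable_comp_brickIdx S fun R => H R * G R).aestronglyMeasurable, lintegral_halfVol S]
  congr 1
  refine tsum_congr fun R => ?_
  have h : ∫⁻ z in brick S R, ENNReal.ofReal (H (brickIdx S z) * G (brickIdx S z))
      = ∫⁻ _z in brick S R, ENNReal.ofReal (H R * G R) :=
    setLIntegral_congr_fun (measurableSet_brick S R) fun z hz => by simp only [brickIdx_eq hz]
  rw [h, setLIntegral_const, ENNReal.ofReal_mul (hH R)]
  ring

theorem ofReal_thickness_inv (S : Shape) (k : ℤ) :
    thickness n S k * ENNReal.ofReal (aspect n S * 2 ^ k)⁻¹ = 1 := by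
  have hA := aspect_pos n S
  rw [thickness, ← ENNReal.ofReal_mul (by positivity), mul_inv_cancel₀ (by positivity),
    ENNReal.ofReal_one]

/-- The indicator function of the dyadic cube of sidelength `2 ^ k` at the origin. -/
noncomputable def cubeInd (n : ℕ) (k : ℤ) : Eucl n → ℝ≥0∞ := (dyCube k 0).indicator fun _ => 1

theorem measurable_cubeInd (k : ℤ) : Measurable (cubeInd n k) :=
  measurable_const.indicator (measurableSet_dyCube k 0)

theorem lintegral_cubeInd (k : ℤ) : ∫⁻ x, cubeInd n k x = ENNReal.ofReal (2 ^ k) ^ n := by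
  rw [cubeInd, lintegral_indicator (measurableSet_dyCube k 0), setLIntegral_const, one_mul,
    volume_dyCube]

theorem eLpNorm_cubeInd_le (p : ℝ≥0∞) : eLpNorm (cubeInd n 0) p volume ≤ 1 := by
  refine (eLpNorm_indicator_const_le (1 : ℝ≥0∞) p).trans ?_
  rw [volume_dyCube]
  simp

theorem dyIdx_zero_corner {k : ℤ} (hk : k ≤ 0) (x : Eucl n) :
    dyIdx 0 (dyCorner k (dyIdx k x)) = dyIdx 0 x := dyIdx_eq_of_le hk (dyIdx_corner k _)

open Classical in
/-- The indicator function of the union of the bricks of scales at most `2 ^ (-M)` over the unit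
cube, as a function of the brick. -/
noncomputable def lowStep (n : ℕ) (M : ℕ) (R : DyIndex n) : ℝ :=
  if R.1 ≤ -M ∧ dyIdx 0 (dyCorner R.1 R.2) = 0 then 1 else 0

open Classical in
/-- The function of integral one which is constant on the layer of scale `2 ^ (-m)` over the unit
cube, as a function of the brick. -/
noncomputable def layer (S : Shape) (m : ℕ) (R : DyIndex n) : ℝ :=
  if R.1 = -m ∧ dyIdx 0 (dyCorner R.1 R.2) = 0 then (aspect n S * 2 ^ R.1)⁻¹ else 0

theorem lowStep_nonneg (M : ℕ) (R : DyIndex n) : 0 ≤ lowStep n M R := by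
  unfold lowStep
  split_ifs <;> simp

theorem layer_nonneg (S : Shape) (m : ℕ) (R : DyIndex n) : 0 ≤ layer S m R := by
  have hA := aspect_pos n S
  unfold layer
  split_ifs <;> positivity

theorem dyStep_lowStep_le (M : ℕ) (k : ℤ) (x : Eucl n) :
    dyStep (fun R => ENNReal.ofReal (lowStep n M R)) k x ≤ cubeInd n 0 x := by
  simp only [dyStep, lowStep]
  split_ifs with h
  · rw [dyIdx_zero_corner (by omega)] at h
    rw [cubeInd, indicator_of_mem (show x ∈ dyCube 0 0 from h.2)]
    simp
  · simp

theorem weightedStep_layer (S : Shape) (m : ℕ) (k : ℤ) (x : Eucl n) :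
    weightedStep S (fun R => ENNReal.ofReal (layer S m R)) k x
      = if k = -m then cubeInd n 0 x else 0 := by
  simp only [weightedStep, dyStep, layer]
  by_cases hk : k = -m
  · rw [if_pos hk, dyIdx_zero_corner (by omega)]
    by_cases hx : dyIdx 0 x = 0
    · rw [if_pos ⟨hk, hx⟩, ofReal_thickness_inv, cubeInd,
        indicator_of_mem (show x ∈ dyCube 0 0 from hx)]
    · rw [if_neg fun h => hx h.2, cubeInd, indicator_of_notMem (show x ∉ dyCube 0 0 from hx)]
      simp
  · rw [if_neg fun h => hk h.1, if_neg hk]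
    simp

theorem enorm_brickAvg_of_nonneg (S : Shape) {q : ℝ≥0∞} (hq : 1 ≤ q) {H : DyIndex n → ℝ}
    (hH : ∀ R, 0 ≤ H R) : brickAvg S q (fun z => H (brickIdx S z))
      = fun R => ENNReal.ofReal (H R) := by
  funext R
  rw [brickAvg_comp_brickIdx S hq, Real.enorm_eq_ofReal (hH R)]

theorem exists_ntENorm_lowStep_le (n : ℕ) (S : Shape) {p q : ℝ≥0∞} (hp : 1 ≤ p) (hq : 1 ≤ q) :
    ∃ C : ℝ≥0∞, C ≠ ∞ ∧ ∀ M, ntENorm S p q (fun z => lowStep n M (brickIdx S z)) ≤ C := by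
  obtain ⟨C, hC, h⟩ := exists_ntENorm_equiv n S hp hq
  refine ⟨C, hC, fun M => (h _ (measurable_comp_brickIdx S _)).1.trans ?_⟩
  rw [enorm_brickAvg_of_nonneg S hq (lowStep_nonneg M)]
  exact mul_le_of_le_one_right' ((eLpNorm_mono_ennreal fun x =>
    iSup_le fun k => dyStep_lowStep_le M k x).trans (eLpNorm_cubeInd_le p))

/-- The dyadic Carleson functional of a layer is at most the dyadic maximal function of the indicator
function of the unit cube. -/
theorem exists_carlesonENorm_layer_le (n : ℕ) (S : Shape) {p p' q : ℝ≥0∞} (h : p⁻¹ + p'⁻¹ = 1)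
    (hp : 1 < p) (hq : 1 ≤ q) : ∃ C : ℝ≥0∞, C ≠ ∞ ∧
      ∀ m, carlesonENorm S p q (fun z => layer S m (brickIdx (n := n) S z)) ≤ C := by
  obtain ⟨C, hC, hc⟩ := exists_carlesonENorm_equiv n S hp.le hq
  obtain ⟨C', hC', hM⟩ := exists_eLpNorm_dyMax_le (n := n) h hp
  refine ⟨C * C', ENNReal.mul_ne_top hC hC', fun m =>
    (hc _ (measurable_comp_brickIdx S _)).1.trans ?_⟩
  rw [enorm_brickAvg_of_nonneg S hq (layer_nonneg S m)]
  gcongr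
  refine le_trans (eLpNorm_mono_ennreal fun x => iSup_mono fun i => dyAvg_mono i (fun y => ?_) x)
    ((hM _ (measurable_cubeInd 0)).trans (mul_le_of_le_one_right' (eLpNorm_cubeInd_le p)))
  simp only [lowerSum, weightedStep_layer]
  rw [tsum_eq_single (-m : ℤ) fun k hk => by simp [hk]]
  split_ifs <;> simp

theorem integral_lowStep_mul_layer (S : Shape) {M m : ℕ} (h : M ≤ m) :
    ∫ z, lowStep n M (brickIdx S z) * layer S m (brickIdx S z) ∂(halfVol n) = 1 := by
  rw [integral_comp_brickIdx S (lowStep_nonneg M) (layer_nonneg S m), tsum_volume_brick_mul,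
    tsum_eq_single (-m : ℤ) fun k hk => by simp [weightedStep_layer, hk]]
  have : ∀ x : Eucl n, dyStep (fun R => ENNReal.ofReal (lowStep n M R)) (-m) x *
      weightedStep S (fun R => ENNReal.ofReal (layer S m R)) (-m) x = cubeInd n 0 x := by
    intro x
    rw [weightedStep_layer, if_pos rfl]
    by_cases hx : dyIdx 0 x = 0
    · simp only [dyStep, lowStep]
      rw [dyIdx_zero_corner (by omega), if_pos ⟨by omega, hx⟩, ENNReal.ofReal_one, one_mul]
    · rw [cubeInd, indicator_of_notMem (show x ∉ dyCube 0 0 from hx), mul_zero]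
  simp_rw [this, lintegral_cubeInd]
  simp

theorem lowStep_eq_zero {M : ℕ} {R : DyIndex n} (h : -R.1 < M) : lowStep n M R = 0 :=
  if_neg fun h' => by omega

theorem lowStep_le (M : ℕ) (R : DyIndex n) : lowStep n M R ≤ lowStep n 0 R := by
  unfold lowStep
  split_ifs with h1 h2 h2
  · rfl
  · exact absurd ⟨by push_cast; omega, h1.2⟩ h2
  · simp
  · rfl

/-- Integrals of a fixed function against functions of the brick which vanish above a scale tending
to zero. -/
theorem tendsto_integral_low (S : Shape) {g : ℝ × Eucl n → ℝ} (hg : Measurable g)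
    {H : ℕ → DyIndex n → ℝ} (hH0 : ∀ M R, 0 ≤ H M R) (hHle : ∀ M R, H M R ≤ H 0 R)
    (hH : ∀ (M : ℕ) R, -R.1 < (M : ℤ) → H M R = 0)
    (hint : Integrable (fun z => H 0 (brickIdx S z) * g z) (halfVol n)) :
    Tendsto (fun M => ∫ z, H M (brickIdx S z) * g z ∂(halfVol n)) atTop (𝓝 0) := by
  have h := tendsto_integral_of_dominated_convergence (μ := halfVol n)
    (F := fun M z => H M (brickIdx S z) * g z) (f := fun _ => 0)
    (fun z => ‖H 0 (brickIdx S z) * g z‖)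
    (fun M => ((measurable_comp_brickIdx S (H M)).mul hg).aestronglyMeasurable) hint.norm
    (fun M => ae_of_all _ fun z => ?_) (ae_of_all _ fun z => ?_)
  · simpa using h
  · rw [norm_mul, norm_mul, Real.norm_of_nonneg (hH0 _ _), Real.norm_of_nonneg (hH0 _ _)]
    gcongr
    exact hHle M _
  · refine tendsto_const_nhds.congr' ?_
    filter_upwards [eventually_gt_atTop (-(brickIdx S z).1).toNat] with M hM
    rw [hH M _ (by omega), zero_mul]

/-- Not every functional on `N_{p,q}` is given by a function in `C_{p',q'}`: the layers over the unit
cube escape to the boundary, but keep the integral one against every `lowStep n M`. -/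
theorem not_surjective_pairing {S : Shape} {p p' q q' : ℝ≥0∞} [Fact (1 ≤ p)] [Fact (1 ≤ p')]
    [Fact (1 ≤ q)] [Fact (1 ≤ q')] (hp : p⁻¹ + p'⁻¹ = 1) (hpt : p ≠ ∞)
    {L : CSpace n S p' q' →L[ℝ] StrongDual ℝ (NSpace n S p q)}
    (hL : ∀ (f : NSpace n S p q) (g : CSpace n S p' q'),
        Integrable (fun z => f.1 z * g.1 z) (halfVol n) ∧
          L g f = ∫ z, f.1 z * g.1 z ∂(halfVol n)) : ¬ Function.Surjective L := by
  have hp' : p'⁻¹ + p⁻¹ = 1 := by rw [add_comm]; exact hp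
  obtain ⟨C₁, hC₁, h₁⟩ := exists_ntENorm_lowStep_le n S (p := p) (q := q) Fact.out Fact.out
  obtain ⟨C₂, hC₂, h₂⟩ := exists_carlesonENorm_layer_le n S (q := q') hp' (conj_gt_one hp hpt)
    Fact.out
  have hx : ∀ M, ntENorm S p q (fun z => lowStep n M (brickIdx S z)) < ∞ := fun M =>
    (h₁ M).trans_lt hC₁.lt_top
  have hy : ∀ m, carlesonENorm S p' q' (fun z => layer S m (brickIdx (n := n) S z)) < ∞ := fun m =>
    (h₂ m).trans_lt hC₂.lt_top
  refine not_surjective_of_escaping L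
    (x := fun M => NSpace.of S _ (measurable_comp_brickIdx S (lowStep n M)) (hx M))
    (y := fun m => CSpace.of S _ (measurable_comp_brickIdx S (layer S m)) (hy m))
    (K := C₂.toReal) (fun m => ?_) (fun M m hMm => ?_) fun g => ?_
  · rw [CSpace.norm_of]
    exact ENNReal.toReal_mono hC₂ (h₂ m)
  · rw [(hL _ _).2, ← integral_lowStep_mul_layer (n := n) S hMm]
    refine integral_congr_ae ?_
    filter_upwards [NSpace.coe_of (measurable_comp_brickIdx S (lowStep n M)) (hx M),
      CSpace.coe_of (measurable_comp_brickIdx S (layer S m)) (hy m)] with z h1 h2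
    rw [h1, h2]
  · have hae : ∀ M, (fun z => (NSpace.of S _ (measurable_comp_brickIdx S (lowStep n M)) (hx M)).1 z
        * g.1 z) =ᵐ[halfVol n] fun z => lowStep n M (brickIdx S z) * g.1 z := fun M => by
      filter_upwards [NSpace.coe_of (measurable_comp_brickIdx S (lowStep n M)) (hx M)] with z h1
      rw [h1]
    refine (tendsto_integral_low S g.measurable lowStep_nonneg lowStep_le
      (fun M R => lowStep_eq_zero) ((hL _ g).1.congr (hae 0))).congr fun M => ?_
    rw [(hL _ g).2, integral_congr_ae (hae M)]

/-! #### The case of integrable maximal functions -/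

open Classical in
/-- The multiple of the indicator function of the brick of scale `2 ^ (-m)` at the origin whose
maximal function has integral comparable to one, as a function of the brick. -/
noncomputable def spike (n : ℕ) (m : ℕ) (R : DyIndex n) : ℝ :=
  if R = ((-m : ℤ), 0) then (2 ^ m) ^ n else 0

open Classical in
/-- The function on the union of the bricks of scales at most `2 ^ (-M)` at the origin which is
inversely proportional to the height, as a function of the brick. -/
noncomputable def tower (S : Shape) (M : ℕ) (R : DyIndex n) : ℝ :=
  if R.1 ≤ -M ∧ R.2 = 0 then (aspect n S * 2 ^ R.1)⁻¹ else 0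

theorem spike_nonneg (m : ℕ) (R : DyIndex n) : 0 ≤ spike n m R := by
  unfold spike
  split_ifs <;> positivity

theorem tower_nonneg (S : Shape) (M : ℕ) (R : DyIndex n) : 0 ≤ tower S M R := by
  have hA := aspect_pos n S
  unfold tower
  split_ifs <;> positivity

theorem tower_le (S : Shape) (M : ℕ) (R : DyIndex n) : tower S M R ≤ tower S 0 R := by
  have hA := aspect_pos n S
  unfold tower
  split_ifs with h1 h2 h2
  · rfl
  · exact absurd ⟨by push_cast; omega, h1.2⟩ h2
  · positivity
  · rfl

theorem tower_eq_zero (S : Shape) {M : ℕ} {R : DyIndex n} (h : -R.1 < M) : tower S M R = 0 :=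
  if_neg fun h' => by omega

theorem ofReal_spike_scale (n m : ℕ) :
    ENNReal.ofReal ((2 ^ m) ^ n) * ENNReal.ofReal (2 ^ (-m : ℤ)) ^ n = 1 := by
  rw [← ENNReal.ofReal_pow (by positivity), ← ENNReal.ofReal_mul (by positivity), ← mul_pow,
    zpow_neg, zpow_natCast, mul_inv_cancel₀ (by positivity), one_pow, ENNReal.ofReal_one]

theorem exists_ntENorm_spike_le (n : ℕ) (S : Shape) {q : ℝ≥0∞} (hq : 1 ≤ q) :
    ∃ C : ℝ≥0∞, C ≠ ∞ ∧ ∀ m, ntENorm S 1 q (fun z => spike n m (brickIdx S z)) ≤ C := by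
  obtain ⟨C, hC, h⟩ := exists_ntENorm_equiv n S le_rfl hq
  refine ⟨C, hC, fun m => (h _ (measurable_comp_brickIdx S _)).1.trans ?_⟩
  rw [enorm_brickAvg_of_nonneg S hq (spike_nonneg m), eLpNorm_one_eq_lintegral_enorm]
  refine mul_le_of_le_one_right' ?_
  calc ∫⁻ x, ‖scaleSup (dyStep fun R => ENNReal.ofReal (spike n m R)) x‖ₑ
      ≤ ∫⁻ x, ENNReal.ofReal ((2 ^ m) ^ n) * cubeInd n (-m) x := by
        refine lintegral_mono fun x => ?_
        rw [enorm_eq_self]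
        refine iSup_le fun k => ?_
        simp only [dyStep, spike]
        split_ifs with hR
        · obtain ⟨rfl, hx⟩ := Prod.ext_iff.1 hR
          rw [cubeInd, indicator_of_mem (show x ∈ dyCube (-m : ℤ) 0 from hx), mul_one]
        · simp
    _ = 1 := by
        rw [lintegral_const_mul _ (measurable_cubeInd _), lintegral_cubeInd, ofReal_spike_scale]

/-- Over a cube of scale `i`, the integrals of the indicator functions of the smaller cubes at the
origin form a series dominated by a geometric one. For `n = 0` all of them would be one. -/
theorem dyCarleson_cubeInd_le (hn : 1 ≤ n) (x : Eucl n) : dyCarleson (cubeInd n) x ≤ 2 := by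
  refine iSup_le fun i => ?_
  have h2i : (0 : ℝ) < 2 ^ i := by positivity
  have hvol : ∫⁻ y, lowerSum (cubeInd n) i y ≤ 2 * ENNReal.ofReal (2 ^ i) ^ n := by
    simp only [lowerSum]
    rw [lintegral_tsum fun k => (show Measurable fun x => if k ≤ i then cubeInd n k x else 0 by
      split_ifs
      exacts [measurable_cubeInd k, measurable_const]).aemeasurable]
    have hinj : Function.Injective fun j : ℕ => i - (j : ℤ) := fun a b h => by
      simpa using h
    rw [← hinj.tsum_eq]
    · calc ∑' j : ℕ, ∫⁻ y, (if i - (j : ℤ) ≤ i then cubeInd n (i - j) y else 0)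
          ≤ ∑' j : ℕ, (2⁻¹ : ℝ≥0∞) ^ j * ENNReal.ofReal (2 ^ i) ^ n := by
            refine ENNReal.tsum_le_tsum fun j => ?_
            have hj : i - (j : ℤ) ≤ i := by omega
            simp only [hj, if_true, lintegral_cubeInd]
            rw [zpow_sub₀ two_ne_zero, zpow_natCast, div_eq_mul_inv, mul_comm,
              ENNReal.ofReal_mul (by positivity), mul_pow, ← inv_pow,
              ENNReal.ofReal_pow (by positivity), ENNReal.ofReal_inv_of_pos two_pos,
              ENNReal.ofReal_ofNat]
            have h2 : (2⁻¹ : ℝ≥0∞) ≤ 1 := ENNReal.inv_le_one.2 one_le_two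
            exact mul_le_mul_left (pow_le_of_le_one zero_le (pow_le_one₀ zero_le h2) (by omega)) _
        _ = 2 * ENNReal.ofReal (2 ^ i) ^ n := by
            rw [ENNReal.tsum_mul_right, ENNReal.tsum_geometric, ENNReal.one_sub_inv_two, inv_inv]
    · intro k hk
      by_contra hk'
      refine hk ?_
      have : ¬ k ≤ i := fun h => hk' ⟨(i - k).toNat, by simp only; omega⟩
      simp [this]
  change dyMean _ _ ≤ 2
  rw [dyMean, volume_dyCube, mul_comm, ← div_eq_mul_inv]
  refine ENNReal.div_le_of_le_mul ((setLIntegral_le_lintegral _ _).trans hvol)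

theorem exists_carlesonENorm_tower_le (hn : 1 ≤ n) (S : Shape) {q : ℝ≥0∞} (hq : 1 ≤ q) :
    ∃ C : ℝ≥0∞, C ≠ ∞ ∧ ∀ M, carlesonENorm S ∞ q (fun z => tower S M (brickIdx (n := n) S z)) ≤ C := by
  obtain ⟨C, hC, h⟩ := exists_carlesonENorm_equiv n S le_top hq
  refine ⟨C * 2, ENNReal.mul_ne_top hC (by simp), fun M =>
    (h _ (measurable_comp_brickIdx S _)).1.trans ?_⟩
  rw [enorm_brickAvg_of_nonneg S hq (tower_nonneg S M), eLpNorm_exponent_top]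
  gcongr
  refine essSup_le_of_ae_le _ (ae_of_all _ fun x => ?_)
  simp only [enorm_eq_self]
  refine le_trans (dyCarleson_mono (fun k y => ?_) x) (dyCarleson_cubeInd_le hn x)
  simp only [weightedStep, dyStep, tower]
  split_ifs with hR
  · rw [ofReal_thickness_inv, cubeInd, indicator_of_mem (show y ∈ dyCube _ _ from hR.2)]
  · simp

theorem integral_spike_mul_tower (S : Shape) {M m : ℕ} (h : M ≤ m) :
    ∫ z, spike n m (brickIdx S z) * tower S M (brickIdx S z) ∂(halfVol n) = 1 := by
  rw [integral_comp_brickIdx S (spike_nonneg m) (tower_nonneg S M),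
    tsum_eq_single ((-m, 0) : DyIndex n) fun R hR => by simp [spike, hR]]
  rw [spike, if_pos rfl, tower, if_pos ⟨by simpa using h, rfl⟩, volume_brick, volume_dyCube]
  calc _ = ((thickness n S (-m) * ENNReal.ofReal (aspect n S * 2 ^ (-m : ℤ))⁻¹) *
      (ENNReal.ofReal ((2 ^ m) ^ n) * ENNReal.ofReal (2 ^ (-m : ℤ)) ^ n)).toReal := by
        congr 1
        ring
    _ = 1 := by rw [ofReal_thickness_inv, ofReal_spike_scale, one_mul, ENNReal.toReal_one]

/-- Not every functional on `C_{∞,q'}` is given by a function in `N_{1,q}`: the spikes escape to the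
boundary, but keep the integral one against every tower. -/
theorem not_surjective_pairing_flip (hn : 1 ≤ n) {S : Shape} {q q' : ℝ≥0∞} [Fact (1 ≤ q)]
    [Fact (1 ≤ q')] [Fact ((1 : ℝ≥0∞) ≤ 1)] [Fact ((1 : ℝ≥0∞) ≤ ∞)]
    {L' : NSpace n S 1 q →L[ℝ] StrongDual ℝ (CSpace n S ∞ q')}
    (hL' : ∀ (f : NSpace n S 1 q) (g : CSpace n S ∞ q'),
        Integrable (fun z => f.1 z * g.1 z) (halfVol n) ∧
          L' f g = ∫ z, f.1 z * g.1 z ∂(halfVol n)) : ¬ Function.Surjective L' := by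
  obtain ⟨C₁, hC₁, h₁⟩ := exists_ntENorm_spike_le n S (q := q) Fact.out
  obtain ⟨C₂, hC₂, h₂⟩ := exists_carlesonENorm_tower_le hn S (q := q') Fact.out
  have hy : ∀ m, ntENorm S 1 q (fun z => spike n m (brickIdx S z)) < ∞ := fun m =>
    (h₁ m).trans_lt hC₁.lt_top
  have hx : ∀ M, carlesonENorm S ∞ q' (fun z => tower S M (brickIdx (n := n) S z)) < ∞ := fun M =>
    (h₂ M).trans_lt hC₂.lt_top
  refine not_surjective_of_escaping L'
    (x := fun M => CSpace.of S _ (measurable_comp_brickIdx S (tower S M)) (hx M))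
    (y := fun m => NSpace.of S _ (measurable_comp_brickIdx S (spike n m)) (hy m))
    (K := C₁.toReal) (fun m => ?_) (fun M m hMm => ?_) fun f => ?_
  · rw [NSpace.norm_of]
    exact ENNReal.toReal_mono hC₁ (h₁ m)
  · rw [(hL' _ _).2, ← integral_spike_mul_tower (n := n) S hMm]
    refine integral_congr_ae ?_
    filter_upwards [CSpace.coe_of (measurable_comp_brickIdx S (tower S M)) (hx M),
      NSpace.coe_of (measurable_comp_brickIdx S (spike n m)) (hy m)] with z h1 h2
    rw [h1, h2]
  · have hae : ∀ M, (fun z => f.1 z *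
        (CSpace.of S _ (measurable_comp_brickIdx S (tower S M)) (hx M)).1 z)
        =ᵐ[halfVol n] fun z => tower S M (brickIdx S z) * f.1 z := fun M => by
      filter_upwards [CSpace.coe_of (measurable_comp_brickIdx S (tower S M)) (hx M)] with z h1
      rw [h1, mul_comm]
    refine (tendsto_integral_low S f.measurable (tower_nonneg S) (tower_le S)
      (fun M R => tower_eq_zero S) ((hL' f _).1.congr (hae 0))).congr fun M => ?_
    rw [(hL' f _).2, integral_congr_ae (hae M)]

end Proper

section Functionals

variable {n : ℕ}

/-! ### Dominated convergence in Carleson spaces -/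

theorem carlesonENorm_mono (S : Shape) (r s : ℝ≥0∞) {f g : ℝ × Eucl n → ℝ}
    (h : ∀ᵐ z ∂(halfVol n), ‖f z‖ₑ ≤ ‖g z‖ₑ) : carlesonENorm S r s f ≤ carlesonENorm S r s g := by
  refine eLpNorm_mono_ennreal fun y => iSup_mono fun v => iSup_mono fun l => iSup_mono fun _ => ?_
  gcongr with w
  unfold whitneyAvg
  gcongr
  exact eLpNorm_mono_enorm_ae (h.filter_mono (ae_mono (restrict_le S w)))

/-- Measurable functions of finite norm in `C_{r,s}`. -/
def MemC (S : Shape) (r s : ℝ≥0∞) (g : ℝ × Eucl n → ℝ) : Prop :=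
  Measurable g ∧ carlesonENorm S r s g < ∞

theorem MemC.of_le {S : Shape} {r s : ℝ≥0∞} {f g : ℝ × Eucl n → ℝ} (hg : MemC S r s g)
    (hf : Measurable f) (h : ∀ z, |f z| ≤ |g z|) : MemC S r s f :=
  ⟨hf, (carlesonENorm_mono S r s (ae_of_all _ fun z => enorm_le_iff_norm_le.2 (h z))).trans_lt hg.2⟩

theorem MemC.const_mul {S : Shape} {r s : ℝ≥0∞} {g : ℝ × Eucl n → ℝ} (hg : MemC S r s g) (c : ℝ) :
    MemC S r s fun z => c * g z := by
  refine ⟨hg.1.const_mul c, ?_⟩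
  change carlesonENorm S r s (c • g) < ∞
  rw [carlesonENorm_smul]
  exact ENNReal.mul_lt_top ENNReal.ofReal_lt_top hg.2

theorem MemC.add {S : Shape} {r s : ℝ≥0∞} (hr : 1 ≤ r) (hs : 1 ≤ s) {f g : ℝ × Eucl n → ℝ}
    (hf : MemC S r s f) (hg : MemC S r s g) : MemC S r s fun z => f z + g z :=
  ⟨hf.1.add hg.1, (carlesonENorm_add_le S hr hs hf.1.aestronglyMeasurable
    hg.1.aestronglyMeasurable).trans_lt (ENNReal.add_lt_top.2 ⟨hf.2, hg.2⟩)⟩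

theorem MemC.eLpNorm_lt_top {S : Shape} {r s : ℝ≥0∞} (hr : 1 ≤ r) (hs : 1 ≤ s)
    {g : ℝ × Eucl n → ℝ} (hg : MemC S r s g) :
    eLpNorm (dyCarleson (weightedStep S (brickAvg S s g))) r volume < ∞ := by
  obtain ⟨C, hC, h⟩ := exists_carlesonENorm_equiv n S hr hs
  exact (h g hg.1).2.trans_lt (ENNReal.mul_lt_top hC.lt_top hg.2)

theorem MemC.eLpNorm_brick_lt_top {S : Shape} {r s : ℝ≥0∞} (hr : 1 ≤ r) (hs : 1 ≤ s)
    {g : ℝ × Eucl n → ℝ} (hg : MemC S r s g) (R : DyIndex n) :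
    eLpNorm g s (volume.restrict (brick S R)) < ∞ := by
  have hr0 : r ≠ 0 := (zero_lt_one.trans_le hr).ne'
  have h1 := (dyConst_weightedStep S (brickAvg S s g) R.1).lt_top (by
    filter_upwards [ae_lt_top_of_eLpNorm hr0 (measurable_dyCarleson _)
      (hg.eLpNorm_lt_top hr hs)] with x hx
    exact (le_dyCarleson (dyConst_weightedStep S _) R.1 x).trans_lt hx) (dyCorner R.1 R.2)
  rw [weightedStep, dyStep, dyIdx_corner] at h1
  have h2 : brickAvg S s g R < ∞ :=
    ENNReal.lt_top_of_mul_ne_top_right h1.ne (thickness_ne_zero S _)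
  rw [eLpNorm_eq_brickAvg]
  exact ENNReal.mul_lt_top (ENNReal.rpow_ne_top_of_nonneg ENNReal.toReal_nonneg
    (volume_brick_ne_top S R)).lt_top h2

/-- **Dominated convergence** in `C_{r,s}`, for finite exponents. -/
theorem tendsto_carlesonENorm_of_dominated (S : Shape) {r r' s : ℝ≥0∞} (h : r⁻¹ + r'⁻¹ = 1)
    (hr : 1 < r) (hrt : r ≠ ∞) (hs : 1 ≤ s) (hst : s ≠ ∞) {G : ℕ → ℝ × Eucl n → ℝ}
    {g : ℝ × Eucl n → ℝ} (hg : MemC S r s g) (hG : ∀ m, Measurable (G m))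
    (hle : ∀ m z, |G m z| ≤ |g z|) (hlim : ∀ z, Tendsto (fun m => G m z) atTop (𝓝 0)) :
    Tendsto (fun m => carlesonENorm S r s (G m)) atTop (𝓝 0) := by
  have hs0 : s ≠ 0 := (zero_lt_one.trans_le hs).ne'
  obtain ⟨C, hC, hequiv⟩ := exists_carlesonENorm_equiv n S hr.le hs
  have hbrick : ∀ R, Tendsto (fun m => brickAvg S s (G m) R) atTop (𝓝 0) := by
    intro R
    have h1 := tendsto_eLpNorm_of_dominated (μ := volume.restrict (brick S R)) hs0 hst
      (G := fun m z => ‖G m z‖ₑ) (H := fun z => ‖g z‖ₑ) (fun m => (hG m).enorm)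
      (fun m z => enorm_le_iff_norm_le.2 (hle m z))
      (by rw [eLpNorm_enorm]; exact hg.eLpNorm_brick_lt_top hr.le hs R)
      (ae_of_all _ fun z => by simpa using (hlim z).enorm)
    simp only [eLpNorm_enorm] at h1
    have h2 := ENNReal.Tendsto.const_mul (a := volume (brick S R) ^ (-(s⁻¹).toReal)) h1
      (Or.inr (ENNReal.rpow_ne_top_of_ne_zero (volume_brick_ne_zero S R) (volume_brick_ne_top S R)))
    rwa [mul_zero] at h2
  have hdy := tendsto_eLpNorm_dyCarleson h hr hrt
    (c := fun m => weightedStep S (brickAvg S s (G m))) (d := weightedStep S (brickAvg S s g))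
    (fun m => dyConst_weightedStep S _) (dyConst_weightedStep S _) (fun m k x => by
      unfold weightedStep dyStep brickAvg
      gcongr
      exact eLpNorm_mono fun z => hle m z) (hg.eLpNorm_lt_top hr.le hs) (fun k x => by
      have h2 := ENNReal.Tendsto.const_mul (a := thickness n S k) (hbrick (k, dyIdx k x))
        (Or.inr (thickness_ne_top S k))
      rwa [mul_zero] at h2)
  have h3 := ENNReal.Tendsto.const_mul (a := C) hdy (Or.inr hC)
  rw [mul_zero] at h3
  exact tendsto_of_tendsto_of_tendsto_of_le_of_le tendsto_const_nhds h3 (fun _ => zero_le)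
    fun m => (hequiv _ (hG m)).1

/-! ### A positive function -/

open Classical in
/-- The indicator function of a brick lies in `C_{r,s}`. -/
theorem carlesonENorm_single_lt_top (S : Shape) {r r' s : ℝ≥0∞} (h : r⁻¹ + r'⁻¹ = 1) (hr : 1 < r)
    (hs : 1 ≤ s) (R : DyIndex n) :
    carlesonENorm S r s (fun z => if brickIdx S z = R then (1 : ℝ) else 0) < ∞ := by
  obtain ⟨C, hC, hc⟩ := exists_carlesonENorm_equiv n S hr.le hs
  obtain ⟨C', hC', hM⟩ := exists_eLpNorm_dyMax_le (n := n) h hr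
  set u : Eucl n → ℝ≥0∞ := (dyCube R.1 R.2).indicator fun _ => thickness n S R.1 with hu
  have hum : Measurable u := measurable_const.indicator (measurableSet_dyCube _ _)
  have hul : eLpNorm u r volume < ∞ := by
    refine (eLpNorm_indicator_const_le (thickness n S R.1) r).trans_lt (ENNReal.mul_lt_top ?_ ?_)
    · rw [enorm_eq_self]
      exact (thickness_ne_top S _).lt_top
    · exact (ENNReal.rpow_ne_top_of_nonneg (by positivity) (volume_dyCube_ne_top _ _)).lt_top
  set H : DyIndex n → ℝ := fun R' => if R' = R then 1 else 0 with hH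
  have hH0 : ∀ R', 0 ≤ H R' := fun R' => by
    simp only [hH]
    split_ifs <;> simp
  refine (hc _ (measurable_comp_brickIdx S H)).1.trans_lt (ENNReal.mul_lt_top hC.lt_top ?_)
  rw [enorm_brickAvg_of_nonneg S hs hH0]
  refine (eLpNorm_mono_ennreal fun x => iSup_mono fun i => dyAvg_mono i (fun y => ?_) x).trans_lt
    ((hM u hum).trans_lt (ENNReal.mul_lt_top hC'.lt_top hul))
  simp only [lowerSum]
  rw [tsum_eq_single R.1 fun k hk => by
    have : ((k, dyIdx k y) : DyIndex n) ≠ R := fun h => hk (congrArg Prod.fst h)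
    simp [weightedStep, dyStep, hH, this]]
  split_ifs
  swap
  · exact zero_le
  by_cases hy : y ∈ dyCube R.1 R.2
  · rw [hu, indicator_of_mem hy]
    refine mul_le_of_le_one_right' ?_
    simp only [dyStep, hH]
    split_ifs <;> simp
  · have : ((R.1, dyIdx R.1 y) : DyIndex n) ≠ R := fun h => hy (congrArg Prod.snd h)
    simp [weightedStep, dyStep, hH, this]

/-- There is a positive function in `C_{r,s}`: a sum of small multiples of the indicator functions of
all bricks. -/
theorem exists_pos_memC (n : ℕ) (S : Shape) {r r' s : ℝ≥0∞} (h : r⁻¹ + r'⁻¹ = 1) (hr : 1 < r)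
    (hs : 1 ≤ s) : ∃ ω : ℝ × Eucl n → ℝ, MemC S r s ω ∧ ∀ z, 0 < ω z := by
  classical
  obtain ⟨hden⟩ := nonempty_denumerable (DyIndex n)
  set e : DyIndex n ≃ ℕ := Denumerable.eqv (DyIndex n) with he
  set χ : ℕ → ℝ × Eucl n → ℝ := fun m z => if brickIdx S z = e.symm m then 1 else 0 with hχ
  set K : ℕ → ℝ≥0∞ := fun m => carlesonENorm S r s (χ m) with hK
  have hKfin : ∀ m, K m ≠ ∞ := fun m => (carlesonENorm_single_lt_top S h hr hs _).ne
  set δ : ℕ → ℝ := fun m => 2⁻¹ ^ m * (1 + (K m).toReal)⁻¹ with hδ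
  have hδ0 : ∀ m, 0 < δ m := fun m => by positivity
  have hωm : Measurable fun z => δ (e (brickIdx (n := n) S z)) :=
    measurable_comp_brickIdx S fun R => δ (e R)
  refine ⟨fun z => δ (e (brickIdx S z)), ⟨hωm, ?_⟩, fun z => hδ0 _⟩
  have hle : carlesonENorm S r s (fun z => δ (e (brickIdx S z)))
      ≤ ∑' m, carlesonENorm S r s (δ m • χ m) := by
    refine carlesonENorm_le_tsum S hr.le hs (fun m => Measurable.const_smul (measurable_comp_brickIdx S
      fun R => if R = e.symm m then (1 : ℝ) else 0) (δ m)) (ae_of_all _ fun z => ?_)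
    refine le_trans (le_of_eq ?_) (ENNReal.le_tsum (e (brickIdx S z)))
    simp [hχ]
  refine hle.trans_lt ?_
  have hterm : ∀ m, carlesonENorm S r s (δ m • χ m) ≤ 2⁻¹ ^ m := by
    intro m
    rw [carlesonENorm_smul, abs_of_pos (hδ0 m)]
    change ENNReal.ofReal (δ m) * K m ≤ _
    rw [← ENNReal.ofReal_toReal (hKfin m), ← ENNReal.ofReal_mul (hδ0 m).le]
    have h1 : δ m * (K m).toReal ≤ 2⁻¹ ^ m := by
      have hK0 : 0 ≤ (K m).toReal := ENNReal.toReal_nonneg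
      rw [hδ, mul_assoc]
      refine mul_le_of_le_one_right (by positivity) ?_
      rw [inv_mul_le_iff₀ (by positivity)]
      linarith
    refine (ENNReal.ofReal_le_ofReal h1).trans_eq ?_
    rw [ENNReal.ofReal_pow (by positivity), ENNReal.ofReal_inv_of_pos two_pos, ENNReal.ofReal_ofNat]
  refine (ENNReal.tsum_le_tsum hterm).trans_lt ?_
  rw [ENNReal.tsum_geometric, ENNReal.one_sub_inv_two, inv_inv]
  exact ENNReal.ofNat_lt_top

/-! ### Functionals on Carleson spaces -/

section Eval

variable {S : Shape} {r s : ℝ≥0∞} [Fact (1 ≤ r)] [Fact (1 ≤ s)]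

open Classical in
/-- A functional on `C_{r,s}`, as a function of functions rather than of their classes. It is zero
on functions which do not belong to the space. -/
noncomputable def evalC (Λ : StrongDual ℝ (CSpace n S r s)) (g : ℝ × Eucl n → ℝ) : ℝ :=
  if h : MemC S r s g then Λ (CSpace.of S g h.1 h.2) else 0

variable (Λ : StrongDual ℝ (CSpace n S r s))

theorem evalC_eq {g : ℝ × Eucl n → ℝ} (h : MemC S r s g) :
    evalC Λ g = Λ (CSpace.of S g h.1 h.2) := dif_pos h

theorem evalC_coe (g : CSpace n S r s) : evalC Λ g.1 = Λ g := by
  rw [evalC_eq Λ ⟨g.measurable, g.2⟩]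
  congr 1
  exact Subtype.ext (AEEqFun.ext (CSpace.coe_of g.measurable g.2))

theorem evalC_add {f g : ℝ × Eucl n → ℝ} (hf : MemC S r s f) (hg : MemC S r s g) :
    evalC Λ (fun z => f z + g z) = evalC Λ f + evalC Λ g := by
  rw [evalC_eq Λ (hf.add Fact.out Fact.out hg), evalC_eq Λ hf, evalC_eq Λ hg, ← map_add]
  rfl

theorem evalC_const_mul {g : ℝ × Eucl n → ℝ} (hg : MemC S r s g) (c : ℝ) :
    evalC Λ (fun z => c * g z) = c * evalC Λ g := by
  rw [evalC_eq Λ (hg.const_mul c), evalC_eq Λ hg, ← smul_eq_mul, ← map_smul]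
  rfl

theorem abs_evalC_le {g : ℝ × Eucl n → ℝ} (hg : MemC S r s g) :
    |evalC Λ g| ≤ ‖Λ‖ * (carlesonENorm S r s g).toReal := by
  rw [evalC_eq Λ hg, ← CSpace.norm_of hg.1 hg.2]
  exact Λ.le_opNorm _

/-- Functionals are continuous under dominated pointwise convergence. -/
theorem tendsto_evalC {r' : ℝ≥0∞} (h : r⁻¹ + r'⁻¹ = 1) (hr : 1 < r) (hrt : r ≠ ∞) (hst : s ≠ ∞)
    {G : ℕ → ℝ × Eucl n → ℝ} {f g : ℝ × Eucl n → ℝ} (hg : MemC S r s g) (hf : Measurable f)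
    (hG : ∀ m, Measurable (G m)) (hle : ∀ m z, |G m z| ≤ |g z|)
    (hlim : ∀ z, Tendsto (fun m => G m z) atTop (𝓝 (f z))) :
    Tendsto (fun m => evalC Λ (G m)) atTop (𝓝 (evalC Λ f)) := by
  have hfle : ∀ z, |f z| ≤ |g z| := fun z =>
    le_of_tendsto' (hlim z).abs fun m => hle m z
  have hfC := hg.of_le hf hfle
  have hGC : ∀ m, MemC S r s (G m) := fun m => hg.of_le (hG m) (hle m)
  have hdC : ∀ m, MemC S r s fun z => G m z + -1 * f z := fun m =>
    (hGC m).add Fact.out Fact.out (hfC.const_mul (-1))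
  have h1 := tendsto_carlesonENorm_of_dominated S h hr hrt Fact.out hst (hg.const_mul 2)
    (G := fun m z => G m z + -1 * f z) (fun m => (hdC m).1) (fun m z => by
      rw [abs_mul, abs_two, two_mul, neg_one_mul]
      refine (abs_add_le _ _).trans (add_le_add (hle m z) ?_)
      rw [abs_neg]
      exact hfle z) (fun z => by simpa using (hlim z).add_const (-f z))
  have h2 := (ENNReal.tendsto_toReal ENNReal.zero_ne_top).comp h1
  have h3 := h2.const_mul ‖Λ‖
  rw [ENNReal.toReal_zero, mul_zero] at h3
  refine tendsto_iff_norm_sub_tendsto_zero.2 (squeeze_zero (fun _ => norm_nonneg _) (fun m => ?_) h3)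
  have h4 : evalC Λ (G m) - evalC Λ f = evalC Λ fun z => G m z + -1 * f z := by
    rw [evalC_add Λ (hGC m) (hfC.const_mul (-1)), evalC_const_mul Λ hfC]
    ring
  rw [h4]
  exact abs_evalC_le Λ (hdC m)

end Eval

end Functionals

section Representation

variable {n : ℕ}

/-! ### Representation of functionals -/

instance sigmaFinite_halfVol : SigmaFinite (halfVol n) :=
  inferInstanceAs (SigmaFinite (volume.restrict (halfSpace n)))

variable {S : Shape} {r r' s : ℝ≥0∞} [Fact (1 ≤ r)] [Fact (1 ≤ s)]
  (Λ : StrongDual ℝ (CSpace n S r s))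

/-- Countable additivity of `E ↦ Λ (1_E ω)`. -/
theorem hasSum_evalC_indicator (h : r⁻¹ + r'⁻¹ = 1) (hr : 1 < r) (hrt : r ≠ ∞) (hst : s ≠ ∞)
    {ω : ℝ × Eucl n → ℝ} (hω : MemC S r s ω) {E : ℕ → Set (ℝ × Eucl n)}
    (hE : ∀ i, MeasurableSet (E i)) (hdisj : Pairwise (Function.onFun Disjoint E)) :
    HasSum (fun i => evalC Λ ((E i).indicator ω)) (evalC Λ ((⋃ i, E i).indicator ω)) := by
  have hle : ∀ (A : Set (ℝ × Eucl n)) z, |A.indicator ω z| ≤ |ω z| := fun A z =>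
    norm_indicator_le_norm_self (f := ω) (s := A) (a := z)
  have hmem : ∀ A, MeasurableSet A → MemC S r s (A.indicator ω) := fun A hA =>
    hω.of_le (hω.1.indicator hA) (hle A)
  have hfin : ∀ t : Finset ℕ, ∑ i ∈ t, evalC Λ ((E i).indicator ω)
      = evalC Λ ((⋃ i ∈ t, E i).indicator ω) := by
    intro t
    induction t using Finset.induction_on with
    | empty =>
      have := evalC_const_mul Λ hω 0
      simp only [zero_mul] at this
      simp only [Finset.sum_empty, Finset.notMem_empty, iUnion_of_empty, iUnion_empty,
        indicator_empty]
      exact this.symm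
    | insert i t hi ih =>
      rw [Finset.sum_insert hi, ih, ← evalC_add Λ (hmem _ (hE i))
        (hmem _ (Finset.measurableSet_biUnion _ fun j _ => hE j)), Finset.set_biUnion_insert]
      congr 1
      rw [indicator_union_of_disjoint]
      refine disjoint_iUnion₂_right.2 fun j hj => hdisj ?_
      rintro rfl
      exact hi hj
  rw [HasSum]
  simp only [SummationFilter.unconditional_filter]
  refine tendsto_of_seq_tendsto fun u hu => ?_
  simp only [Function.comp_def, hfin]
  refine tendsto_evalC Λ h hr hrt hst hω (hω.1.indicator (MeasurableSet.iUnion hE))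
    (fun m => hω.1.indicator (Finset.measurableSet_biUnion _ fun j _ => hE j))
    (fun m => hle _) fun z => ?_
  refine tendsto_const_nhds.congr' ?_
  by_cases hz : z ∈ ⋃ i, E i
  · obtain ⟨i, hi⟩ := mem_iUnion.1 hz
    filter_upwards [hu.eventually (eventually_ge_atTop {i})] with m hm
    rw [indicator_of_mem hz, indicator_of_mem]
    exact mem_iUnion₂.2 ⟨i, Finset.singleton_subset_iff.1 hm, hi⟩
  · refine Eventually.of_forall fun m => ?_
    simp only
    rw [indicator_of_notMem hz, indicator_of_notMem]
    exact fun h => hz (iUnion₂_subset_iUnion _ _ h)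

/-- A functional on `C_{r,s}` has a density against bounded multiples of a given positive function
`ω`: the Radon–Nikodym derivative of the signed measure `E ↦ Λ (1_E ω)`. -/
theorem exists_density (h : r⁻¹ + r'⁻¹ = 1) (hr : 1 < r) (hrt : r ≠ ∞) (hst : s ≠ ∞)
    {ω : ℝ × Eucl n → ℝ} (hω : MemC S r s ω) : ∃ ρ : ℝ × Eucl n → ℝ, Measurable ρ ∧
      Integrable ρ (halfVol n) ∧ ∀ E, MeasurableSet E →
        evalC Λ (E.indicator ω) = ∫ z in E, ρ z ∂(halfVol n) := by
  classical
  set σ : SignedMeasure (ℝ × Eucl n) :=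
    { measureOf' := fun E => if MeasurableSet E then evalC Λ (E.indicator ω) else 0
      empty' := by
        rw [if_pos MeasurableSet.empty, indicator_empty]
        have := evalC_const_mul Λ hω 0
        simpa only [zero_mul] using this
      not_measurable' := fun E hE => if_neg hE
      m_iUnion' := fun E hE hd => by
        simp only [hE, MeasurableSet.iUnion hE, if_true]
        exact hasSum_evalC_indicator Λ h hr hrt hst hω hE hd } with hσ
  have hσE : ∀ E, MeasurableSet E → σ E = evalC Λ (E.indicator ω) := fun E hE => if_pos hE
  -- on a null set, `1_E ω` is the zero element of the space
  have hac : σ ≪ᵥ (halfVol n).toENNRealVectorMeasure := by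
    intro E hE0
    by_cases hE : MeasurableSet E
    swap
    · exact if_neg hE
    rw [Measure.toENNRealVectorMeasure_apply_measurable hE] at hE0
    have hmem : MemC S r s (E.indicator ω) := hω.of_le (hω.1.indicator hE) fun z =>
      norm_indicator_le_norm_self (f := ω) (s := E) (a := z)
    have h0 : carlesonENorm S r s (E.indicator ω) = 0 := by
      have hz : E.indicator ω =ᵐ[halfVol n] (0 : ℝ) • ω := by
        rw [zero_smul]
        exact indicator_meas_zero hE0
      rw [carlesonENorm_congr S r s hz, carlesonENorm_smul]
      simp
    rw [hσE E hE]
    have h1 := abs_evalC_le Λ hmem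
    rw [h0, ENNReal.toReal_zero, mul_zero] at h1
    exact abs_eq_zero.1 (le_antisymm h1 (abs_nonneg _))
  refine ⟨σ.rnDeriv (halfVol n), SignedMeasure.measurable_rnDeriv _ _,
    SignedMeasure.integrable_rnDeriv _ _, fun E hE => ?_⟩
  rw [← hσE E hE, ← withDensityᵥ_apply (SignedMeasure.integrable_rnDeriv _ _) hE,
    SignedMeasure.withDensityᵥ_rnDeriv_eq _ _ hac]

/-- The density represents `Λ` on bounded multiples `b ω` of `ω`: by linearity if `b` is simple, and
by dominated convergence on either side in general. -/
theorem evalC_mul_eq_integral (h : r⁻¹ + r'⁻¹ = 1) (hr : 1 < r) (hrt : r ≠ ∞) (hst : s ≠ ∞)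
    {ω : ℝ × Eucl n → ℝ} (hω : MemC S r s ω) {ρ : ℝ × Eucl n → ℝ} (hρ : Integrable ρ (halfVol n))
    (hρE : ∀ E, MeasurableSet E → evalC Λ (E.indicator ω) = ∫ z in E, ρ z ∂(halfVol n))
    {b : ℝ × Eucl n → ℝ} (hb : Measurable b) {K : ℝ} (hbK : ∀ z, |b z| ≤ K) :
    evalC Λ (fun z => b z * ω z) = ∫ z, b z * ρ z ∂(halfVol n) := by
  have hsimple : ∀ φ : SimpleFunc (ℝ × Eucl n) ℝ,
      MemC S r s (fun z => φ z * ω z) ∧ Integrable (fun z => φ z * ρ z) (halfVol n) ∧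
        evalC Λ (fun z => φ z * ω z) = ∫ z, φ z * ρ z ∂(halfVol n) := by
    intro φ
    induction φ using SimpleFunc.induction with
    | const c hE =>
      rename_i E
      have h1 : ∀ f : ℝ × Eucl n → ℝ, (fun z => (SimpleFunc.piecewise E hE
          (SimpleFunc.const _ c) (SimpleFunc.const _ 0)) z * f z)
          = fun z => c * E.indicator f z := by
        intro f
        funext z
        by_cases hz : z ∈ E <;> simp [hz]
      have hmem : MemC S r s (E.indicator ω) := hω.of_le (hω.1.indicator hE) fun z =>
        norm_indicator_le_norm_self (f := ω) (s := E) (a := z)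
      rw [h1, h1]
      refine ⟨hmem.const_mul c, (hρ.indicator hE).const_mul c, ?_⟩
      rw [evalC_const_mul Λ hmem, hρE E hE, integral_const_mul, integral_indicator hE]
    | add _ hf hg =>
      rename_i f g _
      have h1 : ∀ u : ℝ × Eucl n → ℝ, (fun z => (f + g) z * u z)
          = fun z => f z * u z + g z * u z := by
        intro u
        funext z
        rw [SimpleFunc.add_apply, add_mul]
      rw [h1, h1]
      refine ⟨hf.1.add Fact.out Fact.out hg.1, hf.2.1.add hg.2.1, ?_⟩
      rw [evalC_add Λ hf.1 hg.1, hf.2.2, hg.2.2, integral_add hf.2.1 hg.2.1]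
  set φ : ℕ → SimpleFunc (ℝ × Eucl n) ℝ := SimpleFunc.approxOn b hb univ 0 (mem_univ 0) with hφ
  have hφK : ∀ m z, |φ m z| ≤ 2 * K := fun m z => by
    have := SimpleFunc.norm_approxOn_zero_le hb (mem_univ 0) z m
    rw [Real.norm_eq_abs, Real.norm_eq_abs] at this
    linarith [hbK z]
  have hφb : ∀ z, Tendsto (fun m => φ m z) atTop (𝓝 (b z)) := fun z =>
    SimpleFunc.tendsto_approxOn hb (mem_univ 0) (by simp)
  have hK : ∀ m z, |φ m z| ≤ |2 * K| := fun m z => (hφK m z).trans (le_abs_self _)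
  have h1 : Tendsto (fun m => evalC Λ fun z => φ m z * ω z) atTop
      (𝓝 (evalC Λ fun z => b z * ω z)) :=
    tendsto_evalC Λ h hr hrt hst (hω.const_mul (2 * K)) (hb.mul hω.1)
      (fun m => (φ m).measurable.mul hω.1)
      (fun m z => by
        rw [abs_mul, abs_mul]
        exact mul_le_mul_of_nonneg_right (hK m z) (abs_nonneg _))
      fun z => (hφb z).mul_const _
  have h2 : Tendsto (fun m => ∫ z, φ m z * ρ z ∂(halfVol n)) atTop
      (𝓝 (∫ z, b z * ρ z ∂(halfVol n))) := by
    refine tendsto_integral_of_dominated_convergence (fun z => ‖2 * K * ρ z‖)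
      (fun m => (hsimple (φ m)).2.1.aestronglyMeasurable) (hρ.const_mul _).norm
      (fun m => ae_of_all _ fun z => ?_) (ae_of_all _ fun z => (hφb z).mul_const _)
    rw [norm_mul, norm_mul]
    gcongr
    exact hK m z
  simp only [(hsimple (φ _)).2.2] at h1
  exact tendsto_nhds_unique h1 h2

/-- Every bounded functional on `C_{p',q'}` is the pairing with a function in `N_{p,q}`, if `p'` and
`q'` are finite and `p' > 1`. -/
theorem exists_representation {p p' q q' : ℝ≥0∞} [Fact (1 ≤ p')] [Fact (1 ≤ q')]
    (hp : p⁻¹ + p'⁻¹ = 1) (hq : q⁻¹ + q'⁻¹ = 1) (hpt : p ≠ ∞) (hp1 : 1 < p) (hq1 : 1 < q)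
    (Λ : StrongDual ℝ (CSpace n S p' q')) : ∃ f : ℝ × Eucl n → ℝ, Measurable f ∧
      ntENorm S p q f < ∞ ∧ ∀ g : CSpace n S p' q',
        Integrable (fun z => f z * g.1 z) (halfVol n) ∧
          Λ g = ∫ z, f z * g.1 z ∂(halfVol n) := by
  have hp' : p'⁻¹ + p⁻¹ = 1 := by rw [add_comm]; exact hp
  have hr := conj_gt_one hp hpt
  have hrt := conj_ne_top hp hp1
  have hst := conj_ne_top hq hq1
  obtain ⟨ω, hω, hω0⟩ := exists_pos_memC n S hp' hr (s := q') Fact.out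
  obtain ⟨ρ, hρm, hρ, hρE⟩ := exists_density Λ hp' hr hrt hst hω
  set f : ℝ × Eucl n → ℝ := fun z => ρ z / ω z with hf
  have hfm : Measurable f := hρm.div hω.1
  -- truncation at multiples of `ω`
  set trunc : (ℝ × Eucl n → ℝ) → ℕ → ℝ × Eucl n → ℝ := fun g m z =>
    if |g z| ≤ m * ω z then g z else 0 with htrunc
  have htm : ∀ g, Measurable g → ∀ m, Measurable (trunc g m) := fun g hg m =>
    Measurable.ite (measurableSet_le hg.abs (hω.1.const_mul _)) hg measurable_const
  have htle : ∀ g m z, |trunc g m z| ≤ |g z| := fun g m z => by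
    simp only [htrunc]
    split_ifs
    · rfl
    · simp
  have htω : ∀ g m z, |trunc g m z / ω z| ≤ m := fun g m z => by
    rw [abs_div, abs_of_pos (hω0 z), div_le_iff₀ (hω0 z)]
    simp only [htrunc]
    split_ifs with h1
    · exact h1
    · simpa using mul_nonneg (Nat.cast_nonneg m) (hω0 z).le
  have htlim : ∀ g z, ∀ᶠ m in atTop, trunc g m z = g z := fun g z => by
    obtain ⟨N, hN⟩ := exists_nat_ge (|g z| / ω z)
    filter_upwards [eventually_ge_atTop N] with m hm
    refine if_pos ?_
    rw [← div_le_iff₀ (hω0 z)]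
    exact hN.trans (by exact_mod_cast hm)
  have hrep : ∀ g, Measurable g → ∀ m,
      Integrable (fun z => f z * trunc g m z) (halfVol n) ∧
        evalC Λ (trunc g m) = ∫ z, f z * trunc g m z ∂(halfVol n) := by
    intro g hg m
    have h1 : (fun z => trunc g m z / ω z * ω z) = trunc g m :=
      funext fun z => div_mul_cancel₀ _ (hω0 z).ne'
    have h2 : (fun z => trunc g m z / ω z * ρ z) = fun z => f z * trunc g m z :=
      funext fun z => by
        simp only [hf]
        ring
    have hbm : Measurable fun z => trunc g m z / ω z := (htm g hg m).div hω.1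
    have h3 := evalC_mul_eq_integral Λ hp' hr hrt hst hω hρ hρE hbm (htω g m)
    rw [h1, h2] at h3
    refine ⟨?_, h3⟩
    rw [← h2]
    exact hρ.bdd_mul hbm.aestronglyMeasurable (ae_of_all _ (htω g m))
  -- `f` is normed by functions `g` with `0 ≤ f g`, whose truncations are already represented
  have hfN : ntENorm S p q f < ∞ := by
    obtain ⟨C, hC, hnorm⟩ := exists_norming_of_lt_ntENorm n S hp hq hpt
    suffices ntENorm S p q f ≤ C * (ENNReal.ofReal ‖Λ‖ * C) from
      this.trans_lt (ENNReal.mul_lt_top hC.lt_top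
        (ENNReal.mul_lt_top ENNReal.ofReal_lt_top hC.lt_top))
    refine le_of_forall_lt fun T hT => ?_
    obtain ⟨T', hTT', hT'⟩ := exists_between hT
    obtain ⟨g, hg, hfg, hgC, hgT⟩ := hnorm f hfm T' hT'
    refine hTT'.trans_le (hgT.trans ?_)
    gcongr
    have hgmem : MemC S p' q' g := ⟨hg, hgC.trans_lt hC.lt_top⟩
    have hbd : ∀ m, ∫⁻ z, ‖f z‖ₑ * ‖trunc g m z‖ₑ ∂(halfVol n) ≤ ENNReal.ofReal ‖Λ‖ * C := by
      intro m
      have hmem := hgmem.of_le (htm g hg m) (htle g m)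
      rw [lintegral_mul_eq_pairing EventuallyEq.rfl EventuallyEq.rfl (fun z => by
        simp only [htrunc]
        split_ifs
        · exact hfg z
        · simp) (hrep g hg m).1, ← (hrep g hg m).2]
      calc ENNReal.ofReal (evalC Λ (trunc g m))
          ≤ ENNReal.ofReal (‖Λ‖ * (carlesonENorm S p' q' (trunc g m)).toReal) :=
            ENNReal.ofReal_le_ofReal ((le_abs_self _).trans (abs_evalC_le Λ hmem))
        _ = ENNReal.ofReal ‖Λ‖ * carlesonENorm S p' q' (trunc g m) := by
            rw [ENNReal.ofReal_mul (norm_nonneg _), ENNReal.ofReal_toReal hmem.2.ne]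
        _ ≤ ENNReal.ofReal ‖Λ‖ * C := by
            gcongr
            exact (carlesonENorm_mono S p' q' (ae_of_all _ fun z =>
              enorm_le_iff_norm_le.2 (htle g m z))).trans hgC
    calc ∫⁻ z, ‖f z‖ₑ * ‖g z‖ₑ ∂(halfVol n)
        = ∫⁻ z, liminf (fun m => ‖f z‖ₑ * ‖trunc g m z‖ₑ) atTop ∂(halfVol n) := by
          refine lintegral_congr fun z => (Tendsto.liminf_eq (tendsto_const_nhds.congr' ?_)).symm
          filter_upwards [htlim g z] with m hm
          rw [hm]
      _ ≤ liminf (fun m => ∫⁻ z, ‖f z‖ₑ * ‖trunc g m z‖ₑ ∂(halfVol n)) atTop :=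
          lintegral_liminf_le fun m => hfm.enorm.mul (htm g hg m).enorm
      _ ≤ _ := liminf_le_of_frequently_le' (Frequently.of_forall hbd)
  refine ⟨f, hfm, hfN, fun g => ?_⟩
  obtain ⟨C, hC, hpair⟩ := exists_lintegral_mul_le n S hp hq
  have hint : Integrable (fun z => f z * g.1 z) (halfVol n) := by
    refine ⟨(hfm.mul g.measurable).aestronglyMeasurable, ?_⟩
    simp only [HasFiniteIntegral, enorm_mul]
    exact (hpair f g.1 hfm g.measurable).trans_lt (ENNReal.mul_lt_top
      (ENNReal.mul_lt_top hC.lt_top hfN) g.2)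
  refine ⟨hint, ?_⟩
  have h1 : Tendsto (fun m => evalC Λ (trunc g.1 m)) atTop (𝓝 (evalC Λ g.1)) :=
    tendsto_evalC Λ hp' hr hrt hst ⟨g.measurable, g.2⟩ g.measurable (htm g.1 g.measurable)
      (htle g.1) fun z => tendsto_const_nhds.congr' ((htlim g.1 z).mono fun m hm => hm.symm)
  have h2 : Tendsto (fun m => ∫ z, f z * trunc g.1 m z ∂(halfVol n)) atTop
      (𝓝 (∫ z, f z * g.1 z ∂(halfVol n))) := by
    refine tendsto_integral_of_dominated_convergence (fun z => ‖f z * g.1 z‖)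
      (fun m => (hrep g.1 g.measurable m).1.aestronglyMeasurable) hint.norm
      (fun m => ae_of_all _ fun z => ?_) (ae_of_all _ fun z =>
        tendsto_const_nhds.congr' ((htlim g.1 z).mono fun m hm => by simp only [hm]))
    rw [norm_mul, norm_mul]
    gcongr
    exact htle g.1 m z
  simp only [(hrep g.1 g.measurable _).2] at h1
  rw [← evalC_coe Λ g]
  exact tendsto_nhds_unique h1 h2

end Representation

/-! ### Failure of reflexivity -/

/-- A Banach space is not reflexive if its dual contains a proper closed subspace which separates
the points of the space. -/
theorem not_reflexive_of_separating {E F : Type*} [NormedAddCommGroup E] [NormedSpace ℝ E]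
    [NormedAddCommGroup F] [NormedSpace ℝ F] [CompleteSpace F] (L : F →L[ℝ] StrongDual ℝ E)
    {K : ℝ≥0} (hL : AntilipschitzWith K L) (hns : ¬ Function.Surjective L)
    (hsep : ∀ x : E, (∀ y, L y x = 0) → x = 0) :
    ¬ Function.Surjective (NormedSpace.inclusionInDoubleDual ℝ E) := by
  intro hJ
  obtain ⟨η, hη⟩ := not_forall.1 hns
  have hclosed : IsClosed (range L) := hL.isClosed_range L.uniformContinuous
  have hconv : Convex ℝ (range L) := by
    rintro _ ⟨a, rfl⟩ _ ⟨b, rfl⟩ s t - - -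
    exact ⟨s • a + t • b, by simp⟩
  obtain ⟨ξ, u, hu, huη⟩ := geometric_hahn_banach_closed_point hconv hclosed hη
  -- a functional bounded above on a subspace vanishes there
  have hzero : ∀ y, ξ (L y) = 0 := by
    intro y
    have hu0 : 0 < u := by simpa using hu (L 0) ⟨0, rfl⟩
    by_contra hne
    have h1 := hu (L ((u / ξ (L y)) • y)) ⟨_, rfl⟩
    rw [map_smul, map_smul, smul_eq_mul, div_mul_cancel₀ _ hne] at h1
    exact lt_irrefl _ h1
  obtain ⟨x, rfl⟩ := hJ ξ
  have hx : x = 0 := hsep x fun y => by simpa using hzero y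
  have hu0 : 0 < u := by simpa using hu (L 0) ⟨0, rfl⟩
  rw [hx, map_zero] at huη
  exact absurd huη (not_lt.2 hu0.le)

end CarlesonDuality

open CarlesonDuality in
theorem theorem3p2 (n : ℕ) (hn : 1 ≤ n) (S : CarlesonDuality.Shape) :
    (∀ (p p' q q' : ℝ≥0∞) [Fact (1 ≤ p)] [Fact (1 ≤ p')] [Fact (1 ≤ q)] [Fact (1 ≤ q')],
      p⁻¹ + p'⁻¹ = 1 → q⁻¹ + q'⁻¹ = 1 → p ≠ ∞ →
      CompleteSpace (CarlesonDuality.NSpace n S p q) ∧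
      CompleteSpace (CarlesonDuality.CSpace n S p' q') ∧
      ∃ (L : CarlesonDuality.CSpace n S p' q' →L[ℝ]
            StrongDual ℝ (CarlesonDuality.NSpace n S p q))
        (L' : CarlesonDuality.NSpace n S p q →L[ℝ]
            StrongDual ℝ (CarlesonDuality.CSpace n S p' q')),
        -- `L` and `L'` are the maps induced by the pairing `∬ f g`
        (∀ (f : CarlesonDuality.NSpace n S p q) (g : CarlesonDuality.CSpace n S p' q'),
          Integrable (fun z => f.1 z * g.1 z) (CarlesonDuality.halfVol n) ∧
          L g f = ∫ z, f.1 z * g.1 z ∂(CarlesonDuality.halfVol n) ∧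
          L' f g = ∫ z, f.1 z * g.1 z ∂(CarlesonDuality.halfVol n)) ∧
        -- they are isomorphisms onto their ranges
        (∃ K : ℝ≥0, AntilipschitzWith K L) ∧
        (∃ K : ℝ≥0, AntilipschitzWith K L') ∧
        -- strict inclusions, and equality
        ¬ Function.Surjective L ∧
        (p = 1 → ¬ Function.Surjective L') ∧
        (1 < q → 1 < p → Function.Surjective L')) ∧
    ¬ Function.Surjective
      (NormedSpace.inclusionInDoubleDual ℝ (CarlesonDuality.NSpace n S 2 2)) := by
  constructor
  · intro p p' q q' _ _ _ _ hp hq hpt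
    obtain ⟨L, hL⟩ := exists_pairing n S p p' q q' hp hq
    have hL' : ∀ (f : NSpace n S p q) (g : CSpace n S p' q'),
        Integrable (fun z => f.1 z * g.1 z) (halfVol n) ∧
          L.flip f g = ∫ z, f.1 z * g.1 z ∂(halfVol n) := hL
    refine ⟨(countablySubadditive_ntExtNorm S p q).completeSpace,
      (countablySubadditive_carlesonExtNorm S p' q').completeSpace, L, L.flip,
      fun f g => ⟨(hL f g).1, (hL f g).2, (hL f g).2⟩, antilipschitz_pairing hp hq hpt hL,
      antilipschitz_pairing_flip hp hq hpt hL', not_surjective_pairing hp hpt hL, ?_, ?_⟩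
    · intro hp1
      subst hp1
      obtain rfl := conj_one hp
      exact not_surjective_pairing_flip hn hL'
    · intro hq1 hp1 Λ
      obtain ⟨f, hf, hfN, h⟩ := exists_representation hp hq hpt hp1 hq1 Λ
      refine ⟨NSpace.of S f hf hfN, ContinuousLinearMap.ext fun g => ?_⟩
      rw [(hL' _ g).2, (h g).2]
      refine integral_congr_ae ?_
      filter_upwards [NSpace.coe_of hf hfN] with z hz
      rw [hz]
  · have h2 : (2 : ℝ≥0∞)⁻¹ + 2⁻¹ = 1 := ENNReal.inv_two_add_inv_two
    have h2t : (2 : ℝ≥0∞) ≠ ∞ := ENNReal.ofNat_ne_top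
    obtain ⟨L, hL⟩ := exists_pairing n S 2 2 2 2 h2 h2
    obtain ⟨K, hK⟩ := antilipschitz_pairing h2 h2 h2t hL
    obtain ⟨K', hK'⟩ := antilipschitz_pairing_flip h2 h2 h2t (L' := L.flip) hL
    have := (countablySubadditive_carlesonExtNorm (n := n) S 2 2).completeSpace
    refine not_reflexive_of_separating L hK (not_surjective_pairing h2 h2t hL) fun f hf => ?_
    refine hK'.injective ?_
    rw [map_zero]
    exact ContinuousLinearMap.ext hf
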